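/- Let $n\ge 0$, $d \ge 2$, $R \ge 1$ be integers and let $F_1,\dots,F_R\in\mathbb Z[x_1,\dots,x_n]$ be homogeneous forms of degree $d$. For a form $G\in\mathbb Z[x_1,\dots,x_n]$ of degree $d$ let $H_G(\mathbf x)=\left[\frac{\partial^2G}{\partial x_i\partial x_j}(\mathbf x)\right]_{1\le i,j\le n}$ be its Hessian matrix and put $$ \mathcal H_G=\begin{cases}\max_{0\le r\le n}\left(\dim\{\mathbf x\in\mathbb A^n_{\mathbb C}:\operatorname{rank}H_G(\mathbf x)\le r\}-r\right)&\text{if } d>2,\\ n-\operatorname{rank}H_G&\text{if } d=2.\end{cases} $$ (When $d=2$ the matrix $H_G$ is constant.) Let $$\sigma=\max_{\mathbf c\in\mathbb Z^R\setminus\{\mathbf 0\}}\mathcal H_{c_1F_1+\cdots+c_RF_R}.$$ Let $\mathcal B\subseteq[-1,1]^n$ be a box with sides parallel to the coordinate axes and of length at most $1$, and for $P>0$ and $\boldsymbol\alpha\in\mathbb R^R$ let $$S(\boldsymbol\alpha)=\sum_{\mathbf x\in P\mathcal B\cap\mathbb Z^n}\exp\left(2\pi i\sum_{\ell=1}^R\alpha_\ell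 F_\ell(\mathbf x)\right).$$ Then for all $P\ge1$, $\boldsymbol\alpha\in\mathbb R^R$ and $\eta\in(0,1)$, at least one of the following alternatives holds. (i) For every $\varepsilon>0$, $$|S(\boldsymbol\alpha)|\ll P^{\,n-\frac{(n-\sigma)\eta}{2^{d-1}}+\varepsilon},$$ where the implicit constant depends only on $d$, $n$ and $\varepsilon$. (ii) There exist $q,a_1,\dots,a_R\in\mathbb Z$ with $\gcd(q,a_1,\dots,a_R)=1$, $$1\le q\ll P^{R(d-1)\eta}\quad\text{and}\quad|q\alpha_\ell-a_\ell|\ll P^{-d+R(d-1)\eta}\quad(1\le\ell\le R),$$ where the implicit constants depend only on $d$, $n$, $R$ and the coefficients of $F_1,\dots,F_R$. -/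

import Mathlib

namespace BirchHessian

open scoped Pointwise

/-- The dimension of a subset `Z` of complex affine `n`-space: the Krull dimension of the
coordinate ring `ℂ[x₁, …, xₙ] / I(Z)`, where `I(Z)` is the ideal of polynomials vanishing on `Z`.
It is `⊥` for the empty set. -/
noncomputable def affineDim {n : ℕ} (Z : Set (Fin n → ℂ)) : WithBot ℕ∞ :=
  ringKrullDim (MvPolynomial (Fin n) ℂ ⧸ MvPolynomial.vanishingIdeal ℂ Z)

theorem affineDim_le {n : ℕ} (Z : Set (Fin n → ℂ)) : affineDim Z ≤ (n : WithBot ℕ∞) := by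
  have h := ringKrullDim_quotient_le (MvPolynomial.vanishingIdeal ℂ Z)
  rw [MvPolynomial.ringKrullDim_of_isNoetherianRing] at h
  simpa [affineDim] using h

theorem affineDim_univ (n : ℕ) : affineDim (Set.univ : Set (Fin n → ℂ)) = (n : WithBot ℕ∞) := by
  have h0 : MvPolynomial.vanishingIdeal ℂ (Set.univ : Set (Fin n → ℂ)) = ⊥ := by
    rw [eq_bot_iff]
    intro p hp
    rw [MvPolynomial.mem_vanishingIdeal_iff] at hp
    rw [Ideal.mem_bot]
    refine MvPolynomial.funext fun x => ?_
    simpa [MvPolynomial.aeval_eq_eval] using hp x (Set.mem_univ x)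
  rw [affineDim, h0, ringKrullDim_eq_of_ringEquiv (RingEquiv.quotientBot _),
    MvPolynomial.ringKrullDim_of_isNoetherianRing]
  simp

/-- `affineDim` is not `⊥` on nonempty sets, so on these (by `affineDim_le`) it is an honest
natural number. -/
theorem affineDim_nonneg {n : ℕ} {Z : Set (Fin n → ℂ)} (hZ : Z.Nonempty) :
    0 ≤ affineDim Z := by
  obtain ⟨x, hx⟩ := hZ
  have hne : MvPolynomial.vanishingIdeal ℂ Z ≠ ⊤ := by
    intro h
    have h1 : (1 : MvPolynomial (Fin n) ℂ) ∈ MvPolynomial.vanishingIdeal ℂ Z := by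
      rw [h]; trivial
    simpa using (MvPolynomial.mem_vanishingIdeal_iff.1 h1) x hx
  have := Ideal.Quotient.nontrivial_iff.2 hne
  exact ringKrullDim_nonneg_of_nontrivial

/-- The dimension as an integer, with the value `0` for the empty set. -/
noncomputable def affineDimInt {n : ℕ} (Z : Set (Fin n → ℂ)) : ℤ :=
  (((affineDim Z).unbotD 0).toNat : ℤ)

theorem affineDimInt_univ (n : ℕ) : affineDimInt (Set.univ : Set (Fin n → ℂ)) = n := by
  have h : affineDim (Set.univ : Set (Fin n → ℂ)) = (((n : ℕ∞)) : WithBot ℕ∞) :=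
    affineDim_univ n
  rw [affineDimInt, h, WithBot.unbotD_coe, ENat.toNat_natCast]

theorem affineDimInt_le {n : ℕ} (Z : Set (Fin n → ℂ)) : affineDimInt Z ≤ n := by
  have h : affineDim Z ≤ ((n : ℕ∞) : WithBot ℕ∞) := affineDim_le Z
  have h2 : (affineDim Z).unbotD 0 ≤ (n : ℕ∞) := WithBot.unbotD_le_iff (by simp) |>.2 h
  have h3 := ENat.toNat_le_toNat h2 (by simp)
  rw [ENat.toNat_natCast] at h3
  exact Int.ofNat_le.2 h3

theorem affineDim_eq_affineDimInt {n : ℕ} {Z : Set (Fin n → ℂ)} (hZ : Z.Nonempty) :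
    ∃ k : ℕ, affineDim Z = (k : WithBot ℕ∞) ∧ affineDimInt Z = k := by
  have h0 := affineDim_nonneg hZ
  have h1 := affineDim_le Z
  unfold affineDimInt
  generalize affineDim Z = D at h0 h1 ⊢
  induction D using WithBot.recBotCoe with
  | bot => simp at h0
  | coe D =>
    have h2 : D ≤ (n : ℕ∞) := by exact_mod_cast h1
    lift D to ℕ using ne_top_of_le_ne_top (ENat.natCast_ne_top n) h2
    exact ⟨D, rfl, by simp⟩

/-- The Hessian matrix `H_G(x) = [∂²G/∂xᵢ∂xⱼ (x)]` at a point `x` of complex affine space. -/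
noncomputable def hessian {n : ℕ} (G : MvPolynomial (Fin n) ℤ) (x : Fin n → ℂ) :
    Matrix (Fin n) (Fin n) ℂ :=
  Matrix.of fun i j =>
    MvPolynomial.aeval x (MvPolynomial.pderiv i (MvPolynomial.pderiv j G))

/-- The locus of points at which the Hessian of `G` has rank at most `r`. -/
def hessianLocus {n : ℕ} (G : MvPolynomial (Fin n) ℤ) (r : ℕ) : Set (Fin n → ℂ) :=
  {x | (hessian G x).rank ≤ r}

/-- The quantity `𝓗_G` of a form `G` of degree `d ≥ 2`. If `d > 2`, it is the maximum over
`0 ≤ r ≤ n` of `dim {x : rank H_G(x) ≤ r} - r` (these loci all contain the origin). If `d = 2`,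
the Hessian is constant and `𝓗_G` is `n - rank H_G`. -/
noncomputable def hessianInvariant {n : ℕ} (d : ℕ) (G : MvPolynomial (Fin n) ℤ) : ℤ :=
  if 2 < d then
    (Finset.range (n + 1)).sup' Finset.nonempty_range_add_one
      fun r => affineDimInt (hessianLocus G r) - (r : ℤ)
  else (n : ℤ) - ((hessian G 0).rank : ℤ)

theorem hessianInvariant_nonneg {n : ℕ} (d : ℕ) (G : MvPolynomial (Fin n) ℤ) :
    0 ≤ hessianInvariant d G := by
  unfold hessianInvariant
  split_ifs with h
  · refine le_trans ?_ (Finset.le_sup' (fun r : ℕ => affineDimInt (hessianLocus G r) - (r : ℤ))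
      (Finset.self_mem_range_succ n))
    have hu : hessianLocus G n = Set.univ :=
      Set.eq_univ_of_forall fun x => Matrix.rank_le_width (hessian G x)
    simp [hu, affineDimInt_univ]
  · have := Matrix.rank_le_width (hessian G 0)
    omega

theorem hessianInvariant_le {n : ℕ} (d : ℕ) (G : MvPolynomial (Fin n) ℤ) :
    hessianInvariant d G ≤ n := by
  unfold hessianInvariant
  split_ifs with h
  · refine Finset.sup'_le _ _ fun r _ => ?_
    have := affineDimInt_le (hessianLocus G r)
    omega
  · omega

/-- The linear combination `c.F = c₁F₁ + ⋯ + c_R F_R`. -/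
noncomputable def linComb {n R : ℕ} (F : Fin R → MvPolynomial (Fin n) ℤ) (c : Fin R → ℤ) :
    MvPolynomial (Fin n) ℤ :=
  ∑ l, c l • F l

/-- `σ = max 𝓗_{c.F}` over all nonzero integer vectors `c`. The supremum is attained, see
`isGreatest_sigma`. -/
noncomputable def sigma {n R : ℕ} (d : ℕ) (F : Fin R → MvPolynomial (Fin n) ℤ) : ℤ :=
  sSup {h : ℤ | ∃ c : Fin R → ℤ, c ≠ 0 ∧ h = hessianInvariant d (linComb F c)}

theorem isGreatest_sigma {n R : ℕ} (hR : 0 < R) (d : ℕ) (F : Fin R → MvPolynomial (Fin n) ℤ) :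
    IsGreatest {h : ℤ | ∃ c : Fin R → ℤ, c ≠ 0 ∧ h = hessianInvariant d (linComb F c)}
      (sigma d F) := by
  have hb : BddAbove {h : ℤ | ∃ c : Fin R → ℤ, c ≠ 0 ∧ h = hessianInvariant d (linComb F c)} := by
    refine ⟨n, ?_⟩
    rintro _ ⟨c, -, rfl⟩
    exact hessianInvariant_le d _
  refine ⟨Int.csSup_mem ⟨_, fun _ => 1, ?_, rfl⟩ hb, fun h hh => le_csSup hb hh⟩
  intro h
  simpa using congrFun h ⟨0, hR⟩

/-- A box contained in `[-1, 1]ⁿ`, with sides parallel to the coordinate axes and of length at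
most `1`: a product of intervals, each of which may be open, closed or half-open. -/
def IsBox {n : ℕ} (B : Set (Fin n → ℝ)) : Prop :=
  ∃ I : Fin n → Set ℝ,
    (∀ i, (I i).OrdConnected ∧ I i ⊆ Set.Icc (-1) 1 ∧ ∀ x ∈ I i, ∀ y ∈ I i, |x - y| ≤ 1) ∧
      B = Set.univ.pi I

/-- The integer points of the dilate `P𝓑`. -/
def latticePoints {n : ℕ} (B : Set (Fin n → ℝ)) (P : ℝ) : Set (Fin n → ℤ) :=
  {x | (fun i => (x i : ℝ)) ∈ P • B}

theorem latticePoints_finite {n : ℕ} {B : Set (Fin n → ℝ)} (hB : IsBox B) (P : ℝ) :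
    (latticePoints B P).Finite := by
  obtain ⟨I, hI, rfl⟩ := hB
  refine (Set.finite_Icc (fun _ : Fin n => -⌈|P|⌉) (fun _ => ⌈|P|⌉)).subset ?_
  rintro x ⟨y, hy, hxy⟩
  have key : ∀ i, |(x i : ℝ)| ≤ ⌈|P|⌉ := by
    intro i
    have h1 : (x i : ℝ) = P * y i := (congrFun hxy i).symm
    have h2 := (hI i).2.1 (hy i (Set.mem_univ i))
    rw [h1, abs_mul]
    calc |P| * |y i| ≤ |P| * 1 := by
          gcongr
          exact abs_le.2 h2
      _ ≤ ⌈|P|⌉ := by simpa using Int.le_ceil |P|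
  refine ⟨fun i => ?_, fun i => ?_⟩
  · have := (abs_le.1 (key i)).1
    exact_mod_cast this
  · have := (abs_le.1 (key i)).2
    exact_mod_cast this

/-- The exponential sum `S(α) = ∑ exp(2πi (α₁F₁(x) + ⋯ + α_R F_R(x)))` over the integer points `x`
of `P𝓑`; the sum is finite by `latticePoints_finite`. -/
noncomputable def expSum {n R : ℕ} (F : Fin R → MvPolynomial (Fin n) ℤ) (B : Set (Fin n → ℝ))
    (P : ℝ) (α : Fin R → ℝ) : ℂ :=
  ∑ᶠ x ∈ latticePoints B P,
    Complex.exp (2 * (Real.pi : ℂ) * Complex.I *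
      ((∑ l, α l * ((MvPolynomial.eval x (F l) : ℤ) : ℝ) : ℝ) : ℂ))

end BirchHessian

/-! ### Minors and rank; hyperplane sections of cones. -/

namespace BirchHessian

open MvPolynomial

/-! This is Birch's form of Weyl's inequality, with the dimension of a singular locus replaced by
the Hessian invariant. Write `d = e + 2`, and attach to a form `G` the values `apolar G (X i * ∏ j,
linForm (h j))`, which up to normalisation are its polarised multilinear forms with one argument
left free.

Weyl differencing, applied `d - 1` times to the phase `α.F`, leaves linear phases whose coefficients
are these multilinear forms for `α.F`. Hence `|S(α)| ^ 2 ^ (d - 1)` is bounded by the number of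
tuples `h` of size about `P` at which all of them are within about `P⁻¹` of integers. Davenport's
shrinking lemma, applied to one argument at a time, passes to tuples of size `2P^η` and distance
`P^(-d + (d - 1)η)` (`exists_weyl_bound`).

At such a tuple, each index `i` gives an integer vector in `ℤ^R`, whose entries are the values for
`F₁, …, F_R`, and its pairing with `α` is close to an integer. If these vectors span `ℚ^R`, Cramer's
rule gives the rational approximation (ii). Otherwise a nonzero `c` annihilates all of them, so
every tuple is an exact zero of the multilinear system of `c.F` (`exists_approx_or_annihilator`).

Such zeros are counted in `exists_card_multilinear_zeros_le`. Fix the last `d - 2` arguments: the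
first lies in the kernel of a matrix of some rank `r`, which leaves about `K^(n - r)` choices in a
box of size `K`. For `d > 2`, the tuples of rank at most `r` form a variety whose intersection with
the diagonal is the locus where the Hessian has rank at most `r`, of dimension at most `r + 𝓗`.
Cutting by the diagonal and by generic hyperplanes bounds the number of these tuples by `K^((d - 3)n
+ r + 𝓗)`. The product is `K^((d - 2)n + 𝓗)` for every `r`, and this gives (i). For `d = 2` the
matrix is the Hessian itself.

The constant in (i) must not depend on the forms. For this the counting is done for generic
coefficients over a Noetherian parameter ring (`exists_uniform_power`). -/

theorem exists_linearIndependent_rows {K m n : Type*} [Field K] [Fintype m] [Fintype n]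
    (A : Matrix m n K) {r : ℕ} (h : r ≤ A.rank) :
    ∃ f : Fin r → m, LinearIndependent K (A.submatrix f id).row := by
  rw [Matrix.rank_eq_finrank_span_row] at h
  obtain ⟨v, hv, -, hli⟩ := Submodule.exists_fun_fin_finrank_span_eq K (Set.range A.row)
  choose f hf using hv
  refine ⟨fun i => f (Fin.castLE h i), ?_⟩
  have h1 : (A.submatrix (fun i => f (Fin.castLE h i)) id).row = v ∘ Fin.castLE h :=
    funext fun i => hf _
  rw [h1]
  exact hli.comp (Fin.castLE h) (Fin.castLE_injective h)

theorem exists_submatrix_det_ne_zero {K m n : Type*} [Field K] [Fintype m] [Fintype n]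
    (A : Matrix m n K) {r : ℕ} (h : r ≤ A.rank) :
    ∃ (f : Fin r → m) (g : Fin r → n), (A.submatrix f g).det ≠ 0 := by
  obtain ⟨f, hf⟩ := exists_linearIndependent_rows A h
  have h2 : r ≤ (A.submatrix f id).transpose.rank := by
    rw [Matrix.rank_transpose, hf.rank_matrix, Fintype.card_fin]
  obtain ⟨g, hg⟩ := exists_linearIndependent_rows _ h2
  refine ⟨f, g, ?_⟩
  have h3 := Matrix.linearIndependent_rows_iff_isUnit.1 hg
  rw [Matrix.isUnit_iff_isUnit_det] at h3
  rw [← Matrix.det_transpose]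
  exact h3.ne_zero

/-- Together with the next lemma, this turns a rank condition into polynomial equations, the form in
which zeros are counted. -/
theorem rank_le_of_forall_det_eq_zero {K m n : Type*} [Field K] [Fintype m] [Fintype n]
    (A : Matrix m n K) {r : ℕ}
    (h : ∀ (f : Fin (r + 1) → m) (g : Fin (r + 1) → n), (A.submatrix f g).det = 0) :
    A.rank ≤ r := by
  by_contra! hr
  obtain ⟨f, g, hfg⟩ := exists_submatrix_det_ne_zero A (Nat.succ_le_of_lt hr)
  exact hfg (h f g)

theorem det_submatrix_eq_zero_of_rank_le {K m n : Type*} [Field K] [Fintype m] [Fintype n]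
    (A : Matrix m n K) {r : ℕ} (h : A.rank ≤ r) (f : Fin (r + 1) → m) (g : Fin (r + 1) → n) :
    (A.submatrix f g).det = 0 := by
  by_contra hdet
  have h1 := Matrix.rank_of_det_ne_zero hdet
  have h2 := Matrix.rank_submatrix_le A f g
  rw [Fintype.card_fin] at h1
  omega

/-- The linear form with coefficient vector `v`. -/
noncomputable def linForm {A σ : Type*} [CommSemiring A] [Fintype σ] (v : σ → A) :
    MvPolynomial σ A := ∑ i, C (v i) * X i

theorem eval_linForm {A σ : Type*} [CommSemiring A] [Fintype σ] (v x : σ → A) :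
    eval x (linForm v) = ∑ i, v i * x i := by
  simp [linForm]

theorem isHomogeneous_linForm {A σ : Type*} [CommSemiring A] [Fintype σ] (v : σ → A) :
    (linForm v).IsHomogeneous 1 :=
  IsHomogeneous.sum _ _ _ fun _ _ => isHomogeneous_C_mul_X _ _

theorem map_linForm {A B σ : Type*} [CommSemiring A] [CommSemiring B] [Fintype σ] (φ : A →+* B)
    (v : σ → A) : map φ (linForm v) = linForm (fun i => φ (v i)) := by
  simp [linForm]

theorem le_of_forall_X_mem {K σ : Type*} [Field K] {p q : Ideal (MvPolynomial σ K)}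
    (hp : ∀ i, X i ∈ p) (hpq : p ≤ q) (hq : q ≠ ⊤) : q ≤ p := by
  have hspan : Ideal.span (X '' (Set.univ : Set σ)) ≤ p := by
    rw [Ideal.span_le]
    rintro _ ⟨i, -, rfl⟩
    exact hp i
  intro f hf
  have h1 : f - C (coeff 0 f) ∈ p := by
    apply hspan
    classical
    rw [mem_ideal_span_X_image]
    intro m hm
    by_contra! hm0
    have : m = 0 := by
      ext i
      exact hm0 i trivial
    rw [mem_support_iff, this] at hm
    simp at hm
  have h2 : C (coeff 0 f) ∈ q := by
    have := q.sub_mem hf (hpq h1)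
    simpa using this
  have h3 : coeff 0 f = 0 := by
    by_contra h0
    exact hq (Ideal.eq_top_of_isUnit_mem _ h2 ((isUnit_iff_ne_zero.2 h0).map C))
  simpa [h3] using h1

/-- The linear forms lying in a given prime form a subspace of coefficient vectors, and over an
infinite field finitely many proper subspaces do not cover the space. So some linear form avoids
every minimal prime of `I` that does not contain all variables. A chain of primes over the enlarged
ideal can then be prolonged downwards by a minimal prime of `I`. A minimal prime containing all
variables does no harm: it is maximal, so no chain of positive length starts there. -/
theorem exists_linForm_krullDim_le {K : Type*} [Field K] [Infinite K] {n : ℕ}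
    (I : Ideal (MvPolynomial (Fin n) K)) (k : ℕ)
    (h : ringKrullDim (MvPolynomial (Fin n) K ⧸ I) ≤ (k + 1 : ℕ)) :
    ∃ v : Fin n → K,
      ringKrullDim (MvPolynomial (Fin n) K ⧸ (I ⊔ Ideal.span {linForm v})) ≤ k := by
  classical
  have hfin := I.finite_minimalPrimes_of_isNoetherianRing
  let L : (Fin n → K) →ₗ[K] MvPolynomial (Fin n) K :=
    { toFun := linForm
      map_add' := fun v w => by simp [linForm, add_mul, Finset.sum_add_distrib]
      map_smul' := fun c v => by simp [linForm, Finset.mul_sum, MvPolynomial.smul_eq_C_mul, mul_assoc] }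
  have hLX : ∀ i, L (Pi.single i 1) = X i := by
    intro i
    change linForm (Pi.single i (1 : K)) = X i
    rw [linForm, Finset.sum_eq_single i]
    · simp
    · intro j _ hj
      simp [hj]
    · simp
  let U : Ideal (MvPolynomial (Fin n) K) → Submodule K (Fin n → K) := fun p =>
    (p.restrictScalars K).comap L
  obtain ⟨v, hv⟩ : ∃ v : Fin n → K, ∀ p ∈ I.minimalPrimes, linForm v ∈ p → ∀ i, X i ∈ p := by
    have hT := Subspace.biUnion_ne_univ_of_top_notMem
      (s := (hfin.toFinset.image U).erase ⊤) (by simp)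
    rw [Set.ne_univ_iff_exists_notMem] at hT
    obtain ⟨v, hv⟩ := hT
    refine ⟨v, fun p hp hvp i => ?_⟩
    have hU : U p = ⊤ := by
      by_contra hne
      apply hv
      simp only [Set.mem_iUnion]
      refine ⟨U p, ?_, hvp⟩
      rw [Finset.mem_erase]
      exact ⟨hne, Finset.mem_image_of_mem _ (hfin.mem_toFinset.2 hp)⟩
    have : Pi.single i 1 ∈ U p := by rw [hU]; trivial
    have h2 : L (Pi.single i 1) ∈ p := this
    rwa [hLX] at h2
  refine ⟨v, ?_⟩
  rw [ringKrullDim_quotient] at h ⊢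
  refine iSup_le fun l => ?_
  rcases Nat.eq_zero_or_pos l.length with hl | hl
  · rw [hl]; exact_mod_cast Nat.zero_le k
  have hhead : I ⊔ Ideal.span {linForm v} ≤ l.head.1.asIdeal := l.head.2
  obtain ⟨p, hp, hp'⟩ := Ideal.exists_minimalPrimes_le (I := I) (J := l.head.1.asIdeal)
    (le_sup_left.trans hhead)
  let p' : PrimeSpectrum (MvPolynomial (Fin n) K) := ⟨p, hp.1.1⟩
  have hlt : p' < l.head.1 := by
    refine lt_of_le_of_ne hp' fun heq => ?_
    have hmem : linForm v ∈ p := by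
      have : linForm v ∈ l.head.1.asIdeal :=
        hhead (Ideal.mem_sup_right (Ideal.mem_span_singleton_self _))
      rwa [← heq] at this
    have hX := hv p hp hmem
    have h1 : l.head < l.last := l.strictMono (by
      rw [Fin.lt_def]; simpa using hl)
    have h2 : p' < l.last.1 := heq ▸ h1
    exact absurd (le_of_forall_X_mem hX h2.le l.last.1.isPrime.ne_top) (not_le_of_gt h2)
  have hsub : PrimeSpectrum.zeroLocus (↑(I ⊔ Ideal.span {linForm v}) : Set (MvPolynomial (Fin n) K))
      ⊆ PrimeSpectrum.zeroLocus (I : Set (MvPolynomial (Fin n) K)) :=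
    PrimeSpectrum.zeroLocus_anti_mono (le_sup_left : I ≤ I ⊔ Ideal.span {linForm v})
  let l' := l.map (Set.inclusion hsub) fun _ _ => id
  let P' : PrimeSpectrum.zeroLocus (I : Set (MvPolynomial (Fin n) K)) := ⟨p', hp.1.2⟩
  have hlt' : P' < l'.head := hlt
  have h3 := (Order.LTSeries.length_le_krullDim (l'.cons P' hlt')).trans h
  norm_cast at h3
  rw [RelSeries.cons_length] at h3
  have h4 : l'.length = l.length := rfl
  exact_mod_cast (by omega : l.length ≤ k)

theorem exists_linForms_krullDim_le_zero {K : Type*} [Field K] [Infinite K] {n : ℕ} (k : ℕ) :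
    ∀ I : Ideal (MvPolynomial (Fin n) K),
      ringKrullDim (MvPolynomial (Fin n) K ⧸ I) ≤ k →
      ∃ v : Fin k → Fin n → K, ringKrullDim (MvPolynomial (Fin n) K ⧸
        (I ⊔ Ideal.span (Set.range fun a => linForm (v a)))) ≤ 0 := by
  induction k with
  | zero =>
    intro I hI
    refine ⟨Fin.elim0, ?_⟩
    rw [Set.range_eq_empty, Ideal.span_empty, sup_bot_eq]
    exact_mod_cast hI
  | succ k ih =>
    intro I hI
    obtain ⟨w, hw⟩ := exists_linForm_krullDim_le I k hI
    obtain ⟨v, hv⟩ := ih _ hw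
    refine ⟨Fin.cons w v, ?_⟩
    have : (Set.range fun a => linForm ((Fin.cons w v : Fin (k + 1) → Fin n → K) a)) =
        {linForm w} ∪ Set.range fun a => linForm (v a) := by
      ext x
      simp only [Set.mem_range, Set.mem_union, Set.mem_singleton_iff, Fin.exists_fin_succ,
        Fin.cons_zero, Fin.cons_succ]
      tauto
    rw [this, Ideal.span_union, ← sup_assoc]
    exact hv

/-- A cone of dimension `k` meets a suitable intersection of `k` hyperplanes in the origin only. -/
theorem exists_linForms_of_cone {n k : ℕ} {Z : Set (Fin n → ℂ)} (hdim : affineDim Z ≤ k)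
    (hcone : ∀ x ∈ Z, ∀ t : ℂ, t • x ∈ Z) :
    ∃ v : Fin k → Fin n → ℂ, ∀ x ∈ Z, (∀ a, ∑ i, v a i * x i = 0) → x = 0 := by
  obtain ⟨v, hv⟩ := exists_linForms_krullDim_le_zero k (vanishingIdeal ℂ Z) hdim
  refine ⟨v, fun x hx hvx => ?_⟩
  by_contra hx0
  -- Restriction to the line through `x`. Its kernel is a prime above `J` strictly contained in the
  -- ideal of the origin, so a nonzero `x` would force dimension at least one.
  let φ : MvPolynomial (Fin n) ℂ →ₐ[ℂ] Polynomial ℂ :=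
    aeval fun i => Polynomial.C (x i) * Polynomial.X
  have hφ : ∀ f t, (φ f).eval t = eval (t • x) f := by
    intro f t
    change ((Polynomial.evalRingHom t).comp φ.toRingHom) f = _
    congr 1
    apply MvPolynomial.ringHom_ext
    · intro r
      change Polynomial.eval t (φ (C r)) = eval (t • x) (C r)
      rw [eval_C, ← algebraMap_eq, AlgHom.commutes]
      exact Polynomial.eval_C
    · intro i
      change Polynomial.eval t (φ (X i)) = eval (t • x) (X i)
      rw [aeval_X, eval_X, Polynomial.eval_mul, Polynomial.eval_C, Polynomial.eval_X,
        Pi.smul_apply, smul_eq_mul, mul_comm]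
  set J := vanishingIdeal ℂ Z ⊔ Ideal.span (Set.range fun a => linForm (v a)) with hJ
  have h1 : J ≤ RingHom.ker φ := by
    rw [hJ, sup_le_iff, Ideal.span_le]
    constructor
    · intro f hf
      rw [RingHom.mem_ker]
      apply Polynomial.funext
      intro t
      rw [hφ]
      have := (mem_vanishingIdeal_iff.1 hf) (t • x) (hcone x hx t)
      simpa [aeval_eq_eval] using this
    · rintro _ ⟨a, rfl⟩
      rw [SetLike.mem_coe, RingHom.mem_ker]
      apply Polynomial.funext
      intro t
      rw [hφ, eval_linForm]
      simp only [Pi.smul_apply, smul_eq_mul, Polynomial.eval_zero]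
      have := congrArg (t * ·) (hvx a)
      simp only [Finset.mul_sum, mul_zero] at this
      rw [← this]
      exact Finset.sum_congr rfl fun i _ => by ring
  let m : Ideal (MvPolynomial (Fin n) ℂ) := RingHom.ker (constantCoeff (σ := Fin n) (R := ℂ))
  have h2 : RingHom.ker φ ≤ m := by
    intro f hf
    have := hφ f 0
    rw [RingHom.mem_ker] at hf ⊢
    rw [hf, zero_smul] at this
    rw [constantCoeff_eq, ← constantCoeff_eq, ← eval_zero]
    simpa using this.symm
  have h3 : RingHom.ker φ ≠ m := by
    intro heq
    obtain ⟨i, hi⟩ := Function.ne_iff.1 hx0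
    have : X i ∈ RingHom.ker φ := by
      rw [heq, RingHom.mem_ker]; simp
    rw [RingHom.mem_ker] at this
    have h4 := hφ (X i) 1
    rw [this] at h4
    simp at h4
    exact hi h4.symm
  have p1 : (RingHom.ker φ).IsPrime := RingHom.ker_isPrime _
  have p2 : m.IsPrime := RingHom.ker_isPrime _
  let P1 : PrimeSpectrum.zeroLocus (J : Set (MvPolynomial (Fin n) ℂ)) := ⟨⟨_, p1⟩, h1⟩
  let P2 : PrimeSpectrum.zeroLocus (J : Set (MvPolynomial (Fin n) ℂ)) := ⟨⟨_, p2⟩, h1.trans h2⟩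
  have hlt : P1 < P2 := lt_of_le_of_ne h2 fun h => h3 (congrArg (fun p => p.1.asIdeal) h)
  rw [ringKrullDim_quotient] at hv
  have h5 := (Order.one_le_krullDim_iff.2 ⟨P1, P2, hlt⟩).trans hv
  exact absurd h5 (by decide)

end BirchHessian

/-! ### Counting integer zeros of homogeneous systems, uniformly in the coefficients. -/

namespace BirchHessian

open MvPolynomial

attribute [local instance] MvPolynomial.gradedAlgebra

/-- A common irrelevant power for a family of homogeneous ideals with Noetherian parameters. -/
theorem exists_uniform_power {A K σ ι : Type*} [CommRing A] [IsNoetherianRing A] [Field K]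
    [Finite σ] (f : ι → MvPolynomial σ A) (e : ι → ℕ) (hf : ∀ j, (f j).IsHomogeneous (e j)) :
    ∃ M₀ : ℕ, ∀ φ : A →+* K, Function.Surjective φ →
      (∃ M : ℕ, ∀ m : σ →₀ ℕ, m.degree = M →
        monomial m (1 : K) ∈ Ideal.span (Set.range fun j => map φ (f j))) →
      ∀ m : σ →₀ ℕ, m.degree = M₀ →
        monomial m (1 : K) ∈ Ideal.span (Set.range fun j => map φ (f j)) := by
  classical
  set J : Ideal (MvPolynomial σ A) := Ideal.span (Set.range f) with hJ
  have hJh : J.IsHomogeneous (homogeneousSubmodule σ A) := by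
    apply Ideal.homogeneous_span
    rintro _ ⟨j, rfl⟩
    exact ⟨e j, hf j⟩
  -- The coefficients that push all monomials of degree `M` into `J`. These ideals increase with
  -- `M`, so they stabilise at an `M₀` that knows nothing of `φ`.
  let c : ℕ → Ideal A := fun M =>
    { carrier := {a | ∀ m : σ →₀ ℕ, m.degree = M → monomial m a ∈ J}
      add_mem' := fun {a b} ha hb m hm => by
        rw [map_add]; exact J.add_mem (ha m hm) (hb m hm)
      zero_mem' := fun m _ => by rw [map_zero]; exact J.zero_mem
      smul_mem' := fun r a ha m hm => by
        rw [smul_eq_mul, ← C_mul_monomial]; exact J.mul_mem_left _ (ha m hm) }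
  have hmono : Monotone c := by
    refine monotone_nat_of_le_succ fun M a ha m hm => ?_
    obtain ⟨i, hi⟩ : ∃ i, m i ≠ 0 := by
      by_contra! h
      have : m = 0 := by ext i; exact h i
      rw [this] at hm
      simp at hm
    have hle : Finsupp.single i 1 ≤ m := by
      rw [Finsupp.single_le_iff]; omega
    have hm' : m = (m - Finsupp.single i 1) + Finsupp.single i 1 :=
      (tsub_add_cancel_of_le hle).symm
    have hd : (m - Finsupp.single i 1).degree = M := by
      have := congrArg Finsupp.degree hm'
      rw [map_add, Finsupp.degree_single] at this
      omega
    rw [hm', monomial_add_single, pow_one]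
    exact J.mul_mem_right _ (ha _ hd)
  obtain ⟨M₀, hM₀⟩ := monotone_stabilizes_iff_noetherian.2 ‹IsNoetherianRing A› ⟨c, hmono⟩
  have hc : ∀ M, c M ≤ c M₀ := fun M => by
    rcases le_total M M₀ with h | h
    · exact hmono h
    · exact (hM₀ M h).ge
  refine ⟨M₀, fun φ hφ ⟨M, hM⟩ m₀ hm₀ => ?_⟩
  have hmap : Ideal.span (Set.range fun j => map φ (f j)) = J.map (map (σ := σ) φ) := by
    rw [hJ, Ideal.map_span, ← Set.range_comp]; rfl
  rw [hmap] at hM ⊢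
  -- Lifting the hypothesis from `K` to `A`: modulo `J`, each monomial of degree `M` equals a form
  -- of the same degree with coefficients in `ker φ`.
  have hlift : ∀ m : σ →₀ ℕ, m.degree = M → ∃ r : MvPolynomial σ A, r.IsHomogeneous M ∧
      (∀ a, coeff a r ∈ RingHom.ker φ) ∧ monomial m 1 - r ∈ J := by
    intro m hm
    obtain ⟨p, hp, hpm⟩ := (Ideal.mem_map_iff_of_surjective _ (map_surjective φ hφ)).1 (hM m hm)
    have hmm : homogeneousComponent M (monomial m (1 : A)) = monomial m 1 :=
      homogeneousComponent_eq_self (isHomogeneous_monomial 1 hm)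
    refine ⟨homogeneousComponent M (monomial m 1 - p), homogeneousComponent_isHomogeneous _ _, ?_, ?_⟩
    · intro a
      rw [coeff_homogeneousComponent]
      split_ifs
      · rw [RingHom.mem_ker, ← coeff_map, map_sub, hpm, map_monomial, map_one, sub_self, coeff_zero]
      · exact Ideal.zero_mem _
    · rw [map_sub, hmm, sub_sub_cancel]
      exact homogeneousComponent_mem_of_mem hJh hp M
  let q : MvPolynomial σ A →ₗ[A] (MvPolynomial σ A ⧸ J) := (Ideal.Quotient.mkₐ A J).toLinearMap
  have hq : ∀ p, q p = 0 ↔ p ∈ J := fun p => Ideal.Quotient.eq_zero_iff_mem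
  let N := (homogeneousSubmodule σ A M).map q
  have hN : N.FG := (homogeneousSubmodule_fg σ A M).map q
  have hhom : ∀ p : MvPolynomial σ A, p.IsHomogeneous M → (∀ a, coeff a p ∈ RingHom.ker φ) →
      q p ∈ RingHom.ker φ • N := by
    intro p hp hpc
    rw [p.as_sum, map_sum]
    refine Submodule.sum_mem _ fun a ha => ?_
    have : monomial a (coeff a p) = coeff a p • monomial a (1 : A) := by
      rw [smul_monomial, smul_eq_mul, mul_one]
    rw [this, map_smul]
    refine Submodule.smul_mem_smul (hpc a) (Submodule.mem_map_of_mem ?_)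
    refine isHomogeneous_monomial 1 ?_
    by_contra h
    exact (mem_support_iff.1 ha) (hp.coeff_eq_zero h)
  have hNI : N ≤ RingHom.ker φ • N := by
    rintro _ ⟨p, hp, rfl⟩
    rw [p.as_sum, map_sum]
    refine Submodule.sum_mem _ fun a ha => ?_
    have hda : a.degree = M := by
      by_contra h
      exact (mem_support_iff.1 ha) ((mem_homogeneousSubmodule _ _).1 hp |>.coeff_eq_zero h)
    obtain ⟨r, hr1, hr2, hr3⟩ := hlift a hda
    have h1 : monomial a (coeff a p) = coeff a p • monomial a (1 : A) := by
      rw [smul_monomial, smul_eq_mul, mul_one]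
    have h2 : q (monomial a 1) = q r := by
      rw [← sub_eq_zero, ← map_sub, hq]; exact hr3
    rw [h1, map_smul, h2]
    exact Submodule.smul_mem _ _ (hhom r hr1 hr2)
  -- Nakayama's lemma for `N = ker φ • N`: some `r` congruent to `1` modulo `ker φ` kills `N`. Thus
  -- `r ∈ c M ≤ c M₀`, and `φ r = 1` transports this to `K`.
  obtain ⟨r, hr1, hr2⟩ :=
    Submodule.exists_sub_one_mem_and_smul_eq_zero_of_fg_of_le_smul _ N hN hNI
  have hrc : r ∈ c M := by
    intro m hm
    have := hr2 (q (monomial m 1))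
      (Submodule.mem_map_of_mem (isHomogeneous_monomial 1 hm))
    rw [← map_smul, hq, smul_monomial, smul_eq_mul, mul_one] at this
    exact this
  have h3 := Ideal.mem_map_of_mem (map (σ := σ) φ) (hc M hrc m₀ hm₀)
  have h4 : φ r = 1 := by
    rw [RingHom.mem_ker, map_sub, map_one, sub_eq_zero] at hr1
    exact hr1
  rwa [map_monomial, h4] at h3

theorem homogeneousComponent_succ_mul {R σ : Type*} [CommRing R] (p l : MvPolynomial σ R)
    (hl : l.IsHomogeneous 1) (t : ℕ) :
    homogeneousComponent (t + 1) (p * l) = homogeneousComponent t p * l := by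
  classical
  have h := DirectSum.coe_decompose_mul_add_of_right_mem (homogeneousSubmodule σ R) (i := t)
    (a := p) (b := l) hl
  have h' : ∀ (r : MvPolynomial σ R) i, (DirectSum.decompose (homogeneousSubmodule σ R) r i :
      MvPolynomial σ R) = homogeneousComponent i r := fun r i => decomposition.decompose'_apply r i
  rwa [h', h'] at h

theorem exists_homogeneous_decomposition {R σ Λ : Type*} [CommRing R] [Fintype Λ]
    {I : Ideal (MvPolynomial σ R)} (hI : I.IsHomogeneous (homogeneousSubmodule σ R))
    (l : Λ → MvPolynomial σ R) (hl : ∀ a, (l a).IsHomogeneous 1) {t : ℕ} {p : MvPolynomial σ R}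
    (hp : p.IsHomogeneous (t + 1)) (hmem : p ∈ I ⊔ Ideal.span (Set.range l)) :
    ∃ q : Λ → MvPolynomial σ R, (∀ a, (q a).IsHomogeneous t) ∧ p - ∑ a, q a * l a ∈ I := by
  obtain ⟨g, hg, h, hh, rfl⟩ := Submodule.mem_sup.1 hmem
  obtain ⟨c, rfl⟩ := (Ideal.mem_span_range_iff_exists_fun).1 hh
  refine ⟨fun a => homogeneousComponent t (c a), fun a => homogeneousComponent_isHomogeneous _ _, ?_⟩
  have h1 := homogeneousComponent_eq_self hp
  rw [map_add, map_sum] at h1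
  simp only [homogeneousComponent_succ_mul _ _ (hl _)] at h1
  rw [← h1, add_sub_cancel_right]
  exact homogeneousComponent_mem_of_mem hI hg _

/-- Products of powers of the variables with exponents below `M` and of powers of the linear forms
with exponents at most `t`. -/
def generatorSet {R σ Λ : Type*} [CommRing R] [Fintype σ] [Fintype Λ]
    (l : Λ → MvPolynomial σ R) (M t : ℕ) : Set (MvPolynomial σ R) :=
  {p | ∃ (b : σ → ℕ) (c : Λ → ℕ), (∀ i, b i < M) ∧ (∀ a, c a ≤ t) ∧
    p = (∏ i, X i ^ b i) * ∏ a, l a ^ c a}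

/-- Induction on the degree: a monomial with some exponent at least `M` lies in `I` plus the ideal
of the linear forms, hence is modulo `I` a combination of the `l a` with coefficients of degree one
less. As in Noether normalisation, only the powers of the linear forms grow with the degree. -/
theorem homogeneous_mem_sup_span {R σ Λ : Type*} [CommRing R] [Fintype σ] [Fintype Λ]
    {I : Ideal (MvPolynomial σ R)} (hI : I.IsHomogeneous (homogeneousSubmodule σ R))
    (l : Λ → MvPolynomial σ R) (hl : ∀ a, (l a).IsHomogeneous 1) {M : ℕ} (hM0 : 0 < M)
    (hM : ∀ i, X i ^ M ∈ I ⊔ Ideal.span (Set.range l)) (t : ℕ) :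
    ∀ q : MvPolynomial σ R, q.IsHomogeneous t →
      q ∈ I.restrictScalars R ⊔ Submodule.span R (generatorSet l M t) := by
  classical
  induction t with
  | zero =>
    intro q hq
    rw [← totalDegree_zero_iff_isHomogeneous, totalDegree_eq_zero_iff_eq_C] at hq
    refine Submodule.mem_sup_right ?_
    rw [hq, ← mul_one (C _), ← smul_eq_C_mul]
    refine Submodule.smul_mem _ _ (Submodule.subset_span ⟨0, 0, fun _ => hM0, fun _ => le_rfl, ?_⟩)
    simp
  | succ t ih =>
    intro q hq
    rw [q.as_sum]
    refine Submodule.sum_mem _ fun m hm => ?_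
    have hdm : m.degree = t + 1 := by
      by_contra h
      exact (mem_support_iff.1 hm) (hq.coeff_eq_zero h)
    have h1 : monomial m (coeff m q) = coeff m q • monomial m (1 : R) := by
      rw [smul_monomial, smul_eq_mul, mul_one]
    rw [h1]
    refine Submodule.smul_mem _ _ ?_
    have hprod : monomial m (1 : R) = ∏ i, X i ^ m i := by
      rw [monomial_eq, C_1, one_mul, Finsupp.prod_fintype]
      simp
    by_cases hall : ∀ i, m i < M
    · refine Submodule.mem_sup_right (Submodule.subset_span ⟨m, 0, hall, fun _ => Nat.zero_le _, ?_⟩)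
      simp [hprod]
    · push Not at hall
      obtain ⟨i, hi⟩ := hall
      have hmem : monomial m (1 : R) ∈ I ⊔ Ideal.span (Set.range l) := by
        refine Ideal.mem_of_dvd _ ?_ (hM i)
        rw [hprod]
        exact (pow_dvd_pow _ hi).trans (Finset.dvd_prod_of_mem _ (Finset.mem_univ i))
      obtain ⟨c, hc, hcI⟩ := exists_homogeneous_decomposition hI l hl
        (isHomogeneous_monomial (1 : R) hdm) hmem
      rw [← sub_add_cancel (monomial m (1 : R)) (∑ a, c a * l a)]
      refine Submodule.add_mem _ (Submodule.mem_sup_left hcI) (Submodule.sum_mem _ fun a _ => ?_)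
      obtain ⟨g, hg, h, hh, hgh⟩ := Submodule.mem_sup.1 (ih _ (hc a))
      rw [← hgh, add_mul]
      refine Submodule.add_mem _ (Submodule.mem_sup_left (I.mul_mem_right _ hg))
        (Submodule.mem_sup_right ?_)
      have : Submodule.span R (generatorSet l M t) ≤
          (Submodule.span R (generatorSet l M (t + 1))).comap (LinearMap.mulRight R (l a)) := by
        rw [Submodule.span_le]
        rintro _ ⟨b, d, hb, hd, rfl⟩
        refine Submodule.subset_span ⟨b, d + Pi.single a 1, hb, fun a' => ?_, ?_⟩
        · have := hd a'
          rw [Pi.add_apply, Pi.single_apply]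
          split_ifs <;> omega
        · simp only [LinearMap.mulRight_apply, Pi.add_apply, pow_add, Finset.prod_mul_distrib, mul_assoc]
          congr 2
          rw [Finset.prod_eq_single a]
          · simp
          · intro a' _ h; simp [h]
          · simp
      exact this hh

/-- Polynomials of degree at most `2 * K * |σ|` interpolate every function on `S`, and the elements
of `I` vanish on `S`. So `|S|` is at most the number of products that span these polynomials modulo
`I`. -/
theorem card_zeros_le_of_pow_mem {σ Λ ι : Type*} [Fintype σ] [Fintype Λ]
    (f : ι → MvPolynomial σ ℂ) (e : ι → ℕ) (hf : ∀ j, (f j).IsHomogeneous (e j))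
    (v : Λ → σ → ℂ) {M : ℕ} (hM0 : 0 < M)
    (hM : ∀ i, X i ^ M ∈ Ideal.span (Set.range f) ⊔ Ideal.span (Set.range fun a => linForm (v a)))
    (K : ℕ) (S : Finset (σ → ℤ)) (hS : ∀ s ∈ S, ∀ i, |s i| ≤ K)
    (hS0 : ∀ s ∈ S, ∀ j, eval (fun i => (s i : ℂ)) (f j) = 0) :
    S.card ≤ M ^ Fintype.card σ * (2 * K * Fintype.card σ + 1) ^ Fintype.card Λ := by
  classical
  set t := 2 * K * Fintype.card σ with ht
  set I := Ideal.span (Set.range f) with hI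
  have hIh : I.IsHomogeneous (homogeneousSubmodule σ ℂ) := by
    apply Ideal.homogeneous_span
    rintro _ ⟨j, rfl⟩
    exact ⟨e j, hf j⟩
  set l : Λ → MvPolynomial σ ℂ := fun a => linForm (v a) with hl
  have hlh : ∀ a, (l a).IsHomogeneous 1 := fun a => isHomogeneous_linForm _
  let ev : MvPolynomial σ ℂ →ₗ[ℂ] (S → ℂ) :=
    LinearMap.pi fun s => (aeval (R := ℂ) fun i => ((s : σ → ℤ) i : ℂ)).toLinearMap
  have hev : ∀ p s, ev p s = eval (fun i => ((s : σ → ℤ) i : ℂ)) p := fun p s => by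
    simp [ev, aeval_eq_eval]
  have hevI : ∀ p ∈ I, ev p = 0 := by
    intro p hp
    ext s
    have : I ≤ RingHom.ker (eval (fun i => ((s : σ → ℤ) i : ℂ))) := by
      rw [hI, Ideal.span_le]
      rintro _ ⟨j, rfl⟩
      exact hS0 s s.2 j
    rw [hev]
    exact this hp
  let g : (σ → Fin M) × (Λ → Fin (t + 1)) → (S → ℂ) := fun bc =>
    ev ((∏ i, X i ^ (bc.1 i : ℕ)) * ∏ a, l a ^ (bc.2 a : ℕ))
  have hgen : ∀ j ≤ t, Submodule.map ev (Submodule.span ℂ (generatorSet l M j)) ≤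
      Submodule.span ℂ (Set.range g) := by
    intro j hj
    rw [Submodule.map_span, Submodule.span_le]
    rintro _ ⟨_, ⟨b, c, hb, hc, rfl⟩, rfl⟩
    exact Submodule.subset_span ⟨(fun i => ⟨b i, hb i⟩,
      fun a => ⟨c a, Nat.lt_succ_of_le ((hc a).trans hj)⟩), rfl⟩
  have hdeg : ∀ p : MvPolynomial σ ℂ, p.totalDegree ≤ t → ev p ∈ Submodule.span ℂ (Set.range g) := by
    intro p hp
    rw [← sum_homogeneousComponent p, map_sum]
    refine Submodule.sum_mem _ fun j hj => ?_
    have hjt : j ≤ t := by rw [Finset.mem_range] at hj; omega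
    obtain ⟨x, hx, y, hy, hxy⟩ := Submodule.mem_sup.1
      (homogeneous_mem_sup_span hIh l hlh hM0 hM j _ (homogeneousComponent_isHomogeneous j p))
    rw [← hxy, map_add, hevI x hx, zero_add]
    exact hgen j hjt (Submodule.mem_map_of_mem hy)
  have htop : Submodule.span ℂ (Set.range g) = ⊤ := by
    rw [eq_top_iff, ← (Pi.basisFun ℂ S).span_eq, Submodule.span_le]
    rintro _ ⟨s, rfl⟩
    rw [Pi.basisFun_apply]
    -- The Lagrange polynomial of `s` in the grid `[-K, K]^σ`, of degree at most `2 * K` in each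
    -- variable.
    let δ : MvPolynomial σ ℂ :=
      ∏ i, ∏ c ∈ (Finset.Icc (-(K : ℤ)) K).erase ((s : σ → ℤ) i), (X i - C (c : ℂ))
    have hδdeg : δ.totalDegree ≤ t := by
      refine (totalDegree_finsetProd (Finset.univ : Finset σ) _).trans ?_
      have : ∀ i ∈ (Finset.univ : Finset σ), (∏ c ∈ (Finset.Icc (-(K : ℤ)) K).erase ((s : σ → ℤ) i),
          (X i - C (c : ℂ)) : MvPolynomial σ ℂ).totalDegree ≤ 2 * K := by
        intro i _
        refine (totalDegree_finsetProd _ _).trans ?_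
        refine (Finset.sum_le_card_nsmul _ _ 1 fun c _ => ?_).trans ?_
        · refine (totalDegree_sub_C_le _ _).trans ?_
          simp
        · rw [Finset.card_erase_of_mem]
          · simp; omega
          · rw [Finset.mem_Icc]; exact abs_le.1 (hS s s.2 i)
      refine (Finset.sum_le_card_nsmul _ _ _ this).trans ?_
      rw [Finset.card_univ, smul_eq_mul, ht, mul_comm]
    have hδ : ev δ = ev δ s • Pi.single s (1 : ℂ) := by
      ext s'
      by_cases hss : s' = s
      · subst hss; simp
      · rw [Pi.smul_apply, Pi.single_eq_of_ne hss, smul_zero, hev, eval_prod]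
        have hne : (s' : σ → ℤ) ≠ s := fun h => hss (Subtype.ext h)
        obtain ⟨i, hi⟩ := Function.ne_iff.1 hne
        refine Finset.prod_eq_zero (Finset.mem_univ i) ?_
        rw [eval_prod]
        refine Finset.prod_eq_zero (i := (s' : σ → ℤ) i) ?_ (by simp)
        rw [Finset.mem_erase, Finset.mem_Icc]
        exact ⟨hi, abs_le.1 (hS s' s'.2 i)⟩
    have hδs : ev δ s ≠ 0 := by
      rw [hev, eval_prod, Finset.prod_ne_zero_iff]
      intro i _
      rw [eval_prod, Finset.prod_ne_zero_iff]
      intro c hc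
      rw [eval_sub, eval_X, eval_C, sub_ne_zero]
      intro h
      exact (Finset.mem_erase.1 hc).1 (by exact_mod_cast h.symm)
    have := Submodule.smul_mem _ (ev δ s)⁻¹ (hdeg δ hδdeg)
    rw [hδ, smul_smul, Pi.smul_apply, Pi.single_eq_same, smul_eq_mul, mul_one,
      inv_mul_cancel₀ hδs, one_smul] at this
    exact this
  have h1 : Module.finrank ℂ (S → ℂ) ≤ Fintype.card ((σ → Fin M) × (Λ → Fin (t + 1))) := by
    rw [← finrank_top, ← htop]
    exact finrank_range_le_card g
  simpa using h1

/-- The parameters of the system and the coefficients of the linear forms become variables of one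
Noetherian ring, so a single exponent serves all specialisations for which the origin is the only
common zero. The Nullstellensatz turns that condition into the hypothesis of `exists_uniform_power`.
-/
theorem exists_card_zeros_le {P σ Λ ι : Type*} [Finite P] [Fintype σ] [Fintype Λ]
    (f : ι → MvPolynomial σ (MvPolynomial P ℂ)) (e : ι → ℕ) (hf : ∀ j, (f j).IsHomogeneous (e j)) :
    ∃ C : ℕ, ∀ (t : P → ℂ) (v : Λ → σ → ℂ),
      (∀ x : σ → ℂ, (∀ j, eval x (map (eval t) (f j)) = 0) → (∀ a, ∑ i, v a i * x i = 0) → x = 0) →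
      ∀ (K : ℕ) (S : Finset (σ → ℤ)), (∀ s ∈ S, ∀ i, |s i| ≤ K) →
        (∀ s ∈ S, ∀ j, eval (fun i => (s i : ℂ)) (map (eval t) (f j)) = 0) →
        S.card ≤ C * (K + 1) ^ Fintype.card Λ := by
  classical
  let A := MvPolynomial (P ⊕ Λ × σ) ℂ
  let F : ι ⊕ Λ → MvPolynomial σ A := Sum.elim
    (fun j => map (rename (Sum.inl : P → P ⊕ Λ × σ)).toRingHom (f j))
    (fun a => linForm fun i => (X (Sum.inr (a, i)) : A))
  have hF : ∀ j, (F j).IsHomogeneous (Sum.elim e (fun _ => 1) j) := by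
    rintro (j | a)
    · exact (hf j).map _
    · exact isHomogeneous_linForm _
  obtain ⟨M, hM⟩ := exists_uniform_power (K := ℂ) F _ hF
  refine ⟨(M + 1) ^ Fintype.card σ * (2 * Fintype.card σ + 1) ^ Fintype.card Λ, ?_⟩
  intro t v hx K S hS hS0
  let φ : A →+* ℂ := eval (Sum.elim t fun ai => v ai.1 ai.2)
  have hφ : Function.Surjective φ := fun z => ⟨C z, eval_C z⟩
  have hF1 : ∀ j, map φ (F (Sum.inl j)) = map (eval t) (f j) := by
    intro j
    change map φ (map _ (f j)) = _
    rw [map_map]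
    congr 1
    congr 1
    apply MvPolynomial.ringHom_ext
    · intro r
      change eval _ (rename Sum.inl (C r)) = eval t (C r)
      rw [rename_C, eval_C, eval_C]
    · intro i
      change eval _ (rename Sum.inl (X i)) = eval t (X i)
      rw [rename_X, eval_X, eval_X, Sum.elim_inl]
  have hF2 : ∀ a, map φ (F (Sum.inr a)) = linForm (v a) := by
    intro a
    change map φ (linForm _) = _
    rw [map_linForm]
    congr 1
    funext i
    exact eval_X _
  have hspan : Ideal.span (Set.range fun j => map φ (F j)) =
      Ideal.span (Set.range fun j => map (eval t) (f j)) ⊔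
        Ideal.span (Set.range fun a => linForm (v a)) := by
    rw [← Ideal.span_union]
    congr 1
    ext p
    simp only [Set.mem_range, Sum.exists, hF1, hF2, Set.mem_union]
  set J := Ideal.span (Set.range fun j => map φ (F j)) with hJ
  have hrad : ∀ i, X i ∈ J.radical := by
    intro i
    rw [← vanishingIdeal_zeroLocus_eq_radical (K := ℂ) J, mem_vanishingIdeal_iff]
    intro x hxJ
    rw [mem_zeroLocus_iff] at hxJ
    have : x = 0 := by
      refine hx x (fun j => ?_) (fun a => ?_)
      · have := hxJ _ (Ideal.subset_span ⟨Sum.inl j, rfl⟩)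
        rw [aeval_eq_eval] at this
        rw [← hF1]
        exact this
      · have := hxJ _ (Ideal.subset_span ⟨Sum.inr a, rfl⟩)
        rw [aeval_eq_eval] at this
        rw [← eval_linForm, ← hF2]
        exact this
    simp [this]
  have hex : ∃ N : ℕ, ∀ m : σ →₀ ℕ, m.degree = N → monomial m (1 : ℂ) ∈ J := by
    have hle : Ideal.span (Set.range (X : σ → MvPolynomial σ ℂ)) ≤ J.radical := by
      rw [Ideal.span_le]
      rintro _ ⟨i, rfl⟩
      exact hrad i
    obtain ⟨N, hN⟩ := Ideal.exists_pow_le_of_le_radical_of_fg hle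
      ⟨Finset.univ.image X, by simp⟩
    refine ⟨N, fun m hm => hN ?_⟩
    rw [monomial_eq, C_1, one_mul, ← hm, Finsupp.degree_apply, ← Finset.prod_pow_eq_pow_sum]
    exact Ideal.prod_mem_prod fun i _ => Ideal.pow_mem_pow (Ideal.subset_span (Set.mem_range_self i)) _
  -- `M` may be zero while the count needs a positive exponent, hence `M + 1`.
  have hpow : ∀ i, (X i : MvPolynomial σ ℂ) ^ (M + 1) ∈ J := by
    intro i
    rw [pow_succ]
    refine J.mul_mem_right _ ?_
    rw [X_pow_eq_monomial]
    exact hM φ hφ hex _ (Finsupp.degree_single _ _)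
  rw [hspan] at hpow
  refine (card_zeros_le_of_pow_mem _ e (fun j => (hf j).map _) v (Nat.succ_pos M) hpow K S hS
    hS0).trans ?_
  rw [mul_assoc ((M + 1) ^ _), ← mul_pow]
  gcongr
  nlinarith

end BirchHessian

/-! ### The apolar pairing and iterated differences of polynomials. -/

namespace BirchHessian

open MvPolynomial

/-- The functional `p ↦ (p(∂) f)(0)`. -/
noncomputable def apolar {σ A : Type*} [CommRing A] (f : MvPolynomial σ A) :
    MvPolynomial σ A →ₗ[A] A :=
  (basisMonomials σ A).constr A fun a => (a.prod fun _ k => (k.factorial : A)) * coeff a f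

theorem apolar_monomial_one {σ A : Type*} [CommRing A] (f : MvPolynomial σ A) (a : σ →₀ ℕ) :
    apolar f (monomial a 1) = (a.prod fun _ k => (k.factorial : A)) * coeff a f := by
  have := Module.Basis.constr_basis (basisMonomials σ A) A
    (fun a => (a.prod fun _ k => (k.factorial : A)) * coeff a f) a
  rwa [coe_basisMonomials] at this

theorem apolar_monomial {σ A : Type*} [CommRing A] (f : MvPolynomial σ A) (a : σ →₀ ℕ) (c : A) :
    apolar f (monomial a c) = c * ((a.prod fun _ k => (k.factorial : A)) * coeff a f) := by
  rw [← apolar_monomial_one, ← smul_eq_mul c, ← map_smul, smul_monomial, smul_eq_mul, mul_one]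

theorem apolar_sum_smul {σ A ι : Type*} [CommRing A] [Fintype ι] (f : ι → MvPolynomial σ A)
    (c : ι → A) (p : MvPolynomial σ A) :
    apolar (∑ l, c l • f l) p = ∑ l, c l * apolar (f l) p := by
  induction p using MvPolynomial.induction_on' with
  | monomial a r =>
    simp only [apolar_monomial, coeff_sum, coeff_smul, smul_eq_mul, Finset.mul_sum]
    exact Finset.sum_congr rfl fun l _ => by ring
  | add p q hp hq => simp only [map_add, hp, hq, mul_add, Finset.sum_add_distrib]

theorem apolar_sub {σ A : Type*} [CommRing A] (f g p : MvPolynomial σ A) :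
    apolar (f - g) p = apolar f p - apolar g p := by
  induction p using MvPolynomial.induction_on' with
  | monomial a r => simp only [apolar_monomial, coeff_sub]; ring
  | add p q hp hq => simp only [map_add, hp, hq]; ring

theorem apolar_map {σ A B : Type*} [CommRing A] [CommRing B] (φ : A →+* B)
    (f p : MvPolynomial σ A) : apolar (map φ f) (map φ p) = φ (apolar f p) := by
  induction p using MvPolynomial.induction_on' with
  | monomial a r => simp [apolar_monomial, coeff_map, Finsupp.prod]
  | add p q hp hq => simp only [map_add, hp, hq]

/-- The factorial weights are made for this adjointness: `(k + 1)! = (k + 1) * k!` supplies the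
factor produced by differentiation. -/
theorem apolar_X_mul {σ A : Type*} [CommRing A] [Fintype σ] (f : MvPolynomial σ A) (i : σ)
    (p : MvPolynomial σ A) : apolar f (X i * p) = apolar (pderiv i f) p := by
  classical
  induction p using MvPolynomial.induction_on' with
  | monomial a r =>
    rw [mul_comm, ← pow_one (X i), ← monomial_add_single, apolar_monomial, apolar_monomial,
      coeff_pderiv, Finsupp.prod_fintype _ _ (by simp), Finsupp.prod_fintype _ _ (by simp),
      ← Finset.mul_prod_erase _ _ (Finset.mem_univ i), ← Finset.mul_prod_erase _ _ (Finset.mem_univ i)]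
    have : ∀ j ∈ Finset.univ.erase i, (((a + Finsupp.single i 1 : σ →₀ ℕ) j).factorial : A) =
        ((a j).factorial : A) := by
      intro j hj
      rw [Finsupp.add_apply, Finsupp.single_eq_of_ne (Finset.ne_of_mem_erase hj), add_zero]
    rw [Finset.prod_congr rfl this, Finsupp.add_apply, Finsupp.single_eq_same, Nat.factorial_succ]
    push_cast
    ring
  | add p q hp hq => simp only [mul_add, map_add, hp, hq]

/-- The derivative of `f` in the direction `h`. -/
noncomputable def dirDeriv {σ A : Type*} [CommRing A] [Fintype σ] (h : σ → A)
    (f : MvPolynomial σ A) : MvPolynomial σ A := ∑ i, h i • pderiv i f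

theorem apolar_linForm_mul {σ A : Type*} [CommRing A] [Fintype σ] (f : MvPolynomial σ A)
    (h : σ → A) (p : MvPolynomial σ A) :
    apolar f (linForm h * p) = apolar (dirDeriv h f) p := by
  rw [dirDeriv, apolar_sum_smul, linForm, Finset.sum_mul, map_sum]
  refine Finset.sum_congr rfl fun i _ => ?_
  rw [mul_assoc, ← smul_eq_C_mul, map_smul, apolar_X_mul, smul_eq_mul]

theorem apolar_linForm_mul_eq_sum {σ A : Type*} [CommRing A] [Fintype σ] (f : MvPolynomial σ A)
    (h : σ → A) (p : MvPolynomial σ A) :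
    apolar f (linForm h * p) = ∑ i, h i * apolar f (X i * p) := by
  rw [linForm, Finset.sum_mul, map_sum]
  refine Finset.sum_congr rfl fun i _ => ?_
  rw [mul_assoc, ← smul_eq_C_mul, map_smul, smul_eq_mul]

theorem apolar_one {σ A : Type*} [CommRing A] (f : MvPolynomial σ A) :
    apolar f 1 = coeff 0 f := by
  have := apolar_monomial_one f 0
  simpa using this

/-- Induction by Euler's identity, since the derivative of `f` in the direction `x`, taken at `x`,
is the degree times `f(x)`. -/
theorem apolar_linForm_pow {σ A : Type*} [CommRing A] [Fintype σ] (x : σ → A) (e : ℕ) :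
    ∀ f : MvPolynomial σ A, f.IsHomogeneous e →
      apolar f (linForm x ^ e) = e.factorial * eval x f := by
  induction e with
  | zero =>
    intro f hf
    rw [← totalDegree_zero_iff_isHomogeneous, totalDegree_eq_zero_iff_eq_C] at hf
    rw [pow_zero, apolar_one, Nat.factorial_zero, Nat.cast_one, one_mul]
    conv_rhs => rw [hf, eval_C]
  | succ e ih =>
    intro f hf
    have hD : (dirDeriv x f).IsHomogeneous e := by
      refine IsHomogeneous.sum _ _ _ fun i _ => ?_
      rw [smul_eq_C_mul]
      exact (hf.pderiv (i := i)).C_mul _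
    rw [pow_succ', apolar_linForm_mul, ih _ hD, Nat.factorial_succ]
    have h1 : eval x (dirDeriv x f) = eval x (∑ i, X i * pderiv i f) := by
      simp [dirDeriv, smul_eval]
    rw [h1, hf.sum_X_mul_pderiv, nsmul_eq_mul, map_mul, map_natCast]
    push_cast
    ring

/-- All monomials of `f` have degree at most `e - k`. -/
def DegBound {σ A : Type*} [CommRing A] (k e : ℕ) (f : MvPolynomial σ A) : Prop :=
  ∀ a, coeff a f ≠ 0 → a.degree + k ≤ e

namespace DegBound

variable {σ A : Type*} [CommRing A] {k e : ℕ} {f g : MvPolynomial σ A}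

theorem zero : DegBound k e (0 : MvPolynomial σ A) := fun a h => absurd (coeff_zero a) h

theorem add (hf : DegBound k e f) (hg : DegBound k e g) : DegBound k e (f + g) := by
  intro a ha
  by_cases h : coeff a f = 0
  · refine hg a fun h' => ha ?_
    rw [coeff_add, h, h', add_zero]
  · exact hf a h

theorem sum {ι : Type*} (s : Finset ι) {F : ι → MvPolynomial σ A}
    (h : ∀ i ∈ s, DegBound k e (F i)) : DegBound k e (∑ i ∈ s, F i) := by
  classical
  induction s using Finset.induction_on with
  | empty => exact zero
  | insert i s hi ih =>
    rw [Finset.sum_insert hi]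
    exact (h i (Finset.mem_insert_self _ _)).add
      (ih fun j hj => h j (Finset.mem_insert_of_mem hj))

theorem smul (c : A) (hf : DegBound k e f) : DegBound k e (c • f) := by
  intro a ha
  refine hf a fun h => ha ?_
  rw [coeff_smul, h, smul_zero]

theorem mono {k' e' : ℕ} (hf : DegBound k e f) (h : e + k' ≤ e' + k) : DegBound k' e' f := by
  intro a ha
  have := hf a ha
  omega

theorem mul_X (i : σ) (hf : DegBound k e f) : DegBound k (e + 1) (f * X i) := by
  classical
  intro a ha
  rw [coeff_mul_X'] at ha
  split_ifs at ha with h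
  · have h1 := hf _ ha
    have hle : Finsupp.single i 1 ≤ a := by
      rw [Finsupp.single_le_iff]
      have := Finsupp.mem_support_iff.1 h
      omega
    have h2 := congrArg Finsupp.degree (tsub_add_cancel_of_le hle)
    rw [map_add, Finsupp.degree_single] at h2
    omega
  · exact absurd rfl ha

theorem monomial (m : σ →₀ ℕ) (c : A) : DegBound 0 m.degree (MvPolynomial.monomial m c) := by
  classical
  intro a ha
  rw [coeff_monomial] at ha
  split_ifs at ha with h
  · rw [h]; rfl
  · exact absurd rfl ha

theorem pderiv (i : σ) (hf : DegBound 0 e f) : DegBound 1 e (pderiv i f) := by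
  classical
  intro a ha
  rw [coeff_pderiv] at ha
  have := hf _ (left_ne_zero_of_mul ha)
  rw [map_add, Finsupp.degree_single] at this
  omega

theorem dirDeriv [Fintype σ] (h : σ → A) (hf : DegBound 0 e f) :
    DegBound 1 e (BirchHessian.dirDeriv h f) :=
  sum _ fun i _ => (hf.pderiv i).smul _

theorem of_isHomogeneous (hf : f.IsHomogeneous e) : DegBound 0 e f := by
  intro a ha
  by_contra h
  exact ha (hf.coeff_eq_zero (by omega))

theorem apolar_eq_zero {p : MvPolynomial σ A} (hf : DegBound 1 e f) (hp : p.IsHomogeneous e) :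
    apolar f p = 0 := by
  rw [p.as_sum, map_sum]
  refine Finset.sum_eq_zero fun a ha => ?_
  rw [apolar_monomial]
  have hda : a.degree = e := by
    by_contra h
    exact (mem_support_iff.1 ha) (hp.coeff_eq_zero h)
  have : coeff a f = 0 := by
    by_contra h
    have := hf a h
    omega
  rw [this, mul_zero, mul_zero]

end DegBound

/-- Translation of the variables by `h`. -/
noncomputable def shift {σ A : Type*} [CommRing A] (h : σ → A) :
    MvPolynomial σ A →ₐ[A] MvPolynomial σ A := aeval fun i => X i + C (h i)

theorem eval_shift {σ A : Type*} [CommRing A] (h x : σ → A) (f : MvPolynomial σ A) :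
    eval x (shift h f) = eval (x + h) f := by
  change ((eval x).comp (shift h).toRingHom) f = _
  congr 1
  apply MvPolynomial.ringHom_ext
  · intro r
    change eval x (shift h (C r)) = _
    rw [shift, ← algebraMap_eq, AlgHom.commutes, algebraMap_eq, eval_C, eval_C]
  · intro i
    change eval x (shift h (X i)) = _
    rw [shift, aeval_X, eval_add, eval_X, eval_C, eval_X, Pi.add_apply]

/-- First-order Taylor expansion: the remainder drops the degree by two, so a difference and a
directional derivative have the same top part. Monomials are treated by induction, splitting off one
variable with the product rule. -/
theorem degBound_taylor {σ A : Type*} [CommRing A] [Fintype σ] (h : σ → A) {e : ℕ}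
    {f : MvPolynomial σ A} (hf : DegBound 0 e f) :
    DegBound 2 e (shift h f - f - dirDeriv h f) := by
  classical
  have key : ∀ k, ∀ m : σ →₀ ℕ, m.degree = k →
      DegBound 2 k (shift h (monomial m 1) - monomial m 1 - dirDeriv h (monomial m (1 : A))) := by
    intro k
    induction k with
    | zero =>
      intro m hm
      rw [Finsupp.degree_eq_zero_iff] at hm
      subst hm
      have h1 : monomial (0 : σ →₀ ℕ) (1 : A) = 1 := rfl
      simp only [h1, map_one, sub_self, dirDeriv, pderiv_one, smul_zero, Finset.sum_const_zero]
      exact DegBound.zero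
    | succ k ih =>
      intro m hm
      obtain ⟨i, hi⟩ : ∃ i, m i ≠ 0 := by
        by_contra! h0
        have : m = 0 := by ext i; exact h0 i
        rw [this] at hm
        simp at hm
      have hle : Finsupp.single i 1 ≤ m := by
        rw [Finsupp.single_le_iff]; omega
      set m' := m - Finsupp.single i 1 with hm'
      have hmm : m' + Finsupp.single i 1 = m := tsub_add_cancel_of_le hle
      have hd : m'.degree = k := by
        have := congrArg Finsupp.degree hmm
        rw [map_add, Finsupp.degree_single] at this
        omega
      set g : MvPolynomial σ A := monomial m' 1 with hg
      have hmon : monomial m (1 : A) = g * X i := by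
        rw [← hmm, monomial_add_single, pow_one]
      have hsX : shift h (X i) = X i + C (h i) := by rw [shift, aeval_X]
      have hDX : dirDeriv h (g * X i) = dirDeriv h g * X i + h i • g := by
        simp only [dirDeriv, Derivation.leibniz, smul_add, Finset.sum_add_distrib, Finset.sum_mul]
        rw [add_comm]
        congr 1
        · refine Finset.sum_congr rfl fun j _ => ?_
          simp only [smul_eq_C_mul, smul_eq_mul]; ring
        · rw [Finset.sum_eq_single i]
          · simp
          · intro j _ hj
            rw [pderiv_X_of_ne hj.symm, smul_zero, smul_zero]
          · simp
      have : shift h (monomial m 1) - monomial m 1 - dirDeriv h (monomial m (1 : A)) =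
          (shift h g - g - dirDeriv h g) * X i + h i • (shift h g - g - dirDeriv h g) +
            h i • dirDeriv h g := by
        rw [hmon, map_mul, hsX, hDX]
        simp only [smul_eq_C_mul]
        ring
      rw [this]
      have hgb : DegBound 0 k g := hd ▸ DegBound.monomial m' (1 : A)
      exact (((ih m' hd).mul_X i).add (((ih m' hd).smul _).mono (by omega))).add
        (((hgb.dirDeriv h).smul _).mono (by omega))
  have hexp : shift h f - f - dirDeriv h f = ∑ m ∈ f.support, coeff m f •
      (shift h (monomial m 1) - monomial m 1 - dirDeriv h (monomial m (1 : A))) := by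
    have hf' : f = ∑ m ∈ f.support, coeff m f • monomial m (1 : A) := by
      conv_lhs => rw [f.as_sum]
      refine Finset.sum_congr rfl fun m _ => ?_
      rw [smul_monomial, smul_eq_mul, mul_one]
    have hD : dirDeriv h f = ∑ m ∈ f.support, coeff m f • dirDeriv h (monomial m (1 : A)) := by
      conv_lhs => rw [hf']
      simp only [dirDeriv, map_sum, Finset.smul_sum]
      rw [Finset.sum_comm]
      refine Finset.sum_congr rfl fun m _ => Finset.sum_congr rfl fun i _ => ?_
      rw [Derivation.map_smul, smul_comm]
    simp only [smul_sub, Finset.sum_sub_distrib]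
    rw [← hf', ← hD]
    congr 2
    conv_lhs => rw [hf', map_sum]
    exact Finset.sum_congr rfl fun m _ => map_smul _ _ _
  rw [hexp]
  refine DegBound.sum _ fun m hm => DegBound.smul _ ?_
  exact (key _ m rfl).mono (by have := hf m (mem_support_iff.1 hm); omega)

/-- The iterated difference of `F` with steps `h 0, h 1, …`. -/
def diffs {V W : Type*} [AddCommGroup V] [AddCommGroup W] : (k : ℕ) → (Fin k → V) → (V → W) → V → W
  | 0, _, F => F
  | k + 1, h, F => diffs k (Fin.tail h) fun x => F (x + h 0) - F x

theorem diffs_sub_shift {V W : Type*} [AddCommGroup V] [AddCommGroup W] (k : ℕ) :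
    ∀ (h : Fin k → V) (F : V → W) (y x : V),
      diffs k h (fun x => F (x + y) - F x) x = diffs k h F (x + y) - diffs k h F x := by
  induction k with
  | zero => intro h F y x; rfl
  | succ k ih =>
    intro h F y x
    have := ih (Fin.tail h) (fun x => F (x + h 0) - F x) y x
    simp only [diffs]
    rw [← this]
    congr 1
    funext z
    rw [add_right_comm]
    abel

/-- The real vector underlying an integer vector. -/
def castVec {σ A : Type*} [IntCast A] (h : σ → ℤ) : σ → A := fun i => (h i : A)

/-- Each difference may be replaced by a directional derivative: the error has too low a degree to
pair with the remaining product of linear forms. -/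
theorem diffs_eval {σ A : Type*} [CommRing A] [Fintype σ] (k : ℕ) :
    ∀ (h : Fin k → σ → ℤ) (f : MvPolynomial σ A), DegBound 0 k f → ∀ x : σ → ℤ,
      diffs k h (fun x => eval (castVec x) f) x = apolar f (∏ j, linForm (castVec (h j))) := by
  induction k with
  | zero =>
    intro h f hf x
    have hC : f = C (coeff 0 f) := by
      ext a
      classical
      rw [coeff_C]
      split_ifs with h0
      · rw [h0]
      · by_contra hne
        have := hf a hne
        exact h0 ((Finsupp.degree_eq_zero_iff a).1 (by omega)).symm
    rw [Fin.prod_univ_zero, apolar_one]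
    change eval _ f = _
    conv_lhs => rw [hC, eval_C]
  | succ k ih =>
    intro h f hf x
    rw [Fin.prod_univ_succ, apolar_linForm_mul]
    set g := shift (castVec (h 0)) f - f with hg
    have hgD : DegBound 2 (k + 1) (g - dirDeriv (castVec (h 0)) f) := degBound_taylor _ hf
    have hDb : DegBound 1 (k + 1) (dirDeriv (castVec (h 0)) f) := hf.dirDeriv _
    have hgb : DegBound 0 k g := by
      rw [← sub_add_cancel g (dirDeriv (castVec (h 0)) f)]
      exact (hgD.mono (by omega)).add (hDb.mono (by omega))
    have hF : (fun x : σ → ℤ => eval (castVec (x + h 0)) f - eval (castVec x) f) =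
        fun x => eval (castVec x) g := by
      funext z
      rw [hg, eval_sub, eval_shift]
      congr 2
      congr 1
      funext i
      simp [castVec]
    have := ih (Fin.tail h) g hgb x
    simp only [diffs]
    rw [hF, this]
    simp only [Fin.tail]
    rw [← sub_eq_zero, ← apolar_sub]
    have hd1 : DegBound 1 k (g - dirDeriv (castVec (h 0)) f) := hgD.mono (by omega)
    refine hd1.apolar_eq_zero ?_
    have hp := IsHomogeneous.prod Finset.univ
      (fun j : Fin k => (linForm (castVec (h j.succ)) : MvPolynomial σ A)) (fun _ => 1)
      fun j _ => isHomogeneous_linForm _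
    rwa [Finset.sum_const, Finset.card_univ, Fintype.card_fin, smul_eq_mul, mul_one] at hp

/-- The change from `0` to `x` is one more difference, with step `x`. By `diffs_eval` it is a
multilinear value, hence linear in `x`. -/
theorem diffs_eval_eq_affine {σ A : Type*} [CommRing A] [Fintype σ] (k : ℕ)
    (h : Fin k → σ → ℤ) (f : MvPolynomial σ A) (hf : DegBound 0 (k + 1) f) (x : σ → ℤ) :
    diffs k h (fun x => eval (castVec x) f) x = diffs k h (fun x => eval (castVec x) f) 0 +
      ∑ i, (x i : A) * apolar f (X i * ∏ j, linForm (castVec (h j))) := by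
  have h1 := diffs_eval (k + 1) (Fin.cons x h : Fin (k + 1) → σ → ℤ) f hf 0
  simp only [diffs, Fin.tail_cons, Fin.cons_zero] at h1
  have h2 := diffs_sub_shift k h (fun x => eval (castVec x : σ → A) f) x 0
  rw [h2, zero_add, Fin.prod_univ_succ, apolar_linForm_mul_eq_sum] at h1
  simp only [Fin.cons_zero, Fin.cons_succ] at h1
  rw [sub_eq_iff_eq_add] at h1
  rw [h1, add_comm]
  rfl

end BirchHessian

/-! ### Integer zeros of the multilinear system in terms of the Hessian invariant. -/

namespace BirchHessian

open MvPolynomial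

/-- On the kernel, a nonsingular minor of maximal size determines the coordinates of its columns
from the other `n - A.rank`. -/
theorem card_kernel_le {n : ℕ} (A : Matrix (Fin n) (Fin n) ℂ) (K : ℕ) (S : Finset (Fin n → ℤ))
    (hS : ∀ s ∈ S, ∀ i, |s i| ≤ K) (hS0 : ∀ s ∈ S, A.mulVec (castVec s) = 0) :
    S.card ≤ (2 * K + 1) ^ (n - A.rank) := by
  classical
  obtain ⟨f, g, hdet⟩ := exists_submatrix_det_ne_zero A le_rfl
  have hg : Function.Injective g := by
    intro a b hab
    by_contra hne
    exact hdet (Matrix.det_zero_of_column_eq hne fun i => by simp [hab])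
  let c : Finset (Fin n) := (Finset.univ.image g)ᶜ
  have hc : c.card = n - A.rank := by
    rw [Finset.card_compl, Finset.card_image_of_injective _ hg]; simp
  let π : (Fin n → ℤ) → (c → ℤ) := fun s i => s i
  have hinj : Set.InjOn π S := by
    intro s hs s' hs' hss
    have hoff : ∀ i, i ∉ Set.range g → s i = s' i := by
      intro i hi
      have hic : i ∈ c := by simpa [c] using hi
      exact congrFun hss ⟨i, hic⟩
    have hz : (A.submatrix f g).mulVec (fun a => ((s (g a) : ℂ) - s' (g a))) = 0 := by
      funext b
      have h1 := congrFun (hS0 s hs) (f b)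
      have h2 := congrFun (hS0 s' hs') (f b)
      simp only [Matrix.mulVec, dotProduct, castVec, Pi.zero_apply] at h1 h2 ⊢
      have h3 : ∑ i, A (f b) i * ((s i : ℂ) - s' i) = 0 := by
        simp only [mul_sub, Finset.sum_sub_distrib, h1, h2, sub_self]
      rw [← h3]
      simp only [Matrix.submatrix_apply]
      refine Finset.sum_of_injOn g hg.injOn (by simp) ?_ (fun _ _ => rfl)
      intro i _ hi
      have : i ∉ Set.range g := by simpa using hi
      rw [hoff i this, sub_self, mul_zero]
    have hz0 := Matrix.eq_zero_of_mulVec_eq_zero hdet hz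
    funext i
    by_cases hi : i ∈ Set.range g
    · obtain ⟨a, rfl⟩ := hi
      have := congrFun hz0 a
      simp only [Pi.zero_apply, sub_eq_zero] at this
      exact_mod_cast this
    · exact hoff i hi
  calc S.card = (S.image π).card := (Finset.card_image_of_injOn hinj).symm
    _ ≤ (Fintype.piFinset fun _ : c => Finset.Icc (-(K : ℤ)) K).card := by
      refine Finset.card_le_card fun y hy => ?_
      obtain ⟨s, hs, rfl⟩ := Finset.mem_image.1 hy
      rw [Fintype.mem_piFinset]
      intro i
      rw [Finset.mem_Icc]
      exact abs_le.1 (hS s hs i)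
    _ = (2 * K + 1) ^ (n - A.rank) := by
      rw [Fintype.card_piFinset, Finset.prod_const, Finset.card_univ, Fintype.card_coe, hc,
        Int.card_Icc]
      congr 1
      omega

/-- The matrix of the multilinear form attached to `G`, with two of its arguments left free. -/
noncomputable def polarMatrix {n e : ℕ} (G : MvPolynomial (Fin n) ℂ) (x : Fin e × Fin n → ℂ) :
    Matrix (Fin n) (Fin n) ℂ :=
  Matrix.of fun i j => apolar G (X i * (X j * ∏ m, linForm fun i => x (m, i)))

/-- The matrix of the generic multilinear form. -/
noncomputable def genericMatrix (n e : ℕ) : Matrix (Fin n) (Fin n)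
    (MvPolynomial (Fin e × Fin n) (MvPolynomial (Fin n × Fin n × (Fin e → Fin n)) ℂ)) :=
  Matrix.of fun i j => ∑ κ : Fin e → Fin n, C (X (i, j, κ)) * ∏ m, X (m, κ m)

theorem isHomogeneous_det_genericMatrix (n e r : ℕ) (f g : Fin r → Fin n) :
    ((genericMatrix n e).submatrix f g).det.IsHomogeneous (r * e) := by
  have hent : ∀ i j, (genericMatrix n e i j).IsHomogeneous e := by
    intro i j
    refine IsHomogeneous.sum _ _ _ fun κ _ => ?_
    refine IsHomogeneous.C_mul ?_ _
    have hp := IsHomogeneous.prod Finset.univ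
      (fun m : Fin e => (X (m, κ m) : MvPolynomial (Fin e × Fin n)
        (MvPolynomial (Fin n × Fin n × (Fin e → Fin n)) ℂ))) (fun _ => 1)
      fun m _ => isHomogeneous_X _ _
    rwa [Finset.sum_const, Finset.card_univ, Fintype.card_fin, smul_eq_mul, mul_one] at hp
  rw [Matrix.det_apply']
  refine IsHomogeneous.sum _ _ _ fun τ _ => ?_
  have h1 : (((Equiv.Perm.sign τ : ℤˣ) : ℤ) : MvPolynomial (Fin e × Fin n)
      (MvPolynomial (Fin n × Fin n × (Fin e → Fin n)) ℂ)) =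
      C (((Equiv.Perm.sign τ : ℤˣ) : ℤ) : MvPolynomial (Fin n × Fin n × (Fin e → Fin n)) ℂ) := by
    rw [map_intCast]
  rw [h1]
  refine IsHomogeneous.C_mul ?_ _
  have hp := IsHomogeneous.prod Finset.univ
    (fun m : Fin r => (genericMatrix n e).submatrix f g (τ m) m) (fun _ => e)
    fun m _ => hent _ _
  rwa [Finset.sum_const, Finset.card_univ, Fintype.card_fin, smul_eq_mul] at hp

theorem linForm_smul {A σ : Type*} [CommSemiring A] [Fintype σ] (c : A) (v : σ → A) :
    linForm (c • v) = c • linForm v := by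
  simp [linForm, smul_eq_C_mul, Finset.mul_sum, mul_assoc]

/-- `G` enters only through the values of the parameters, which makes the later constants uniform in
`G`. -/
theorem eval_genericMatrix {n e : ℕ} (G : MvPolynomial (Fin n) ℂ) (x : Fin e × Fin n → ℂ)
    (i j : Fin n) :
    eval x (map (eval fun p : Fin n × Fin n × (Fin e → Fin n) =>
      apolar G (X p.1 * (X p.2.1 * ∏ m, X (p.2.2 m)))) (genericMatrix n e i j)) =
      polarMatrix G x i j := by
  simp only [genericMatrix, polarMatrix, Matrix.of_apply, map_sum, map_mul, map_prod, map_C, map_X,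
    eval_C, eval_X, linForm]
  rw [Finset.prod_univ_sum, Fintype.piFinset_univ]
  simp only [Finset.prod_mul_distrib, Finset.mul_sum, map_sum]
  refine Finset.sum_congr rfl fun κ _ => ?_
  rw [← map_prod, ← smul_eq_C_mul, mul_smul_comm, mul_smul_comm, map_smul, smul_eq_mul, mul_comm]

theorem eval_det_genericMatrix {n e r : ℕ} (G : MvPolynomial (Fin n) ℂ) (x : Fin e × Fin n → ℂ)
    (f g : Fin r → Fin n) :
    eval x (map (eval fun p : Fin n × Fin n × (Fin e → Fin n) =>
      apolar G (X p.1 * (X p.2.1 * ∏ m, X (p.2.2 m)))) ((genericMatrix n e).submatrix f g).det) =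
      ((polarMatrix G x).submatrix f g).det := by
  rw [← RingHom.comp_apply, RingHom.map_det]
  congr 1
  ext a b
  exact eval_genericMatrix G x (f a) (g b)

theorem hessian_eq {n : ℕ} (G : MvPolynomial (Fin n) ℤ) (x : Fin n → ℂ) (i j : Fin n) :
    hessian G x i j = eval x (pderiv i (pderiv j (map (Int.castRingHom ℂ) G))) := by
  rw [pderiv_map, pderiv_map, eval_map, hessian, Matrix.of_apply, aeval_def]
  rfl

/-- The link to the Hessian: on the diagonal the product of linear forms is an `e`-th power, and
`apolar_linForm_pow` applies to the second derivatives of `G`. -/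
theorem factorial_smul_hessian {n e : ℕ} {G : MvPolynomial (Fin n) ℤ}
    (hG : G.IsHomogeneous (e + 2)) (x : Fin n → ℂ) :
    polarMatrix (map (Int.castRingHom ℂ) G) (fun p : Fin e × Fin n => x p.2) =
      (e.factorial : ℂ) • hessian G x := by
  ext i j
  have hG' : (map (Int.castRingHom ℂ) G).IsHomogeneous (e + 2) := hG.map _
  have h2 : (pderiv i (pderiv j (map (Int.castRingHom ℂ) G))).IsHomogeneous e :=
    (hG'.pderiv (i := j)).pderiv (i := i)
  rw [Matrix.smul_apply, hessian_eq, smul_eq_mul, ← apolar_linForm_pow x e _ h2]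
  simp only [polarMatrix, Matrix.of_apply]
  rw [mul_left_comm, apolar_X_mul, apolar_X_mul, Finset.prod_const, Finset.card_univ,
    Fintype.card_fin]

theorem rank_smul_of_ne_zero {n : ℕ} {c : ℂ} (hc : c ≠ 0) (A : Matrix (Fin n) (Fin n) ℂ) :
    (c • A).rank = A.rank :=
  Matrix.rank_smul_of_mem_nonZeroDivisors A (mem_nonZeroDivisors_of_ne_zero hc)

theorem smul_mem_hessianLocus {n e r : ℕ} {G : MvPolynomial (Fin n) ℤ}
    (hG : G.IsHomogeneous (e + 2)) {x : Fin n → ℂ} (hx : x ∈ hessianLocus G r) (t : ℂ) :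
    t • x ∈ hessianLocus G r := by
  have hfac : (e.factorial : ℂ) ≠ 0 := by exact_mod_cast e.factorial_ne_zero
  have h : hessian G (t • x) = t ^ e • hessian G x := by
    have h1 := factorial_smul_hessian hG (t • x)
    have h2 := factorial_smul_hessian hG x
    have h3 : polarMatrix (map (Int.castRingHom ℂ) G) (fun p : Fin e × Fin n => (t • x) p.2) =
        t ^ e • polarMatrix (map (Int.castRingHom ℂ) G) (fun p : Fin e × Fin n => x p.2) := by
      ext i j
      simp only [polarMatrix, Matrix.of_apply, Matrix.smul_apply]
      have : (fun i => (t • x) i) = t • x := rfl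
      simp only [this, linForm_smul]
      rw [Finset.prod_const, Finset.prod_const, Finset.card_univ, Fintype.card_fin, smul_pow,
        mul_smul_comm, mul_smul_comm, map_smul]
    rw [h3, h2, smul_comm] at h1
    exact (smul_right_injective _ hfac h1).symm
  change (hessian G (t • x)).rank ≤ r
  rw [h]
  rcases eq_or_ne (t ^ e) 0 with h0 | h0
  · rw [h0, zero_smul, Matrix.rank_zero]; exact Nat.zero_le r
  · rw [rank_smul_of_ne_zero h0]; exact hx

/-- The tuples of rank at most `r` meet the diagonal in a copy of the Hessian locus, a cone of
dimension at most `k`. The `e * n` equations of the diagonal and `k` suitable hyperplanes therefore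
leave only the origin, and `exists_card_zeros_le` applies with `e * n + k` linear forms. -/
theorem exists_card_polarMatrix_rank_le (n e r k : ℕ) :
    ∃ C : ℕ, ∀ G : MvPolynomial (Fin n) ℤ, G.IsHomogeneous (e + 1 + 2) →
      affineDim (hessianLocus G r) ≤ k →
      ∀ (K : ℕ) (S : Finset (Fin (e + 1) × Fin n → ℤ)), (∀ s ∈ S, ∀ p, |s p| ≤ K) →
        (∀ s ∈ S, (polarMatrix (map (Int.castRingHom ℂ) G) (castVec s)).rank ≤ r) →
        S.card ≤ C * (K + 1) ^ (e * n + k) := by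
  classical
  obtain ⟨C, hC⟩ := exists_card_zeros_le (Λ := (Fin e × Fin n) ⊕ Fin k)
    (fun fg : (Fin (r + 1) → Fin n) × (Fin (r + 1) → Fin n) =>
      ((genericMatrix n (e + 1)).submatrix fg.1 fg.2).det) (fun _ => (r + 1) * (e + 1))
    (fun fg => isHomogeneous_det_genericMatrix n (e + 1) (r + 1) fg.1 fg.2)
  refine ⟨C, fun G hG hdim K S hS hS0 => ?_⟩
  obtain ⟨w, hw⟩ := exists_linForms_of_cone hdim
    fun x hx t => smul_mem_hessianLocus hG hx t
  -- The first family equates every block with block `0`; the second imposes the hyperplanes `w` on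
  -- block `0`.
  let v : (Fin e × Fin n) ⊕ Fin k → Fin (e + 1) × Fin n → ℂ := Sum.elim
    (fun p => Pi.single (p.1.succ, p.2) 1 - Pi.single (0, p.2) 1)
    (fun a p => if p.1 = 0 then w a p.2 else 0)
  have hcard : Fintype.card ((Fin e × Fin n) ⊕ Fin k) = e * n + k := by simp
  rw [← hcard]
  refine hC (fun p => apolar (map (Int.castRingHom ℂ) G) (X p.1 * (X p.2.1 * ∏ m, X (p.2.2 m))))
    v ?_ K S hS ?_
  · intro x hx hvx
    have h1 : ∀ m i, x (m, i) = x (0, i) := by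
      intro m i
      refine Fin.cases rfl (fun m => ?_) m
      have := hvx (Sum.inl (m, i))
      simp only [v, Sum.elim_inl, Pi.sub_apply, sub_mul, Finset.sum_sub_distrib, Pi.single_apply,
        ite_mul, one_mul, zero_mul, Finset.sum_ite_eq', Finset.mem_univ, if_true] at this
      exact sub_eq_zero.1 this
    have hx' : x = fun p => x (0, p.2) := by
      funext p
      exact h1 p.1 p.2
    have hrank : (polarMatrix (map (Int.castRingHom ℂ) G) x).rank ≤ r := by
      refine rank_le_of_forall_det_eq_zero _ fun f g => ?_
      rw [← eval_det_genericMatrix]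
      exact hx (f, g)
    rw [hx', factorial_smul_hessian hG (fun i => x (0, i)),
      rank_smul_of_ne_zero (by exact_mod_cast (e + 1).factorial_ne_zero)] at hrank
    have hy : (fun i => x (0, i)) = 0 := by
      refine hw _ hrank fun a => ?_
      have := hvx (Sum.inr a)
      simp only [v, Sum.elim_inr, Fintype.sum_prod_type, ite_mul, zero_mul] at this
      rw [Fin.sum_univ_succ] at this
      simpa using this
    funext p
    rw [h1 p.1 p.2]
    exact congrFun hy p.2
  · intro s hs fg
    rw [eval_det_genericMatrix]
    exact det_submatrix_eq_zero_of_rank_le _ (hS0 s hs) _ _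

theorem polarMatrix_mulVec {n e : ℕ} (G : MvPolynomial (Fin n) ℂ) (h : Fin (e + 1) → Fin n → ℤ)
    (i : Fin n) :
    (polarMatrix G (castVec fun p : Fin e × Fin n => h p.1.succ p.2)).mulVec (castVec (h 0)) i =
      apolar G (X i * ∏ j, linForm (castVec (h j))) := by
  rw [Fin.prod_univ_succ, mul_left_comm, apolar_linForm_mul_eq_sum]
  simp only [Matrix.mulVec, dotProduct, polarMatrix, Matrix.of_apply]
  refine Finset.sum_congr rfl fun j _ => ?_
  rw [mul_comm, mul_left_comm (X i)]
  rfl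

/-- The factor `(K + 1) ^ (n - r)` stands for the kernel vectors available over a tuple of rank `r`.
It offsets the `r` in the dimension bound `r + k` of the Hessian locus. -/
theorem exists_card_rank_eq_mul_pow_le (n e r : ℕ) (hr : r ≤ n) :
    ∃ C : ℕ, ∀ G : MvPolynomial (Fin n) ℤ, G.IsHomogeneous (e + 2) →
      ∀ k : ℕ, hessianInvariant (e + 2) G ≤ k →
      ∀ (K : ℕ) (S : Finset (Fin e × Fin n → ℤ)), (∀ s ∈ S, ∀ p, |s p| ≤ K) →
        (∀ s ∈ S, (polarMatrix (map (Int.castRingHom ℂ) G) (castVec s)).rank = r) →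
        S.card * (K + 1) ^ (n - r) ≤ C * (K + 1) ^ (e * n + k) := by
  rcases e with _ | e
  -- Degree two: there are no remaining arguments, so `S` has at most one point, and the matrix is
  -- the constant Hessian.
  · refine ⟨1, fun G hG k hk K S hS hS0 => ?_⟩
    have h1 : S.card ≤ 1 := Finset.card_le_one_of_subsingleton S
    rcases S.eq_empty_or_nonempty with rfl | ⟨s, hs⟩
    · simp
    · have hrank := hS0 s hs
      have h2 := factorial_smul_hessian (e := 0) hG 0
      have h3 : (castVec s : Fin 0 × Fin n → ℂ) = fun p => (0 : Fin n → ℂ) p.2 :=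
        Subsingleton.elim _ _
      rw [h3, h2, Nat.factorial_zero, Nat.cast_one, one_smul] at hrank
      rw [hessianInvariant, if_neg (by omega), hrank] at hk
      gcongr
      · omega
      · omega
  · choose C hC using fun k => exists_card_polarMatrix_rank_le n e r k
    -- The dimension of the locus depends on `G`, so the constants of all possible dimensions are
    -- added.
    refine ⟨∑ k ∈ Finset.range (n + 1), C k, fun G hG k hk K S hS hS0 => ?_⟩
    -- The Hessian has entries of positive degree and vanishes at the origin. So the locus is
    -- nonempty, and `affineDimInt` is its dimension rather than the default value.
    have h0 : (0 : Fin n → ℂ) ∈ hessianLocus G r := by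
      have hu : (0 : Fin n → ℂ) ∈ hessianLocus G n := Matrix.rank_le_width (hessian G 0)
      have h1 : hessian G 0 = 0 := by
        ext i j
        rw [hessian_eq]
        have h2 : (pderiv i (pderiv j (map (Int.castRingHom ℂ) G))).IsHomogeneous (e + 1) :=
          ((hG.map _).pderiv (i := j)).pderiv (i := i)
        change eval 0 _ = 0
        rw [eval_zero, constantCoeff_eq]
        exact h2.coeff_eq_zero (by simp)
      change (hessian G 0).rank ≤ r
      rw [h1, Matrix.rank_zero]
      exact Nat.zero_le r
    obtain ⟨D, hD1, hD2⟩ := affineDim_eq_affineDimInt ⟨_, h0⟩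
    have hDn : D ≤ n := by
      have := affineDimInt_le (hessianLocus G r)
      omega
    have hDk : D ≤ r + k := by
      rw [hessianInvariant, if_pos (by omega)] at hk
      have := (Finset.le_sup' (fun r : ℕ => affineDimInt (hessianLocus G r) - (r : ℤ))
        (Finset.mem_range.2 (Nat.lt_succ_of_le hr))).trans hk
      simp only [hD2] at this
      omega
    have h1 := hC D G hG hD1.le K S hS fun s hs => (hS0 s hs).le
    calc S.card * (K + 1) ^ (n - r) ≤ C D * (K + 1) ^ (e * n + D) * (K + 1) ^ (n - r) := by gcongr
      _ = C D * (K + 1) ^ (e * n + D + (n - r)) := by rw [mul_assoc, ← pow_add]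
      _ ≤ _ := by
        refine Nat.mul_le_mul (Finset.single_le_sum (fun _ _ => Nat.zero_le _)
            (Finset.mem_range.2 (Nat.lt_succ_of_le hDn))) (Nat.pow_le_pow_right (Nat.succ_pos _) ?_)
        rw [add_mul]
        omega

/-- The number of integer zeros of the multilinear system attached to `G` in a box. -/
theorem exists_card_multilinear_zeros_le (n e : ℕ) :
    ∃ C : ℕ, ∀ G : MvPolynomial (Fin n) ℤ, G.IsHomogeneous (e + 2) →
      ∀ k : ℕ, hessianInvariant (e + 2) G ≤ k →
      ∀ (K : ℕ) (S : Finset (Fin (e + 1) → Fin n → ℤ)), (∀ h ∈ S, ∀ j i, |h j i| ≤ K) →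
        (∀ h ∈ S, ∀ i, apolar G (X i * ∏ j, linForm (h j)) = 0) →
        S.card ≤ C * (K + 1) ^ (e * n + k) := by
  classical
  choose C hC using fun r : Fin (n + 1) =>
    exists_card_rank_eq_mul_pow_le n e r (Nat.lt_succ_iff.1 r.2)
  refine ⟨2 ^ n * ∑ r, C r, fun G hG k hk K S hS hS0 => ?_⟩
  let Gc := map (Int.castRingHom ℂ) G
  -- Forgetting `h 0`: over a fixed image, `h 0` runs through kernel vectors of one polar matrix.
  let π : (Fin (e + 1) → Fin n → ℤ) → (Fin e × Fin n → ℤ) := fun h p => h p.1.succ p.2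
  let rk : (Fin e × Fin n → ℤ) → ℕ := fun s => (polarMatrix Gc (castVec s)).rank
  have hrk : ∀ s, rk s ≤ n := fun s => Matrix.rank_le_width _
  have hker : ∀ h ∈ S, (polarMatrix Gc (castVec (π h))).mulVec (castVec (h 0)) = 0 := by
    intro h hh
    funext i
    rw [polarMatrix_mulVec]
    have h1 := apolar_map (Int.castRingHom ℂ) G (X i * ∏ j, linForm (h j))
    rw [hS0 h hh i, map_mul, map_X, map_prod, map_zero] at h1
    simp only [map_linForm] at h1
    exact h1
  have hfib : ∀ s ∈ S.image π, (S.filter fun h => π h = s).card ≤ (2 * K + 1) ^ (n - rk s) := by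
    intro s _
    have hinj : Set.InjOn (fun h : Fin (e + 1) → Fin n → ℤ => h 0)
        (S.filter fun h => π h = s : Finset _) := by
      intro h hh h' hh' h0
      have e1 := (Finset.mem_filter.1 hh).2
      have e2 := (Finset.mem_filter.1 hh').2
      funext j
      refine Fin.cases h0 (fun j => ?_) j
      funext i
      exact congrFun (e1.trans e2.symm) (j, i)
    rw [← Finset.card_image_of_injOn hinj]
    refine card_kernel_le _ K _ ?_ ?_
    · intro y hy
      obtain ⟨h, hh, rfl⟩ := Finset.mem_image.1 hy
      exact hS h (Finset.mem_filter.1 hh).1 0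
    · intro y hy
      obtain ⟨h, hh, rfl⟩ := Finset.mem_image.1 hy
      have := hker h (Finset.mem_filter.1 hh).1
      rwa [(Finset.mem_filter.1 hh).2] at this
  calc S.card = ∑ s ∈ S.image π, (S.filter fun h => π h = s).card :=
        Finset.card_eq_sum_card_image π S
    _ ≤ ∑ s ∈ S.image π, (2 * K + 1) ^ (n - rk s) := Finset.sum_le_sum hfib
    _ = ∑ r : Fin (n + 1), ∑ s ∈ (S.image π).filter (fun s => rk s = r),
          (2 * K + 1) ^ (n - rk s) := by
      rw [← Finset.sum_fiberwise (S.image π)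
        (fun s => (⟨rk s, Nat.lt_succ_of_le (hrk s)⟩ : Fin (n + 1)))]
      refine Finset.sum_congr rfl fun r _ => Finset.sum_congr ?_ fun _ _ => rfl
      ext s
      simp only [Finset.mem_filter, Fin.ext_iff]
    _ ≤ ∑ r : Fin (n + 1), 2 ^ n * (C r * (K + 1) ^ (e * n + k)) := by
      refine Finset.sum_le_sum fun r _ => ?_
      have h1 : ∑ s ∈ (S.image π).filter (fun s => rk s = r), (2 * K + 1) ^ (n - rk s) =
          ((S.image π).filter (fun s => rk s = r)).card * (2 * K + 1) ^ (n - (r : ℕ)) := by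
        have h4 : ∀ s ∈ (S.image π).filter (fun s => rk s = r),
            (2 * K + 1) ^ (n - rk s) = (2 * K + 1) ^ (n - (r : ℕ)) := fun s hs => by
          rw [(Finset.mem_filter.1 hs).2]
        rw [Finset.sum_congr rfl h4, Finset.sum_const, smul_eq_mul]
      have h2 := hC r G hG k hk K ((S.image π).filter (fun s => rk s = r)) (by
        intro s hs p
        obtain ⟨h, hh, rfl⟩ := Finset.mem_image.1 (Finset.mem_filter.1 hs).1
        exact hS h hh _ _) (fun s hs => (Finset.mem_filter.1 hs).2)
      have h3 : (2 * K + 1) ^ (n - (r : ℕ)) ≤ 2 ^ n * (K + 1) ^ (n - (r : ℕ)) := by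
        calc (2 * K + 1) ^ (n - (r : ℕ)) ≤ (2 * (K + 1)) ^ (n - (r : ℕ)) := by gcongr; omega
          _ = 2 ^ (n - (r : ℕ)) * (K + 1) ^ (n - (r : ℕ)) := mul_pow _ _ _
          _ ≤ _ := by
            gcongr
            · norm_num
            · omega
      rw [h1]
      calc _ ≤ ((S.image π).filter (fun s => rk s = r)).card * (2 ^ n * (K + 1) ^ (n - (r : ℕ))) := by
            gcongr
        _ = 2 ^ n * (((S.image π).filter (fun s => rk s = r)).card * (K + 1) ^ (n - (r : ℕ))) := by
          ring
        _ ≤ _ := by gcongr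
    _ = _ := by rw [← Finset.mul_sum, ← Finset.sum_mul, mul_assoc]

end BirchHessian

/-! ### Davenport's shrinking lemma by packing and symplectic geometry. -/

namespace BirchHessian

open MeasureTheory

/-- The integer points of the cube `[-A, A]ⁿ`. -/
noncomputable def box (n : ℕ) (A : ℝ) : Finset (Fin n → ℤ) :=
  Fintype.piFinset fun _ => Finset.Icc (-⌊A⌋) ⌊A⌋

theorem mem_box {n : ℕ} {A : ℝ} {y : Fin n → ℤ} : y ∈ box n A ↔ ∀ i, |(y i : ℝ)| ≤ A := by
  simp only [box, Fintype.mem_piFinset, Finset.mem_Icc]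
  refine forall_congr' fun i => ?_
  rw [← abs_le, Int.le_floor, Int.cast_abs]

/-- The real number `β` is within `δ` of an integer. -/
def Near (δ β : ℝ) : Prop := ∃ m : ℤ, |β - m| ≤ δ

open Classical in
/-- The integer points `y` of a cube at which the linear forms `L i` are close to integers. -/
noncomputable def nearPoints {n : ℕ} (L : Fin n → Fin n → ℝ) (A δ : ℝ) : Finset (Fin n → ℤ) :=
  (box n A).filter fun y => ∀ i, Near δ (∑ j, L i j * y j)

theorem mem_nearPoints {n : ℕ} {L : Fin n → Fin n → ℝ} {A δ : ℝ} {y : Fin n → ℤ} :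
    y ∈ nearPoints L A δ ↔ (∀ i, |(y i : ℝ)| ≤ A) ∧ ∀ i, Near δ (∑ j, L i j * y j) := by
  simp [nearPoints, mem_box]

/-- The balls of radius `μ / 2` about the points are disjoint and lie in the ball of radius `3 / 2`;
volumes are compared. -/
theorem card_le_of_separated {E : Type*} [NormedAddCommGroup E] [NormedSpace ℝ E]
    [FiniteDimensional ℝ E] (T : Finset E) {μ : ℝ} (hμ0 : 0 < μ) (hμ1 : μ ≤ 1)
    (hT : ∀ x ∈ T, ‖x‖ ≤ 1) (hsep : ∀ x ∈ T, ∀ y ∈ T, x ≠ y → μ < ‖x - y‖) :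
    (T.card : ℝ) ≤ (3 / μ) ^ Module.finrank ℝ E := by
  borelize E
  let ν : Measure E := Measure.addHaar
  have hdisj : (T : Set E).PairwiseDisjoint fun x => Metric.ball x (μ / 2) := by
    intro x hx y hy hxy
    refine Metric.ball_disjoint_ball ?_
    rw [dist_eq_norm]
    linarith [hsep x hx y hy hxy]
  have hsub : (⋃ x ∈ T, Metric.ball x (μ / 2)) ⊆ Metric.ball (0 : E) (3 / 2) := by
    intro z hz
    simp only [Set.mem_iUnion] at hz
    obtain ⟨x, hx, hz⟩ := hz
    rw [mem_ball_zero_iff]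
    rw [mem_ball_iff_norm] at hz
    have := norm_le_norm_add_norm_sub' z x
    linarith [hT x hx]
  have h1 := measure_mono (μ := ν) hsub
  rw [measure_biUnion_finset hdisj fun _ _ => measurableSet_ball] at h1
  simp only [Measure.addHaar_ball_of_pos ν _ (half_pos hμ0)] at h1
  rw [Measure.addHaar_ball_of_pos ν _ (by norm_num : (0 : ℝ) < 3 / 2), Finset.sum_const,
    nsmul_eq_mul, ← mul_assoc] at h1
  have hpos : ν (Metric.ball 0 1) ≠ 0 := (Metric.measure_ball_pos ν _ one_pos).ne'
  have hfin : ν (Metric.ball 0 1) ≠ ⊤ := measure_ball_lt_top.ne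
  rw [ENNReal.mul_le_mul_iff_left hpos hfin, ← ENNReal.ofReal_natCast,
    ← ENNReal.ofReal_mul (Nat.cast_nonneg _), ENNReal.ofReal_le_ofReal_iff (by positivity)] at h1
  have h2 : (3 / μ) ^ Module.finrank ℝ E = (3 / 2) ^ Module.finrank ℝ E / (μ / 2) ^ Module.finrank ℝ E := by
    rw [← div_pow]
    congr 1
    field_simp
  rw [h2, le_div_iff₀ (by positivity)]
  exact h1

/-- The `μ`-neighbourhoods of a maximal `μ`-separated subset cover everything, and packing bounds
the size of that subset. -/
theorem exists_card_le_mul_card_close {ι E : Type*} [NormedAddCommGroup E] [NormedSpace ℝ E]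
    [FiniteDimensional ℝ E] (S : Finset ι) (p : ι → E) {μ : ℝ} (hμ0 : 0 < μ) (hμ1 : μ ≤ 1)
    (hp : ∀ s ∈ S, ‖p s‖ ≤ 1) {N : ℕ} (hN : Module.finrank ℝ E ≤ N) (B : ℕ)
    (hB : ∀ s₀ ∈ S, ∀ T ⊆ S, (∀ s ∈ T, ‖p s - p s₀‖ ≤ μ) → T.card ≤ B) :
    (S.card : ℝ) ≤ (3 / μ) ^ N * B := by
  classical
  let Sep : Finset ι → Prop := fun T => ∀ x ∈ T, ∀ y ∈ T, x ≠ y → μ < ‖p x - p y‖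
  obtain ⟨T, hTmem, hTmax⟩ := Finset.exists_max_image (S.powerset.filter Sep) Finset.card
    ⟨∅, Finset.mem_filter.2 ⟨Finset.empty_mem_powerset S, fun x hx => by simp at hx⟩⟩
  rw [Finset.mem_filter, Finset.mem_powerset] at hTmem
  obtain ⟨hTS, hTsep⟩ := hTmem
  have hcover : ∀ s ∈ S, ∃ t ∈ T, ‖p s - p t‖ ≤ μ := by
    intro s hs
    by_contra! hcon
    have hsT : s ∉ T := fun h => by
      have := hcon s h
      rw [sub_self, norm_zero] at this
      exact absurd this (not_lt.2 hμ0.le)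
    have := hTmax (insert s T) (by
      rw [Finset.mem_filter, Finset.mem_powerset]
      refine ⟨Finset.insert_subset hs hTS, ?_⟩
      intro x hx y hy hxy
      rw [Finset.mem_insert] at hx hy
      rcases hx with rfl | hx <;> rcases hy with rfl | hy
      · exact absurd rfl hxy
      · exact hcon y hy
      · rw [norm_sub_rev]; exact hcon x hx
      · exact hTsep x hx y hy hxy)
    rw [Finset.card_insert_of_notMem hsT] at this
    omega
  have hTinj : Set.InjOn p T := by
    intro x hx y hy hxy
    by_contra hne
    have := hTsep x hx y hy hne
    rw [hxy, sub_self, norm_zero] at this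
    exact absurd this (not_lt.2 hμ0.le)
  have hTcard : (T.card : ℝ) ≤ (3 / μ) ^ N := by
    rw [← Finset.card_image_of_injOn hTinj]
    refine (card_le_of_separated (T.image p) hμ0 hμ1 ?_ ?_).trans ?_
    · intro x hx
      obtain ⟨t, ht, rfl⟩ := Finset.mem_image.1 hx
      exact hp t (hTS ht)
    · intro x hx y hy hxy
      obtain ⟨t, ht, rfl⟩ := Finset.mem_image.1 hx
      obtain ⟨u, hu, rfl⟩ := Finset.mem_image.1 hy
      exact hTsep t ht u hu fun h => hxy (by rw [h])
    · refine pow_le_pow_right₀ ?_ hN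
      rw [le_div_iff₀ hμ0]
      linarith
  have hS : S ⊆ T.biUnion fun t => S.filter fun s => ‖p s - p t‖ ≤ μ := by
    intro s hs
    obtain ⟨t, ht, hst⟩ := hcover s hs
    exact Finset.mem_biUnion.2 ⟨t, ht, Finset.mem_filter.2 ⟨hs, hst⟩⟩
  have h1 : S.card ≤ T.card * B := by
    refine (Finset.card_le_card hS).trans (Finset.card_biUnion_le_card_mul _ _ _ fun t ht => ?_)
    exact hB t (hTS ht) _ (Finset.filter_subset _ _) fun s hs => (Finset.mem_filter.1 hs).2
  calc (S.card : ℝ) ≤ T.card * B := by exact_mod_cast h1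
    _ ≤ _ := by gcongr

/-- The standard symplectic form. -/
noncomputable def symplecticForm (n : ℕ) :
    ((Fin n → ℝ) × (Fin n → ℝ)) →ₗ[ℝ] ((Fin n → ℝ) × (Fin n → ℝ)) →ₗ[ℝ] ℝ :=
  LinearMap.mk₂ ℝ (fun x y => ∑ i, (x.1 i * y.2 i - y.1 i * x.2 i))
    (fun x x' y => by
      rw [← Finset.sum_add_distrib]
      exact Finset.sum_congr rfl fun i _ => by
          simp only [Prod.fst_add, Prod.snd_add, Pi.add_apply]; ring)
    (fun c x y => by
      rw [smul_eq_mul, Finset.mul_sum]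
      exact Finset.sum_congr rfl fun i _ => by
        simp only [Prod.smul_fst, Prod.smul_snd, Pi.smul_apply, smul_eq_mul]; ring)
    (fun x y y' => by
      rw [← Finset.sum_add_distrib]
      exact Finset.sum_congr rfl fun i _ => by
          simp only [Prod.fst_add, Prod.snd_add, Pi.add_apply]; ring)
    (fun c x y => by
      rw [smul_eq_mul, Finset.mul_sum]
      exact Finset.sum_congr rfl fun i _ => by
        simp only [Prod.smul_fst, Prod.smul_snd, Pi.smul_apply, smul_eq_mul]; ring)

theorem symplecticForm_apply {n : ℕ} (x y : (Fin n → ℝ) × (Fin n → ℝ)) :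
    symplecticForm n x y = ∑ i, (x.1 i * y.2 i - y.1 i * x.2 i) := rfl

/-- By nondegeneracy the form embeds `W` into its own annihilator, which has dimension `2n - dim W`.
-/
theorem finrank_le_of_isotropic {n : ℕ} (W : Submodule ℝ ((Fin n → ℝ) × (Fin n → ℝ)))
    (hW : ∀ x ∈ W, ∀ y ∈ W, symplecticForm n x y = 0) : Module.finrank ℝ W ≤ n := by
  classical
  have hinj : Function.Injective (symplecticForm n) := by
    rw [injective_iff_map_eq_zero]
    intro x hx
    refine Prod.ext (funext fun i => ?_) (funext fun i => ?_)
    · have := LinearMap.congr_fun hx (0, Pi.single i 1)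
      rw [symplecticForm_apply, Finset.sum_eq_single i] at this
      · simpa using this
      · intro j _ hj; simp [hj]
      · simp
    · have := LinearMap.congr_fun hx (Pi.single i 1, 0)
      rw [symplecticForm_apply, Finset.sum_eq_single i] at this
      · simpa using this
      · intro j _ hj; simp [hj]
      · simp
  have hle : W.map (symplecticForm n) ≤ W.dualAnnihilator := by
    rintro _ ⟨x, hx, rfl⟩
    rw [Submodule.mem_dualAnnihilator]
    exact hW x hx
  have h1 := Submodule.finrank_mono hle
  rw [← (Submodule.equivMapOfInjective _ hinj W).finrank_eq] at h1
  have h2 := Subspace.finrank_add_finrank_dualAnnihilator_eq W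
  have h3 : Module.finrank ℝ ((Fin n → ℝ) × (Fin n → ℝ)) = n + n := by simp
  have h4 : Module.finrank ℝ W + Module.finrank ℝ W ≤ n + n :=
    ((Nat.add_le_add_left h1 _).trans h2.le).trans h3.le
  omega

/-- Rescaled, a near point together with its distances to integers is a vector of norm at most one
in `W`. Two such vectors within `μ` differ by a near point at the scales `μ * A` and `μ * δ`, so the
cost of shrinking is governed by `dim W` alone. -/
theorem card_nearPoints_le_of_mem {n : ℕ} (L : Fin n → Fin n → ℝ) {A δ μ : ℝ} (hA : 0 < A)
    (hδ : 0 < δ) (hμ0 : 0 < μ) (hμ1 : μ ≤ 1) (m : (Fin n → ℤ) → Fin n → ℤ)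
    (hm : ∀ y ∈ nearPoints L A δ, ∀ i, |∑ j, L i j * y j - m y i| ≤ δ)
    (W : Submodule ℝ ((Fin n → ℝ) × (Fin n → ℝ))) {N : ℕ} (hN : Module.finrank ℝ W ≤ N)
    (hW : ∀ y ∈ nearPoints L A δ,
      (((fun i => (y i : ℝ) / A), fun i => (∑ j, L i j * y j - m y i) / δ) :
        (Fin n → ℝ) × (Fin n → ℝ)) ∈ W) :
    ((nearPoints L A δ).card : ℝ) ≤ (3 / μ) ^ N * (nearPoints L (μ * A) (μ * δ)).card := by
  classical
  let p : nearPoints L A δ → W := fun y => ⟨_, hW y y.2⟩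
  have hcard : ((nearPoints L A δ).attach.card : ℝ) = (nearPoints L A δ).card := by
    rw [Finset.card_attach]
  rw [← hcard]
  refine exists_card_le_mul_card_close (nearPoints L A δ).attach p hμ0 hμ1 ?_ hN _ ?_
  · intro y _
    change ‖((fun i => ((y : Fin n → ℤ) i : ℝ) / A),
      fun i => (∑ j, L i j * (y : Fin n → ℤ) j - m y i) / δ)‖ ≤ 1
    rw [Prod.norm_def, max_le_iff, pi_norm_le_iff_of_nonneg zero_le_one,
      pi_norm_le_iff_of_nonneg zero_le_one]
    constructor
    · intro i
      rw [Real.norm_eq_abs, abs_div, abs_of_pos hA, div_le_one hA]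
      exact (mem_nearPoints.1 y.2).1 i
    · intro i
      rw [Real.norm_eq_abs, abs_div, abs_of_pos hδ, div_le_one hδ]
      exact hm y y.2 i
  · intro y₀ _ T _ hT
    refine Finset.card_le_card_of_injOn (fun y => (y : Fin n → ℤ) - y₀) ?_ ?_
    · intro y hy
      have h1 := hT y hy
      have h2 : ‖(((fun i => ((y : Fin n → ℤ) i : ℝ) / A),
          fun i => (∑ j, L i j * (y : Fin n → ℤ) j - m y i) / δ) : (Fin n → ℝ) × (Fin n → ℝ)) -
          ((fun i => ((y₀ : Fin n → ℤ) i : ℝ) / A),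
          fun i => (∑ j, L i j * (y₀ : Fin n → ℤ) j - m y₀ i) / δ)‖ ≤ μ := h1
      rw [Prod.norm_def, max_le_iff, pi_norm_le_iff_of_nonneg hμ0.le,
        pi_norm_le_iff_of_nonneg hμ0.le] at h2
      rw [Finset.mem_coe, mem_nearPoints]
      constructor
      · intro i
        have h3 := h2.1 i
        change ‖((y : Fin n → ℤ) i : ℝ) / A - ((y₀ : Fin n → ℤ) i : ℝ) / A‖ ≤ μ at h3
        rw [Real.norm_eq_abs, ← sub_div, abs_div, abs_of_pos hA, div_le_iff₀ hA] at h3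
        simpa using h3
      · intro i
        refine ⟨m y i - m y₀ i, ?_⟩
        have h3 := h2.2 i
        change ‖(∑ j, L i j * (y : Fin n → ℤ) j - m y i) / δ -
          (∑ j, L i j * (y₀ : Fin n → ℤ) j - m y₀ i) / δ‖ ≤ μ at h3
        rw [Real.norm_eq_abs, ← sub_div, abs_div, abs_of_pos hδ, div_le_iff₀ hδ] at h3
        have h4 : (∑ j, L i j * (((y : Fin n → ℤ) - y₀ : Fin n → ℤ) j : ℝ)) -
            ((m y i - m y₀ i : ℤ) : ℝ) = (∑ j, L i j * (y : Fin n → ℤ) j - m y i) -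
              (∑ j, L i j * (y₀ : Fin n → ℤ) j - m y₀ i) := by
          simp only [Pi.sub_apply, Int.cast_sub, mul_sub, Finset.sum_sub_distrib]
          ring
        exact h4 ▸ h3
    · intro y _ y' _ hyy
      exact Subtype.ext (sub_left_injective hyy)

theorem exists_near_choice {n : ℕ} (L : Fin n → Fin n → ℝ) (A δ : ℝ) :
    ∃ m : (Fin n → ℤ) → Fin n → ℤ,
      ∀ y ∈ nearPoints L A δ, ∀ i, |∑ j, L i j * y j - m y i| ≤ δ := by
  have h : ∀ y : Fin n → ℤ, ∃ m : Fin n → ℤ, y ∈ nearPoints L A δ →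
      ∀ i, |∑ j, L i j * y j - m i| ≤ δ := by
    intro y
    by_cases hy : y ∈ nearPoints L A δ
    · choose m hm using (mem_nearPoints.1 hy).2
      exact ⟨m, fun _ => hm⟩
    · exact ⟨0, fun h => absurd h hy⟩
  choose m hm using h
  exact ⟨m, hm⟩

/-- By the symmetry of `L`, the symplectic product of two rescaled vectors, multiplied by `A * δ`,
is an integer. It is smaller than one in absolute value, hence zero. The vectors span an isotropic
subspace, so the exponent is `n` and not `2n`. -/
theorem card_nearPoints_le_of_small {n : ℕ} (L : Fin n → Fin n → ℝ) (hL : ∀ i j, L i j = L j i)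
    {A δ μ : ℝ} (hA : 0 < A) (hδ : 0 < δ) (hAδ : 2 * n * (A * δ) < 1) (hμ0 : 0 < μ) (hμ1 : μ ≤ 1) :
    ((nearPoints L A δ).card : ℝ) ≤ (3 / μ) ^ n * (nearPoints L (μ * A) (μ * δ)).card := by
  classical
  obtain ⟨m, hm⟩ := exists_near_choice L A δ
  let p : (Fin n → ℤ) → (Fin n → ℝ) × (Fin n → ℝ) := fun y =>
    ((fun i => (y i : ℝ) / A), fun i => (∑ j, L i j * y j - m y i) / δ)
  let W := Submodule.span ℝ (p '' (nearPoints L A δ : Set (Fin n → ℤ)))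
  have hzero : ∀ y ∈ nearPoints L A δ, ∀ z ∈ nearPoints L A δ, symplecticForm n (p y) (p z) = 0 := by
    intro y hy z hz
    have hsym : ∑ i, ((y i : ℝ) * ∑ j, L i j * z j) = ∑ i, ((z i : ℝ) * ∑ j, L i j * y j) := by
      simp only [Finset.mul_sum]
      rw [Finset.sum_comm]
      refine Finset.sum_congr rfl fun i _ => Finset.sum_congr rfl fun j _ => ?_
      rw [hL i j]; ring
    have h1 : A * δ * symplecticForm n (p y) (p z) = ((∑ i, (z i * m y i - y i * m z i) : ℤ) : ℝ) := by
      rw [symplecticForm_apply, Finset.mul_sum]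
      have h2 : ∀ i, A * δ * ((p y).1 i * (p z).2 i - (p z).1 i * (p y).2 i) =
          ((y i : ℝ) * ∑ j, L i j * z j) - ((z i : ℝ) * ∑ j, L i j * y j) +
            ((z i : ℝ) * m y i - y i * m z i) := by
        intro i
        simp only [p]
        field_simp
        ring
      simp only [h2]
      rw [Finset.sum_add_distrib, Finset.sum_sub_distrib, hsym, sub_self, zero_add]
      push_cast
      rfl
    have h3 : |A * δ * symplecticForm n (p y) (p z)| < 1 := by
      refine lt_of_le_of_lt ?_ hAδ
      rw [symplecticForm_apply, Finset.mul_sum]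
      refine (Finset.abs_sum_le_sum_abs _ _).trans ?_
      have h4 : ∀ i ∈ Finset.univ, |A * δ * ((p y).1 i * (p z).2 i - (p z).1 i * (p y).2 i)| ≤
          2 * (A * δ) := by
        intro i _
        have e1 : A * δ * ((p y).1 i * (p z).2 i - (p z).1 i * (p y).2 i) =
            y i * (∑ j, L i j * z j - m z i) - z i * (∑ j, L i j * y j - m y i) := by
          simp only [p]
          field_simp
        rw [e1]
        refine (abs_sub _ _).trans ?_
        rw [abs_mul, abs_mul]
        have a1 := (mem_nearPoints.1 hy).1 i
        have a2 := (mem_nearPoints.1 hz).1 i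
        have b1 := mul_le_mul a1 (hm z hz i) (abs_nonneg _) hA.le
        have b2 := mul_le_mul a2 (hm y hy i) (abs_nonneg _) hA.le
        linarith
      refine (Finset.sum_le_card_nsmul _ _ _ h4).trans ?_
      rw [Finset.card_univ, Fintype.card_fin, nsmul_eq_mul]
      linarith
    rw [h1, ← Int.cast_abs] at h3
    have h5 : |∑ i, (z i * m y i - y i * m z i)| < 1 := by exact_mod_cast h3
    rw [Int.abs_lt_one_iff.1 h5, Int.cast_zero] at h1
    exact (mul_eq_zero.1 h1).resolve_left (by positivity)
  have hiso : ∀ x ∈ W, ∀ y ∈ W, symplecticForm n x y = 0 := by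
    intro x hx y hy
    refine Submodule.span_induction₂ (p := fun x y _ _ => symplecticForm n x y = 0)
      ?_ ?_ ?_ ?_ ?_ ?_ ?_ hx hy
    · rintro _ _ ⟨a, ha, rfl⟩ ⟨b, hb, rfl⟩
      exact hzero a ha b hb
    · intro y _; rw [map_zero, LinearMap.zero_apply]
    · intro x _; rw [map_zero]
    · intro x y z _ _ _ h1 h2; rw [map_add, LinearMap.add_apply, h1, h2, add_zero]
    · intro x y z _ _ _ h1 h2; rw [map_add, h1, h2, add_zero]
    · intro r x y _ _ h; rw [map_smul, LinearMap.smul_apply, h, smul_zero]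
    · intro r x y _ _ h; rw [map_smul, h, smul_zero]
  exact card_nearPoints_le_of_mem L hA hδ hμ0 hμ1 m hm W (finrank_le_of_isotropic W hiso)
    fun y hy => Submodule.subset_span ⟨y, hy, rfl⟩

theorem nearPoints_mono {n : ℕ} (L : Fin n → Fin n → ℝ) {A A' δ δ' : ℝ} (hA : A ≤ A')
    (hδ : δ ≤ δ') : nearPoints L A δ ⊆ nearPoints L A' δ' := by
  intro y hy
  rw [mem_nearPoints] at hy ⊢
  exact ⟨fun i => (hy.1 i).trans hA, fun i => (hy.2 i).imp fun m hm => hm.trans hδ⟩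

/-- Davenport's shrinking lemma for symmetric systems of linear forms. -/
theorem card_nearPoints_le (n : ℕ) :
    ∃ C : ℝ, 1 ≤ C ∧ ∀ L : Fin n → Fin n → ℝ, (∀ i j, L i j = L j i) →
      ∀ A δ μ : ℝ, 0 < A → 0 < δ → A * δ ≤ 2 → 0 < μ → μ ≤ 1 →
        ((nearPoints L A δ).card : ℝ) ≤
          C * (1 / μ) ^ n * (nearPoints L (μ * A) (μ * δ)).card := by
  -- A first reduction by `c`, made in the full dimension `2n`, costs only a constant. It reaches
  -- the range of `card_nearPoints_le_of_small`, because `2n · c² · 2 < 1`.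
  set c : ℝ := 1 / (2 * n + 1) with hc
  have hn : (0 : ℝ) ≤ n := Nat.cast_nonneg n
  have hc0 : 0 < c := by positivity
  have hc1 : c ≤ 1 := by
    rw [hc, div_le_one (by positivity)]; linarith
  have h3c : 1 ≤ 3 / c := by
    rw [le_div_iff₀ hc0]; linarith
  refine ⟨(3 / c) ^ (n + n) * 3 ^ n, ?_, ?_⟩
  · exact one_le_mul_of_one_le_of_one_le (one_le_pow₀ h3c) (one_le_pow₀ (by norm_num))
  · intro L hL A δ μ hA hδ hAδ hμ0 hμ1
    obtain ⟨m, hm⟩ := exists_near_choice L A δ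
    have h1 := card_nearPoints_le_of_mem L hA hδ hc0 hc1 m hm ⊤ (N := n + n)
      (by rw [finrank_top]; simp) (fun _ _ => Submodule.mem_top)
    have hsmall : 2 * n * (c * A * (c * δ)) < 1 := by
      have e1 : 2 * n * (c * A * (c * δ)) = 2 * n * c ^ 2 * (A * δ) := by ring
      have e2 : 2 * n * c ^ 2 * (A * δ) ≤ 2 * n * c ^ 2 * 2 := by gcongr
      have e3 : 2 * n * c ^ 2 * 2 < 1 := by
        rw [hc, div_pow, one_pow, mul_one_div, div_mul_eq_mul_div, div_lt_one (by positivity)]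
        nlinarith
      linarith
    have h2 := card_nearPoints_le_of_small L hL (mul_pos hc0 hA) (mul_pos hc0 hδ) hsmall hμ0 hμ1
    have h4 : nearPoints L (μ * (c * A)) (μ * (c * δ)) ⊆ nearPoints L (μ * A) (μ * δ) := by
      refine nearPoints_mono L ?_ ?_
      · gcongr; exact mul_le_of_le_one_left hA.le hc1
      · gcongr; exact mul_le_of_le_one_left hδ.le hc1
    have h5 : ((nearPoints L (μ * (c * A)) (μ * (c * δ))).card : ℝ) ≤
        (nearPoints L (μ * A) (μ * δ)).card := by exact_mod_cast Finset.card_le_card h4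
    calc ((nearPoints L A δ).card : ℝ)
        ≤ (3 / c) ^ (n + n) * ((3 / μ) ^ n * (nearPoints L (μ * A) (μ * δ)).card) := by
          refine h1.trans ?_
          gcongr
          refine h2.trans ?_
          gcongr
      _ = _ := by
        rw [div_pow 3 μ, div_pow 1 μ, one_pow]
        ring

end BirchHessian

/-! ### Weyl differencing and geometric exponential sums. -/

namespace BirchHessian

open MvPolynomial

/-- The additive character `x ↦ exp(2πix)`. -/
noncomputable def expChar (x : ℝ) : ℂ := Complex.exp (2 * (Real.pi : ℂ) * Complex.I * (x : ℂ))

theorem expChar_add (x y : ℝ) : expChar (x + y) = expChar x * expChar y := by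
  rw [expChar, expChar, expChar, ← Complex.exp_add]
  congr 1
  push_cast
  ring

theorem norm_expChar (x : ℝ) : ‖expChar x‖ = 1 := by
  have : 2 * (Real.pi : ℂ) * Complex.I * (x : ℂ) = ((2 * Real.pi * x : ℝ) : ℂ) * Complex.I := by
    push_cast; ring
  rw [expChar, this, Complex.norm_exp_ofReal_mul_I]

theorem expChar_zero : expChar 0 = 1 := by simp [expChar]

theorem expChar_sum {ι : Type*} (s : Finset ι) (f : ι → ℝ) :
    expChar (∑ i ∈ s, f i) = ∏ i ∈ s, expChar (f i) := by
  classical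
  induction s using Finset.induction_on with
  | empty => simp [expChar_zero]
  | insert i s hi ih => rw [Finset.sum_insert hi, Finset.prod_insert hi, expChar_add, ih]

theorem expChar_int (m : ℤ) : expChar m = 1 := by
  rw [expChar, Complex.exp_eq_one_iff]
  exact ⟨m, by push_cast; ring⟩

theorem conj_expChar (x : ℝ) : (starRingEnd ℂ) (expChar x) = expChar (-x) := by
  have h : ∀ y : ℝ, 2 * (Real.pi : ℂ) * Complex.I * (y : ℂ) =
      ((2 * Real.pi * y : ℝ) : ℂ) * Complex.I := fun y => by push_cast; ring
  rw [expChar, expChar, ← Complex.exp_conj, h, h, map_mul, Complex.conj_ofReal, Complex.conj_I]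
  congr 1
  push_cast
  ring

/-- Expand the square and put `h = y - x`. The intersection of a box with its translate by `-h` is
again a box, which allows iteration. -/
theorem norm_sum_expChar_sq_le {n p : ℕ} (F : (Fin n → ℤ) → ℝ) (a b : Fin n → ℤ)
    (hab : ∀ i, b i - a i ≤ p) :
    ‖∑ x ∈ Finset.Icc a b, expChar (F x)‖ ^ 2 ≤
      ∑ h ∈ box n p, ‖∑ x ∈ Finset.Icc (a ⊔ (a - h)) (b ⊓ (b - h)),
        expChar (F (x + h) - F x)‖ := by
  classical
  set Q := Finset.Icc a b with hQ
  have h1 : ‖∑ x ∈ Q, expChar (F x)‖ ^ 2 =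
      ‖∑ x ∈ Q, ∑ y ∈ Q, expChar (F y - F x)‖ := by
    have h0 : ‖∑ x ∈ Q, expChar (F x)‖ ^ 2 =
        ‖(starRingEnd ℂ) (∑ x ∈ Q, expChar (F x)) * ∑ x ∈ Q, expChar (F x)‖ := by
      rw [norm_mul, RCLike.norm_conj, sq]
    rw [h0, map_sum, Finset.sum_mul]
    congr 1
    refine Finset.sum_congr rfl fun x _ => ?_
    rw [Finset.mul_sum]
    refine Finset.sum_congr rfl fun y _ => ?_
    rw [conj_expChar, ← expChar_add]
    congr 1
    ring
  have h2 : ∀ x ∈ Q, ∑ y ∈ Q, expChar (F y - F x) =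
      ∑ h ∈ box n p, if x + h ∈ Q then expChar (F (x + h) - F x) else 0 := by
    intro x hx
    rw [← Finset.sum_filter]
    refine Finset.sum_bij' (fun y _ => y - x) (fun h _ => x + h) ?_ ?_ ?_ ?_ ?_
    · intro y hy
      rw [Finset.mem_filter, mem_box]
      refine ⟨fun i => ?_, by simpa using hy⟩
      rw [hQ, Finset.mem_Icc] at hx hy
      have e1 : a i ≤ x i := hx.1 i
      have e2 : x i ≤ b i := hx.2 i
      have e3 : a i ≤ y i := hy.1 i
      have e4 : y i ≤ b i := hy.2 i
      have e5 := hab i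
      have : |(y - x) i| ≤ (p : ℤ) := by
        rw [abs_le, Pi.sub_apply]; constructor <;> omega
      exact_mod_cast this
    · intro h hh; exact (Finset.mem_filter.1 hh).2
    · intro y _; simp
    · intro h _; simp
    · intro y _; simp
  rw [h1, Finset.sum_congr rfl h2, Finset.sum_comm]
  refine (norm_sum_le _ _).trans (Finset.sum_le_sum fun h _ => ?_)
  rw [← Finset.sum_filter]
  refine le_of_eq ?_
  congr 1
  refine Finset.sum_congr ?_ fun _ _ => rfl
  ext x
  simp only [hQ, Finset.mem_filter, Finset.mem_Icc, sup_le_iff, le_inf_iff, sub_le_iff_le_add,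
    le_sub_iff_add_le]
  tauto

theorem sum_piFinset_succ {X M : Type*} [AddCommMonoid M] (k : ℕ) (s : Finset X)
    (G : (Fin (k + 1) → X) → M) :
    ∑ h ∈ Fintype.piFinset (fun _ : Fin (k + 1) => s), G h =
      ∑ y ∈ s, ∑ h ∈ Fintype.piFinset (fun _ : Fin k => s), G (Fin.cons y h) := by
  classical
  rw [← Finset.sum_product']
  refine Finset.sum_bij' (fun h _ => (h 0, Fin.tail h)) (fun yh _ => Fin.cons yh.1 yh.2)
    ?_ ?_ ?_ ?_ ?_
  · intro h hh
    rw [Fintype.mem_piFinset] at hh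
    rw [Finset.mem_product, Fintype.mem_piFinset]
    exact ⟨hh 0, fun j => hh j.succ⟩
  · intro yh hyh
    rw [Finset.mem_product, Fintype.mem_piFinset] at hyh
    rw [Fintype.mem_piFinset]
    exact Fin.cases hyh.1 hyh.2
  · intro h _; exact Fin.cons_self_tail h
  · intro yh _; simp
  · intro h _; rw [Fin.cons_self_tail]

/-- Each step uses one squaring and one power mean inequality. The range of summation shrinks along
the way, so the bound `B` is required for all boxes of side at most `p`. Powers of the cardinality
stand on both sides to avoid division. -/
theorem weyl_differencing {n p : ℕ} (k : ℕ) :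
    ∀ (F : (Fin n → ℤ) → ℝ) (B : (Fin k → Fin n → ℤ) → ℝ),
      (∀ h, ∀ a b : Fin n → ℤ, (∀ i, b i - a i ≤ p) →
        ‖∑ x ∈ Finset.Icc a b, expChar (diffs k h F x)‖ ≤ B h) →
      ∀ a b : Fin n → ℤ, (∀ i, b i - a i ≤ p) →
        ((box n p).card : ℝ) ^ (k + 1) * ‖∑ x ∈ Finset.Icc a b, expChar (F x)‖ ^ 2 ^ k ≤
          ((box n p).card : ℝ) ^ 2 ^ k *
            ∑ h ∈ Fintype.piFinset (fun _ : Fin k => box n p), B h := by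
  induction k with
  | zero =>
    intro F B hB a b hab
    have := hB Fin.elim0 a b hab
    simp only [diffs] at this
    rw [zero_add, pow_one, pow_zero, pow_one, pow_one, Fintype.piFinset_of_isEmpty,
      Finset.univ_unique, Finset.sum_singleton]
    gcongr
    exact this.trans_eq (congrArg B (Subsingleton.elim _ _))
  | succ k ih =>
    intro F B hB a b hab
    set W : ℝ := ((box n p).card : ℝ) with hW
    have hW0 : 0 ≤ W := Nat.cast_nonneg _
    let s : (Fin n → ℤ) → ℝ := fun h => ‖∑ x ∈ Finset.Icc (a ⊔ (a - h)) (b ⊓ (b - h)),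
        expChar (F (x + h) - F x)‖
    have h1 : (‖∑ x ∈ Finset.Icc a b, expChar (F x)‖ ^ 2) ^ 2 ^ k ≤
        (∑ h ∈ box n p, s h) ^ 2 ^ k :=
      pow_le_pow_left₀ (by positivity) (norm_sum_expChar_sq_le F a b hab) _
    have h2 : W * (∑ h ∈ box n p, s h) ^ 2 ^ k ≤ W ^ 2 ^ k * ∑ h ∈ box n p, s h ^ 2 ^ k := by
      obtain ⟨N, hN⟩ : ∃ N, 2 ^ k = N + 1 :=
        ⟨2 ^ k - 1, by have := Nat.one_le_two_pow (n := k); omega⟩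
      have h0 := pow_sum_le_card_mul_sum_pow (s := box n p) (f := s) (fun _ _ => norm_nonneg _) N
      rw [hN, pow_succ' W, mul_assoc]
      exact mul_le_mul_of_nonneg_left h0 hW0
    have h3 : ∀ h ∈ box n p, W ^ (k + 1) * s h ^ 2 ^ k ≤ W ^ 2 ^ k *
        ∑ h' ∈ Fintype.piFinset (fun _ : Fin k => box n p), B (Fin.cons h h') := by
      intro h _
      refine ih (fun x => F (x + h) - F x) (fun h' => B (Fin.cons h h')) ?_ _ _ ?_
      · intro h' a b hab
        have := hB (Fin.cons h h') a b hab
        simpa only [diffs, Fin.tail_cons, Fin.cons_zero] using this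
      · intro i
        have := hab i
        simp only [Pi.inf_apply, Pi.sup_apply, Pi.sub_apply]
        have e1 : b i ⊓ (b i - h i) ≤ b i := inf_le_left
        have e2 : a i ≤ a i ⊔ (a i - h i) := le_sup_left
        omega
    rw [sum_piFinset_succ]
    calc W ^ (k + 1 + 1) * ‖∑ x ∈ Finset.Icc a b, expChar (F x)‖ ^ 2 ^ (k + 1)
        = W ^ (k + 1) * (W * (‖∑ x ∈ Finset.Icc a b, expChar (F x)‖ ^ 2) ^ 2 ^ k) := by
          rw [← pow_mul, ← pow_succ']; ring
      _ ≤ W ^ (k + 1) * (W * (∑ h ∈ box n p, s h) ^ 2 ^ k) := by gcongr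
      _ ≤ W ^ (k + 1) * (W ^ 2 ^ k * ∑ h ∈ box n p, s h ^ 2 ^ k) := by gcongr
      _ = W ^ 2 ^ k * ∑ h ∈ box n p, W ^ (k + 1) * s h ^ 2 ^ k := by
          rw [← Finset.mul_sum]; ring
      _ ≤ W ^ 2 ^ k * ∑ h ∈ box n p, W ^ 2 ^ k *
          ∑ h' ∈ Fintype.piFinset (fun _ : Fin k => box n p), B (Fin.cons h h') := by
          exact mul_le_mul_of_nonneg_left (Finset.sum_le_sum h3) (by positivity)
      _ = _ := by
          rw [← Finset.mul_sum, ← mul_assoc, ← pow_add, ← two_mul, ← pow_succ']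

/-- The bound for a geometric exponential sum whose frequency lies in the `c`-th of `p + 1` equal
parts of the unit interval. -/
noncomputable def cellBound (p c : ℕ) : ℝ := (p + 1) * (1 / (c + 1)) + (p + 1) * (1 / (p - c + 1))

/-- The index of the part of the unit interval containing the fractional part of `β`. -/
noncomputable def cell (p : ℕ) (β : ℝ) : ℕ := ⌊(p + 1) * Int.fract β⌋₊

theorem cell_le (p : ℕ) (β : ℝ) : cell p β ≤ p := by
  have h1 := Int.fract_lt_one β
  have h2 : (p + 1) * Int.fract β < p + 1 := by
    have : (0 : ℝ) < p + 1 := by positivity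
    nlinarith
  have h3 : cell p β < p + 1 := by
    rw [cell, Nat.floor_lt (by have := Int.fract_nonneg β; positivity)]
    exact_mod_cast h2
  omega

theorem norm_geom_sum_mul_le (a b : ℤ) (β : ℝ) :
    ‖∑ x ∈ Finset.Icc a b, expChar (x * β)‖ * ‖expChar β - 1‖ ≤ 2 := by
  rw [← norm_mul, Finset.sum_mul]
  have h1 : ∀ x : ℤ, expChar (x * β) * (expChar β - 1) =
      expChar ((x + 1 : ℤ) * β) - expChar (x * β) := by
    intro x
    rw [mul_sub, mul_one, ← expChar_add]
    congr 2
    push_cast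
    ring
  simp only [h1]
  rcases le_or_gt a b with hab | hab
  · have key : ∀ m : ℕ, ∑ x ∈ Finset.Icc a (a + m), (expChar ((x + 1 : ℤ) * β) - expChar (x * β)) =
        expChar ((a + m + 1 : ℤ) * β) - expChar (a * β) := by
      intro m
      induction m with
      | zero => simp
      | succ m ih =>
        have : Finset.Icc a (a + (m + 1 : ℕ)) = insert (a + m + 1) (Finset.Icc a (a + m)) := by
          ext x
          simp only [Finset.mem_Icc, Finset.mem_insert]
          push_cast
          omega
        rw [this, Finset.sum_insert (by simp), ih]
        push_cast
        ring_nf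
    obtain ⟨m, hm⟩ := Int.eq_ofNat_of_zero_le (sub_nonneg.2 hab)
    have hb : b = a + m := by omega
    rw [hb, key]
    refine (norm_sub_le _ _).trans ?_
    rw [norm_expChar, norm_expChar]
    norm_num
  · rw [Finset.Icc_eq_empty (not_le.2 hab)]
    simp

theorem four_mul_le_norm_expChar_sub_one (β : ℝ) :
    4 * min (Int.fract β) (1 - Int.fract β) ≤ ‖expChar β - 1‖ := by
  set t := Int.fract β with ht
  have ht0 : 0 ≤ t := Int.fract_nonneg β
  have ht1 : t < 1 := Int.fract_lt_one β
  have h1 : expChar β = expChar t := by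
    have : β = t + ⌊β⌋ := (Int.fract_add_floor β).symm
    conv_lhs => rw [this]
    rw [expChar_add, expChar_int, mul_one]
  have h2 : ‖expChar t - 1‖ = 2 * Real.sin (Real.pi * t) := by
    have e1 : expChar t - 1 = expChar (t / 2) * (2 * Complex.I * Real.sin (Real.pi * t)) := by
      have e2 : expChar t = expChar (t / 2) * expChar (t / 2) := by
        rw [← expChar_add]; congr 1; ring
      have e3 : (1 : ℂ) = expChar (t / 2) * expChar (-(t / 2)) := by
        rw [← expChar_add, add_neg_cancel, expChar_zero]
      rw [e2]
      conv_lhs => rw [e3]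
      rw [← mul_sub]
      congr 1
      rw [expChar, expChar, Complex.ofReal_sin, Complex.sin]
      have e4 : 2 * (Real.pi : ℂ) * Complex.I * ((t / 2 : ℝ) : ℂ) =
          ((Real.pi * t : ℝ) : ℂ) * Complex.I := by push_cast; ring
      have e5 : 2 * (Real.pi : ℂ) * Complex.I * ((-(t / 2) : ℝ) : ℂ) =
          -((Real.pi * t : ℝ) : ℂ) * Complex.I := by push_cast; ring
      rw [e4, e5]
      have e6 : Complex.I * Complex.I = -1 := Complex.I_mul_I
      linear_combination (-(Complex.exp (-((Real.pi * t : ℝ) : ℂ) * Complex.I) -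
        Complex.exp (((Real.pi * t : ℝ) : ℂ) * Complex.I))) * e6
    have hs : 0 ≤ Real.sin (Real.pi * t) :=
      Real.sin_nonneg_of_nonneg_of_le_pi (by positivity) (by nlinarith [Real.pi_pos])
    rw [e1, norm_mul, norm_expChar, one_mul, norm_mul, norm_mul, Complex.norm_I, Complex.norm_real,
      Real.norm_eq_abs, abs_of_nonneg hs]
    norm_num
  rw [h1, h2]
  have hsin : ∀ u : ℝ, 0 ≤ u → u ≤ 1 / 2 → 2 * u ≤ Real.sin (Real.pi * u) := by
    intro u hu0 hu1
    have := Real.mul_le_sin (x := Real.pi * u) (by positivity) (by nlinarith [Real.pi_pos])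
    have e : 2 / Real.pi * (Real.pi * u) = 2 * u := by
      field_simp
    linarith
  rcases le_total t (1 / 2) with h | h
  · have := hsin t ht0 h
    have := min_le_left t (1 - t)
    linarith
  · have e1 := hsin (1 - t) (by linarith) (by linarith)
    have e2 : Real.sin (Real.pi * (1 - t)) = Real.sin (Real.pi * t) := by
      rw [mul_sub, mul_one, Real.sin_pi_sub]
    have := min_le_right t (1 - t)
    linarith

/-- The sum is bounded both by its number of terms and by `1 / (2‖β‖)`. The end of the unit interval
nearer to the fractional part of `β` selects which term of `cellBound` is used; the other term is
nonnegative. -/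
theorem norm_geom_sum_le {p : ℕ} {a b : ℤ} (hab : b - a ≤ p) (β : ℝ) :
    ‖∑ x ∈ Finset.Icc a b, expChar (x * β)‖ ≤ cellBound p (cell p β) := by
  set c := cell p β with hc
  set t := Int.fract β with ht
  have hcp : c ≤ p := cell_le p β
  have hcp' : (c : ℝ) ≤ p := by exact_mod_cast hcp
  have ht0 : 0 ≤ t := Int.fract_nonneg β
  have hp : (0 : ℝ) < p + 1 := by positivity
  have h1 : (c : ℝ) ≤ (p + 1) * t := Nat.floor_le (by positivity)
  have h2 : (p + 1) * t < c + 1 := Nat.lt_floor_add_one _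
  set S := ‖∑ x ∈ Finset.Icc a b, expChar (x * β)‖ with hS
  have hS0 : 0 ≤ S := norm_nonneg _
  have htriv : S ≤ p + 1 := by
    refine (norm_sum_le _ _).trans ?_
    simp only [norm_expChar, Finset.sum_const, nsmul_eq_mul, mul_one, Int.card_Icc]
    have : (b + 1 - a).toNat ≤ p + 1 := by omega
    exact_mod_cast this
  have hmain : S * (4 * min t (1 - t)) ≤ 2 :=
    (mul_le_mul_of_nonneg_left (four_mul_le_norm_expChar_sub_one β) hS0).trans
      (norm_geom_sum_mul_le a b β)
  have hA : 0 ≤ (p + 1 : ℝ) * (1 / (c + 1)) := by positivity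
  have hB : 0 ≤ (p + 1 : ℝ) * (1 / (p - c + 1)) := by
    have : (0 : ℝ) < p - c + 1 := by linarith
    positivity
  rw [cellBound]
  rcases le_total t (1 - t) with h | h
  · rw [min_eq_left h] at hmain
    suffices S ≤ (p + 1 : ℝ) * (1 / (c + 1)) by linarith
    rw [mul_one_div, le_div_iff₀ (by positivity)]
    rcases Nat.eq_zero_or_pos c with h0 | h0
    · rw [h0]; simpa using htriv
    · have hc1 : (1 : ℝ) ≤ c := by exact_mod_cast h0
      nlinarith
  · rw [min_eq_right h] at hmain
    suffices S ≤ (p + 1 : ℝ) * (1 / (p - c + 1)) by linarith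
    rw [mul_one_div, le_div_iff₀ (by linarith)]
    rcases Nat.eq_zero_or_pos (p - c) with h0 | h0
    · have : (p : ℝ) = c := by
        have : p = c := by omega
        exact_mod_cast this
      rw [this, sub_self, zero_add, mul_one, ← this]
      exact htriv
    · have hc1 : (1 : ℝ) ≤ p - c := by
        have : c + 1 ≤ p := by omega
        have : ((c + 1 : ℕ) : ℝ) ≤ p := by exact_mod_cast this
        push_cast at this
        linarith
      nlinarith

theorem cellBound_nonneg {p c : ℕ} (hc : c ≤ p) : 0 ≤ cellBound p c := by
  have : (c : ℝ) ≤ p := by exact_mod_cast hc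
  have : (0 : ℝ) < p - c + 1 := by linarith
  rw [cellBound]
  positivity

theorem sum_cellBound_le (p : ℕ) :
    ∑ c ∈ Finset.range (p + 1), cellBound p c ≤ 2 * (p + 1) * (1 + Real.log (p + 1)) := by
  have h1 : ∑ c ∈ Finset.range (p + 1), (1 / ((c : ℝ) + 1)) ≤ 1 + Real.log (p + 1) := by
    have := harmonic_le_one_add_log (p + 1)
    rw [harmonic] at this
    push_cast at this
    simpa using this
  have h2 : ∑ c ∈ Finset.range (p + 1), (1 / ((p : ℝ) - c + 1)) =
      ∑ c ∈ Finset.range (p + 1), (1 / ((c : ℝ) + 1)) := by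
    rw [← Finset.sum_range_reflect]
    refine Finset.sum_congr rfl fun c hc => ?_
    have : c ≤ p := by rw [Finset.mem_range] at hc; omega
    rw [Nat.add_sub_cancel, Nat.cast_sub this, sub_sub_cancel]
  simp only [cellBound]
  rw [Finset.sum_add_distrib, ← Finset.mul_sum, ← Finset.mul_sum, h2]
  have : (0 : ℝ) ≤ p + 1 := by positivity
  nlinarith

theorem norm_linear_sum_le {n p : ℕ} {a b : Fin n → ℤ} (hab : ∀ i, b i - a i ≤ p) (c₀ : ℝ)
    (β : Fin n → ℝ) :
    ‖∑ x ∈ Finset.Icc a b, expChar (c₀ + ∑ i, x i * β i)‖ ≤ ∏ i, cellBound p (cell p (β i)) := by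
  have h1 : ∑ x ∈ Finset.Icc a b, expChar (c₀ + ∑ i, x i * β i) =
      expChar c₀ * ∏ i, ∑ x ∈ Finset.Icc (a i) (b i), expChar (x * β i) := by
    rw [Finset.prod_univ_sum, Finset.mul_sum]
    refine Finset.sum_congr (Pi.Icc_eq a b) fun x _ => ?_
    rw [expChar_add, expChar_sum]
  rw [h1, norm_mul, norm_expChar, one_mul, norm_prod]
  exact Finset.prod_le_prod (fun _ _ => norm_nonneg _) fun i _ => norm_geom_sum_le (hab i) _

theorem near_of_cell_eq {p : ℕ} {β γ : ℝ} (h : cell p β = cell p γ) :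
    Near (1 / (p + 1)) (β - γ) := by
  have hp : (0 : ℝ) < p + 1 := by positivity
  have b0 := Int.fract_nonneg β
  have c0 := Int.fract_nonneg γ
  have b1 : (cell p β : ℝ) ≤ (p + 1) * Int.fract β := Nat.floor_le (by positivity)
  have b2 : (p + 1) * Int.fract β < cell p β + 1 := Nat.lt_floor_add_one _
  have c1 : (cell p γ : ℝ) ≤ (p + 1) * Int.fract γ := Nat.floor_le (by positivity)
  have c2 : (p + 1) * Int.fract γ < cell p γ + 1 := Nat.lt_floor_add_one _
  rw [h] at b1 b2
  refine ⟨⌊β⌋ - ⌊γ⌋, ?_⟩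
  have e : β - γ - ((⌊β⌋ - ⌊γ⌋ : ℤ) : ℝ) = Int.fract β - Int.fract γ := by
    rw [Int.fract, Int.fract]; push_cast; ring
  rw [e, abs_le, neg_le, le_div_iff₀ hp, le_div_iff₀ hp]
  constructor <;> nlinarith

/-- Sort the `y` by the cells of all their frequencies. Two points with equal cells differ by a near
point, which bounds each class; the sum over all cell vectors factors into harmonic sums. -/
theorem sum_prod_cellBound_le {n : ℕ} (p : ℕ) (L : Fin n → Fin n → ℝ) :
    ∑ y ∈ box n p, ∏ i, cellBound p (cell p (∑ j, L i j * y j)) ≤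
      (nearPoints L (2 * p) (1 / (p + 1))).card *
        (2 * (p + 1) * (1 + Real.log (p + 1))) ^ n := by
  classical
  let κ : (Fin n → ℤ) → (Fin n → ℕ) := fun y i => cell p (∑ j, L i j * y j)
  let T := Fintype.piFinset fun _ : Fin n => Finset.range (p + 1)
  have hκ : ∀ y ∈ box n p, κ y ∈ T := fun y _ => by
    rw [Fintype.mem_piFinset]
    exact fun i => Finset.mem_range.2 (Nat.lt_succ_of_le (cell_le _ _))
  rw [← Finset.sum_fiberwise_of_maps_to hκ]
  have hfib : ∀ c ∈ T, ∑ y ∈ (box n p).filter (fun y => κ y = c),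
      ∏ i, cellBound p (cell p (∑ j, L i j * y j)) ≤
      (nearPoints L (2 * p) (1 / (p + 1))).card * ∏ i, cellBound p (c i) := by
    intro c hc
    have h1 : ∀ y ∈ (box n p).filter (fun y => κ y = c),
        ∏ i, cellBound p (cell p (∑ j, L i j * y j)) = ∏ i, cellBound p (c i) := by
      intro y hy
      rw [← (Finset.mem_filter.1 hy).2]
    rw [Finset.sum_congr rfl h1, Finset.sum_const, nsmul_eq_mul]
    have h2 : 0 ≤ ∏ i, cellBound p (c i) := Finset.prod_nonneg fun i _ =>
      cellBound_nonneg (Nat.lt_succ_iff.1 (Finset.mem_range.1 (Fintype.mem_piFinset.1 hc i)))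
    refine mul_le_mul_of_nonneg_right ?_ h2
    rcases ((box n p).filter (fun y => κ y = c)).eq_empty_or_nonempty with he | ⟨y₀, hy₀⟩
    · rw [he]; simp
    · refine Nat.cast_le.2 ?_
      refine Finset.card_le_card_of_injOn (fun y => y - y₀) ?_ (sub_left_injective.injOn)
      intro y hy
      have hy1 := Finset.mem_filter.1 hy
      have hy2 := Finset.mem_filter.1 hy₀
      rw [Finset.mem_coe, mem_nearPoints]
      constructor
      · intro i
        have e1 := mem_box.1 hy1.1 i
        have e2 := mem_box.1 hy2.1 i
        change |((y i - y₀ i : ℤ) : ℝ)| ≤ 2 * p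
        rw [Int.cast_sub]
        refine (abs_sub _ _).trans ?_
        linarith
      · intro i
        have := near_of_cell_eq (congrFun (hy1.2.trans hy2.2.symm) i)
        have e : ∑ j, L i j * ((y - y₀) j : ℤ) = ∑ j, L i j * y j - ∑ j, L i j * y₀ j := by
          simp only [Pi.sub_apply, Int.cast_sub, mul_sub, Finset.sum_sub_distrib]
        exact e ▸ this
  refine (Finset.sum_le_sum hfib).trans ?_
  rw [← Finset.mul_sum]
  refine mul_le_mul_of_nonneg_left ?_ (Nat.cast_nonneg _)
  have h3 := Finset.prod_univ_sum (fun _ : Fin n => Finset.range (p + 1))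
    (fun _ c => cellBound p c)
  rw [← h3, Finset.prod_const, Finset.card_univ, Fintype.card_fin]
  refine pow_le_pow_left₀ ?_ (sum_cellBound_le p) n
  exact Finset.sum_nonneg fun c hc => cellBound_nonneg (Nat.lt_succ_iff.1 (Finset.mem_range.1 hc))

end BirchHessian

/-! ### Weyl's inequality through the shrunken multilinear count. -/

namespace BirchHessian

open MvPolynomial

open Classical in
/-- The tuples of integer points at which the multilinear forms attached to `f` are close to
integers. -/
noncomputable def multiNear {n k : ℕ} (f : MvPolynomial (Fin n) ℝ) (A : Fin k → ℝ) (δ : ℝ) :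
    Finset (Fin k → Fin n → ℤ) :=
  (Fintype.piFinset fun j => box n (A j)).filter fun h =>
    ∀ i, Near δ (apolar f (X i * ∏ j, linForm (castVec (h j))))

theorem mem_multiNear {n k : ℕ} {f : MvPolynomial (Fin n) ℝ} {A : Fin k → ℝ} {δ : ℝ}
    {h : Fin k → Fin n → ℤ} : h ∈ multiNear f A δ ↔ (∀ j i, |(h j i : ℝ)| ≤ A j) ∧
      ∀ i, Near δ (apolar f (X i * ∏ j, linForm (castVec (h j)))) := by
  simp [multiNear, mem_box]

theorem multiNear_mono {n k : ℕ} (f : MvPolynomial (Fin n) ℝ) {A A' : Fin k → ℝ} {δ δ' : ℝ}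
    (hA : ∀ j, A j ≤ A' j) (hδ : δ ≤ δ') : multiNear f A δ ⊆ multiNear f A' δ' := by
  intro h hh
  rw [mem_multiNear] at hh ⊢
  exact ⟨fun j i => (hh.1 j i).trans (hA j), fun i => (hh.2 i).imp fun m hm => hm.trans hδ⟩

/-- The symmetric system of linear forms obtained from `f` by fixing all arguments but two. -/
noncomputable def polarForm {n : ℕ} (f Q : MvPolynomial (Fin n) ℝ) (i j : Fin n) : ℝ :=
  apolar f (X i * (X j * Q))

theorem polarForm_symm {n : ℕ} (f Q : MvPolynomial (Fin n) ℝ) (i j : Fin n) :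
    polarForm f Q i j = polarForm f Q j i := by
  rw [polarForm, polarForm, mul_left_comm]

theorem apolar_eq_sum_polarForm {n : ℕ} (f Q : MvPolynomial (Fin n) ℝ) (i : Fin n)
    (y : Fin n → ℤ) :
    apolar f (X i * (linForm (castVec y) * Q)) = ∑ j, polarForm f Q i j * y j := by
  rw [mul_left_comm, apolar_linForm_mul_eq_sum]
  refine Finset.sum_congr rfl fun j _ => ?_
  rw [polarForm, mul_left_comm, mul_comm]
  rfl

/-- With the other arguments fixed, the condition on the `j`-th is a system of linear forms that is
symmetric, since the two free slots of the polarised form may be exchanged. The shrinking lemma then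
applies fibre by fibre. -/
theorem card_multiNear_le_update {n k : ℕ} {C : ℝ} (hC : 1 ≤ C)
    (hshrink : ∀ L : Fin n → Fin n → ℝ, (∀ i j, L i j = L j i) →
      ∀ A δ μ : ℝ, 0 < A → 0 < δ → A * δ ≤ 2 → 0 < μ → μ ≤ 1 →
        ((nearPoints L A δ).card : ℝ) ≤ C * (1 / μ) ^ n * (nearPoints L (μ * A) (μ * δ)).card)
    (f : MvPolynomial (Fin n) ℝ) (A : Fin k → ℝ) (j : Fin k) {δ μ : ℝ} (hA : 0 < A j)
    (hδ : 0 < δ) (hAδ : A j * δ ≤ 2) (hμ0 : 0 < μ) (hμ1 : μ ≤ 1) :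
    ((multiNear f A δ).card : ℝ) ≤
      C * (1 / μ) ^ n * (multiNear f (Function.update A j (μ * A j)) (μ * δ)).card := by
  classical
  let π : (Fin k → Fin n → ℤ) → (Fin k → Fin n → ℤ) := fun h => Function.update h j 0
  let Q : (Fin k → Fin n → ℤ) → MvPolynomial (Fin n) ℝ := fun g =>
    ∏ m ∈ Finset.univ.erase j, linForm (castVec (g m))
  have hQ : ∀ h : Fin k → Fin n → ℤ, ∏ m, linForm (castVec (h m)) =
      (linForm (castVec (h j)) * Q h : MvPolynomial (Fin n) ℝ) := fun h =>
    (Finset.mul_prod_erase _ _ (Finset.mem_univ j)).symm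
  have hQπ : ∀ h g : Fin k → Fin n → ℤ, π h = π g → Q h = Q g := by
    intro h g hg
    refine Finset.prod_congr rfl fun m hm => ?_
    have h1 := congrFun hg m
    have hne := Finset.ne_of_mem_erase hm
    simp only [π, Function.update_of_ne hne] at h1
    rw [h1]
  set M₁ := multiNear f A δ with hM₁
  set M₂ := multiNear f (Function.update A j (μ * A j)) (μ * δ) with hM₂
  have hππ : ∀ g y, π (Function.update (π g) j y) = π g := fun g y => by simp [π]
  have hfib : ∀ g ∈ M₁.image π, ((M₁.filter fun h => π h = g).card : ℝ) ≤
      C * (1 / μ) ^ n * (M₂.filter fun h => π h = g).card := by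
    intro g hg
    obtain ⟨g₀, hg₀, rfl⟩ := Finset.mem_image.1 hg
    have h1 : (M₁.filter fun h => π h = π g₀).card ≤
        (nearPoints (polarForm f (Q g₀)) (A j) δ).card := by
      refine Finset.card_le_card_of_injOn (fun h => h j) ?_ ?_
      · intro h hh
        obtain ⟨hh1, hh2⟩ := Finset.mem_filter.1 hh
        rw [hM₁, mem_multiNear] at hh1
        rw [Finset.mem_coe, mem_nearPoints]
        refine ⟨hh1.1 j, fun i => ?_⟩
        have := hh1.2 i
        rwa [hQ, hQπ _ _ hh2, apolar_eq_sum_polarForm] at this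
      · intro h hh h' hh' hj
        have e := (Finset.mem_filter.1 hh).2.trans (Finset.mem_filter.1 hh').2.symm
        funext m
        by_cases hm : m = j
        · rw [hm]; exact hj
        · have := congrFun e m
          simpa only [π, Function.update_of_ne hm] using this
    have h2 : (nearPoints (polarForm f (Q g₀)) (μ * A j) (μ * δ)).card ≤
        (M₂.filter fun h => π h = π g₀).card := by
      refine Finset.card_le_card_of_injOn (fun y => Function.update (π g₀) j y) ?_ ?_
      · intro y hy
        rw [Finset.mem_coe, mem_nearPoints] at hy
        rw [Finset.mem_coe, Finset.mem_filter, hM₂, mem_multiNear]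
        refine ⟨⟨fun m i => ?_, fun i => ?_⟩, hππ _ _⟩ <;> beta_reduce
        · by_cases hm : m = j
          · subst hm
            simpa using hy.1 i
          · rw [Function.update_of_ne hm, Function.update_of_ne hm]
            simp only [π, Function.update_of_ne hm]
            exact (mem_multiNear.1 hg₀).1 m i
        · rw [hQ, hQπ _ _ (hππ g₀ y), Function.update_self, apolar_eq_sum_polarForm]
          exact hy.2 i
      · intro y _ y' _ hyy
        simpa using congrFun hyy j
    have h3 := hshrink _ (polarForm_symm f (Q g₀)) (A j) δ μ hA hδ hAδ hμ0 hμ1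
    calc ((M₁.filter fun h => π h = π g₀).card : ℝ)
        ≤ (nearPoints (polarForm f (Q g₀)) (A j) δ).card := by exact_mod_cast h1
      _ ≤ _ := h3
      _ ≤ _ := by gcongr
  have hsum : ∑ g ∈ M₁.image π, (M₂.filter fun h => π h = g).card ≤ M₂.card := by
    rw [Finset.sum_card_fiberwise_eq_card_filter]
    exact Finset.card_filter_le _ _
  calc (M₁.card : ℝ) = ∑ g ∈ M₁.image π, ((M₁.filter fun h => π h = g).card : ℝ) := by
        exact_mod_cast Finset.card_eq_sum_card_image π M₁
    _ ≤ ∑ g ∈ M₁.image π, C * (1 / μ) ^ n * (M₂.filter fun h => π h = g).card :=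
        Finset.sum_le_sum hfib
    _ = C * (1 / μ) ^ n * ((∑ g ∈ M₁.image π, (M₂.filter fun h => π h = g).card : ℕ) : ℝ) := by
        rw [← Finset.mul_sum]; push_cast; rfl
    _ ≤ _ := by gcongr

theorem exists_card_multiNear_le (n k : ℕ) :
    ∃ C : ℝ, 1 ≤ C ∧ ∀ (f : MvPolynomial (Fin n) ℝ) (A δ μ : ℝ), 0 < A → 0 < δ → A * δ ≤ 2 →
      0 < μ → μ ≤ 1 →
      ((multiNear f (fun _ : Fin k => A) δ).card : ℝ) ≤
        C * ((1 / μ) ^ n) ^ k * (multiNear f (fun _ : Fin k => μ * A) (μ ^ k * δ)).card := by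
  obtain ⟨C, hC, hshrink⟩ := card_nearPoints_le n
  refine ⟨C ^ k, one_le_pow₀ hC, fun f A δ μ hA hδ hAδ hμ0 hμ1 => ?_⟩
  -- The first `t` arguments have been shrunk. The condition `A * δ ≤ 2` persists, because the
  -- tolerance only decreases and the next argument still has size `A`.
  have key : ∀ t ≤ k, ((multiNear f (fun _ : Fin k => A) δ).card : ℝ) ≤
      (C * (1 / μ) ^ n) ^ t *
        (multiNear f (fun j : Fin k => if (j : ℕ) < t then μ * A else A) (μ ^ t * δ)).card := by
    intro t
    induction t with
    | zero => intro _; simp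
    | succ t ih =>
      intro ht
      refine (ih (by omega)).trans ?_
      have htk : t < k := ht
      have hle1 : μ ^ t ≤ 1 := pow_le_one₀ hμ0.le hμ1
      have := card_multiNear_le_update hC hshrink f
        (fun j : Fin k => if (j : ℕ) < t then μ * A else A) ⟨t, htk⟩ (δ := μ ^ t * δ) (μ := μ)
        (by simpa using hA) (by positivity)
        (by
          simp only [lt_irrefl, if_false]
          calc A * (μ ^ t * δ) = μ ^ t * (A * δ) := by ring
            _ ≤ 1 * (A * δ) := by gcongr
            _ ≤ 2 := by rw [one_mul]; exact hAδ) hμ0 hμ1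
      have hup : Function.update (fun j : Fin k => if (j : ℕ) < t then μ * A else A) ⟨t, htk⟩
          (μ * (if t < t then μ * A else A)) =
          fun j : Fin k => if (j : ℕ) < t + 1 then μ * A else A := by
        funext j
        by_cases hj : j = ⟨t, htk⟩
        · subst hj; simp
        · rw [Function.update_of_ne hj]
          have : (j : ℕ) ≠ t := fun h => hj (Fin.ext h)
          congr 1
          rw [eq_iff_iff]
          omega
      simp only [hup] at this
      refine (mul_le_mul_of_nonneg_left this (by positivity)).trans_eq ?_
      rw [pow_succ (C * (1 / μ) ^ n), pow_succ' μ, mul_assoc μ, mul_assoc (_ ^ t)]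
  have := key k le_rfl
  simp only [Fin.is_lt, if_true] at this
  rwa [mul_pow] at this

theorem sum_card_nearPoints_le {n e : ℕ} (f : MvPolynomial (Fin n) ℝ) (A δ : ℝ) :
    ∑ h ∈ Fintype.piFinset (fun _ : Fin e => box n A),
      ((nearPoints (polarForm f (∏ m, linForm (castVec (h m)))) A δ).card : ℝ) ≤
      (multiNear f (fun _ : Fin (e + 1) => A) δ).card := by
  classical
  rw [multiNear, Finset.card_filter, sum_piFinset_succ, Finset.sum_comm]
  push_cast
  refine Finset.sum_le_sum fun h _ => ?_
  rw [nearPoints, Finset.card_filter]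
  push_cast
  refine Finset.sum_le_sum fun y _ => le_of_eq ?_
  congr 1
  rw [eq_iff_iff]
  refine forall_congr' fun i => ?_
  rw [Fin.prod_univ_succ]
  simp only [Fin.cons_zero, Fin.cons_succ]
  rw [apolar_eq_sum_polarForm]

theorem box_mono {n : ℕ} {A B : ℝ} (h : A ≤ B) : box n A ⊆ box n B := by
  intro y hy
  rw [mem_box] at hy ⊢
  exact fun i => (hy i).trans h

theorem card_box (n p : ℕ) : ((box n p).card : ℝ) = (2 * p + 1) ^ n := by
  have h : (box n (p : ℝ)).card = (2 * p + 1) ^ n := by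
    rw [box, Fintype.card_piFinset, Finset.prod_const, Finset.card_univ, Fintype.card_fin,
      Int.floor_natCast, Int.card_Icc]
    congr 1
    omega
  rw [h]
  push_cast
  rfl

/-- After `e + 1` differences the phase is affine in `x`, so the inner sum is a product of geometric
sums. Summing over the first step with `sum_prod_cellBound_le` costs logarithms and doubles the
range of that step. -/
theorem pow_norm_sum_le_card_multiNear {n e p : ℕ} (f : MvPolynomial (Fin n) ℝ)
    (hf : DegBound 0 (e + 2) f) (a b : Fin n → ℤ) (hab : ∀ i, b i - a i ≤ p) :
    ((2 * p + 1 : ℝ) ^ n) ^ (e + 2) *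
        ‖∑ x ∈ Finset.Icc a b, expChar (eval (castVec x) f)‖ ^ 2 ^ (e + 1) ≤
      ((2 * p + 1 : ℝ) ^ n) ^ 2 ^ (e + 1) * ((2 * (p + 1) * (1 + Real.log (p + 1))) ^ n *
        (multiNear f (fun _ : Fin (e + 1) => 2 * (p : ℝ)) (1 / (p + 1))).card) := by
  have h1 := weyl_differencing (p := p) (e + 1) (fun x : Fin n → ℤ => eval (castVec x) f)
    (fun h => ∏ i, cellBound p (cell p (apolar f (X i * ∏ j, linForm (castVec (h j))))))
    (by
      intro h a b hab
      have h2 := norm_linear_sum_le hab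
        (diffs (e + 1) h (fun x : Fin n → ℤ => eval (castVec x) f) 0)
        (fun i => apolar f (X i * ∏ j, linForm (castVec (h j))))
      rw [Finset.sum_congr rfl fun x _ => by rw [diffs_eval_eq_affine (e + 1) h f hf x]]
      exact h2) a b hab
  rw [card_box] at h1
  refine h1.trans ?_
  refine mul_le_mul_of_nonneg_left ?_ (by positivity)
  set Y : ℝ := (2 * (p + 1) * (1 + Real.log (p + 1))) ^ n with hY
  have hlog : 0 ≤ Real.log ((p : ℝ) + 1) := Real.log_nonneg (by
    have : (0 : ℝ) ≤ p := Nat.cast_nonneg p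
    linarith)
  have hY0 : 0 ≤ Y := by positivity
  rw [sum_piFinset_succ, Finset.sum_comm]
  have h3 : ∀ h ∈ Fintype.piFinset (fun _ : Fin e => box n p),
      ∑ y ∈ box n p, ∏ i, cellBound p (cell p (apolar f (X i * ∏ j : Fin (e + 1),
        linForm (castVec ((Fin.cons y h : Fin (e + 1) → Fin n → ℤ) j))))) ≤
      Y * (nearPoints (polarForm f (∏ m, linForm (castVec (h m)))) (2 * p) (1 / (p + 1))).card := by
    intro h _
    simp only [Fin.prod_univ_succ, Fin.cons_zero, Fin.cons_succ, apolar_eq_sum_polarForm]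
    rw [mul_comm]
    exact sum_prod_cellBound_le p _
  refine (Finset.sum_le_sum h3).trans ?_
  rw [← Finset.mul_sum]
  refine mul_le_mul_of_nonneg_left ?_ hY0
  refine le_trans ?_ (sum_card_nearPoints_le f (2 * (p : ℝ)) (1 / (p + 1)))
  refine Finset.sum_le_sum_of_subset_of_nonneg ?_ fun _ _ _ => Nat.cast_nonneg _
  refine Fintype.piFinset_subset _ _ fun _ => box_mono ?_
  have : (0 : ℝ) ≤ p := Nat.cast_nonneg p
  linarith

/-- Weyl's inequality in terms of the number of solutions of the auxiliary inequalities. -/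
theorem exists_weyl_bound (n e : ℕ) :
    ∃ C : ℝ, 0 < C ∧ ∀ f : MvPolynomial (Fin n) ℝ, DegBound 0 (e + 2) f → ∀ P : ℝ, 1 ≤ P →
      ∀ η : ℝ, 0 < η → η < 1 → ∀ a b : Fin n → ℤ, (∀ i, b i - a i ≤ (⌊P⌋₊ : ℤ)) →
      ‖∑ x ∈ Finset.Icc a b, expChar (eval (castVec x) f)‖ ^ 2 ^ (e + 1) ≤
        C * P ^ ((n : ℝ) * 2 ^ (e + 1) - n * (e + 1) * η) * (1 + Real.log (2 * P)) ^ n *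
          (multiNear f (fun _ : Fin (e + 1) => 2 * P ^ η)
            (P ^ (-((e : ℝ) + 2) + (e + 1) * η))).card := by
  obtain ⟨C, hC, hshrink⟩ := exists_card_multiNear_le n (e + 1)
  refine ⟨(3 ^ n) ^ 2 ^ (e + 1) * 4 ^ n * C, by positivity, ?_⟩
  intro f hf P hP η hη0 hη1 a b hab
  set p := ⌊P⌋₊ with hp
  have hP0 : 0 < P := by linarith
  have hp1 : 1 ≤ p := Nat.one_le_floor_iff P |>.2 hP
  have hp1' : (1 : ℝ) ≤ p := by exact_mod_cast hp1
  have hpP : (p : ℝ) ≤ P := Nat.floor_le hP0.le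
  have hPp : P < p + 1 := Nat.lt_floor_add_one P
  -- The ratio that takes the range `P` to `P ^ η`. Shrinking is available since `2p · 1/(p + 1) ≤
  -- 2`.
  set μ : ℝ := P ^ (η - 1) with hμ
  have hμ0 : 0 < μ := Real.rpow_pos_of_pos hP0 _
  have hμ1 : μ ≤ 1 := Real.rpow_le_one_of_one_le_of_nonpos hP (by linarith)
  have hweyl := pow_norm_sum_le_card_multiNear f hf a b hab
  have hsh := hshrink f (2 * p) (1 / (p + 1)) μ (by positivity) (by positivity)
    (by rw [mul_one_div, div_le_iff₀ (by positivity)]; linarith) hμ0 hμ1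
  set M := multiNear f (fun _ : Fin (e + 1) => 2 * P ^ η) (P ^ (-((e : ℝ) + 2) + (e + 1) * η))
    with hM
  have hPμ : P * μ = P ^ η := by
    rw [hμ, Real.rpow_sub_one hP0.ne']
    field_simp
  have hsub : multiNear f (fun _ : Fin (e + 1) => μ * (2 * p)) (μ ^ (e + 1) * (1 / (p + 1))) ⊆ M := by
    refine multiNear_mono f (fun _ => ?_) ?_
    · rw [← hPμ]
      nlinarith
    · have e1 : P ^ (-((e : ℝ) + 2) + (e + 1) * η) = μ ^ (e + 1) * (1 / P) := by
        rw [hμ, ← Real.rpow_natCast, ← Real.rpow_mul hP0.le, one_div, ← Real.rpow_neg_one,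
          ← Real.rpow_add hP0]
        congr 1
        push_cast
        ring
      rw [e1]
      gcongr
  have hcard := Nat.cast_le (α := ℝ).2 (Finset.card_le_card hsub)
  set S := ‖∑ x ∈ Finset.Icc a b, expChar (eval (castVec x) f)‖ with hS
  have hS0 : 0 ≤ S := norm_nonneg _
  have hlog0 : 0 ≤ Real.log ((p : ℝ) + 1) := Real.log_nonneg (by linarith)
  have hlog : Real.log ((p : ℝ) + 1) ≤ Real.log (2 * P) :=
    Real.log_le_log (by positivity) (by linarith)
  have h1 : (P ^ n) ^ (e + 2) * S ^ 2 ^ (e + 1) ≤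
      ((3 * P) ^ n) ^ 2 ^ (e + 1) * ((4 * P * (1 + Real.log (2 * P))) ^ n *
        (C * ((1 / μ) ^ n) ^ (e + 1) * M.card)) := by
    calc (P ^ n) ^ (e + 2) * S ^ 2 ^ (e + 1)
        ≤ ((2 * p + 1 : ℝ) ^ n) ^ (e + 2) * S ^ 2 ^ (e + 1) := by
          gcongr
          linarith
      _ ≤ _ := hweyl
      _ ≤ ((3 * P) ^ n) ^ 2 ^ (e + 1) * ((4 * P * (1 + Real.log (2 * P))) ^ n *
        (C * ((1 / μ) ^ n) ^ (e + 1) * M.card)) := by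
          have hL : (0 : ℝ) ≤ 1 + Real.log (2 * P) := by linarith
          have a1 : (2 * p + 1 : ℝ) ≤ 3 * P := by linarith
          have a2 : 2 * ((p : ℝ) + 1) * (1 + Real.log (p + 1)) ≤
              4 * P * (1 + Real.log (2 * P)) :=
            mul_le_mul (by linarith) (by linarith) (by linarith) (by linarith)
          have a3 := hsh.trans (mul_le_mul_of_nonneg_left hcard
            (show 0 ≤ C * ((1 / μ) ^ n) ^ (e + 1) by positivity))
          exact mul_le_mul
            (pow_le_pow_left₀ (by positivity) (pow_le_pow_left₀ (by positivity) a1 _) _)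
            (mul_le_mul (pow_le_pow_left₀ (by positivity) a2 _) a3 (by positivity)
              (by positivity)) (by positivity) (by positivity)
  have h2 : 1 / μ = P ^ (1 - η) := by
    rw [hμ, one_div, ← Real.rpow_neg hP0.le]
    congr 1
    ring
  -- Exponents: `n(e + 2)` on the left is matched by `n` from the geometric sums and `n(e + 1)(1 -
  -- η)` from the shrinking.
  have h3 : P ^ ((n : ℝ) * 2 ^ (e + 1) - n * (e + 1) * η) * (P ^ n) ^ (e + 2) =
      (P ^ n) ^ 2 ^ (e + 1) * P ^ n * ((1 / μ) ^ n) ^ (e + 1) := by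
    have h4 : (2 : ℝ) ^ (e + 1) = ((2 ^ (e + 1) : ℕ) : ℝ) := by push_cast; rfl
    rw [h2, h4]
    generalize 2 ^ (e + 1) = D
    simp only [← Real.rpow_natCast, ← Real.rpow_mul hP0.le]
    simp only [← Real.rpow_add hP0]
    congr 1
    push_cast
    ring
  have hpos : 0 < (P ^ n) ^ (e + 2) := by positivity
  refine le_of_mul_le_mul_left (h1.trans_eq ?_) hpos
  calc ((3 * P) ^ n) ^ 2 ^ (e + 1) * ((4 * P * (1 + Real.log (2 * P))) ^ n *
        (C * ((1 / μ) ^ n) ^ (e + 1) * M.card))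
      = (3 ^ n) ^ 2 ^ (e + 1) * 4 ^ n * C * ((P ^ n) ^ 2 ^ (e + 1) * P ^ n * ((1 / μ) ^ n) ^ (e + 1)) *
          (1 + Real.log (2 * P)) ^ n * M.card := by
        rw [mul_pow, mul_pow, mul_pow, mul_pow]
        ring
    _ = _ := by
      rw [← h3]
      ring

end BirchHessian

/-! ### Rational approximation or an annihilating combination. -/

namespace BirchHessian

open MvPolynomial

/-- Either the vectors span `ℚ^R` and contain a basis, or a nonzero rational functional vanishes on
them and its denominators are cleared. -/
theorem exists_annihilator_or_exists_det_ne_zero {R : ℕ} (𝒱 : Set (Fin R → ℤ)) :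
    (∃ c : Fin R → ℤ, c ≠ 0 ∧ ∀ v ∈ 𝒱, ∑ l, c l * v l = 0) ∨
      ∃ M : Matrix (Fin R) (Fin R) ℤ, (∀ k, M k ∈ 𝒱) ∧ M.det ≠ 0 := by
  classical
  let φ : (Fin R → ℤ) → (Fin R → ℚ) := fun v l => (v l : ℚ)
  by_cases hs : Submodule.span ℚ (φ '' 𝒱) = ⊤
  · right
    obtain ⟨w, hw, hspan, hli⟩ := Submodule.exists_fun_fin_finrank_span_eq ℚ (φ '' 𝒱)
    have hfin : Module.finrank ℚ (Submodule.span ℚ (φ '' 𝒱)) = R := by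
      rw [hs, finrank_top, Module.finrank_fintype_fun_eq_card, Fintype.card_fin]
    choose v hv hvw using hw
    let t := finCongr hfin.symm
    refine ⟨Matrix.of fun k => v (t k), fun k => hv _, fun h0 => ?_⟩
    have h1 : LinearIndependent ℚ ((Matrix.of fun k => v (t k)).map (Int.cast : ℤ → ℚ)).row := by
      have h2 := hli.comp t t.injective
      rwa [show w = fun i => φ (v i) from funext fun i => (hvw i).symm] at h2
    rw [Matrix.linearIndependent_rows_iff_isUnit, Matrix.isUnit_iff_isUnit_det] at h1
    refine h1.ne_zero ?_
    rw [show ((Matrix.of fun k => v (t k)).map (Int.cast : ℤ → ℚ)) =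
      (Int.castRingHom ℚ).mapMatrix (Matrix.of fun k => v (t k)) from rfl, ← RingHom.map_det, h0,
      map_zero]
  · left
    obtain ⟨f, hf0, hf⟩ := Submodule.exists_le_ker_of_lt_top _ (lt_top_iff_ne_top.2 hs)
    obtain ⟨b, hb⟩ := IsLocalization.exist_integer_multiples_of_finite (nonZeroDivisors ℤ)
      (fun l : Fin R => f (Pi.single l 1))
    choose c hc using hb
    have hb0 : ((b : ℤ) : ℚ) ≠ 0 := Int.cast_ne_zero.2 (nonZeroDivisors.ne_zero b.2)
    have hc' : ∀ l, (c l : ℚ) = (b : ℤ) * f (Pi.single l 1) := fun l => by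
      have := hc l
      rw [zsmul_eq_mul] at this
      exact this
    have hfx : ∀ x : Fin R → ℚ, f x = ∑ l, x l * f (Pi.single l 1) := fun x => by
      rw [LinearMap.pi_apply_eq_sum_univ f x]
      refine Finset.sum_congr rfl fun l _ => ?_
      rw [smul_eq_mul]
      congr 2
      funext j
      simp [Pi.single_apply, eq_comm]
    refine ⟨c, fun h0 => hf0 (LinearMap.ext fun x => ?_), fun v hv => ?_⟩
    · rw [hfx, LinearMap.zero_apply]
      refine Finset.sum_eq_zero fun l _ => ?_
      have := hc' l
      rw [h0, Pi.zero_apply, Int.cast_zero, eq_comm, mul_eq_zero] at this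
      rw [this.resolve_left hb0, mul_zero]
    · have h1 : f (φ v) = 0 := hf (Submodule.subset_span ⟨v, hv, rfl⟩)
      rw [hfx] at h1
      have h2 : ((∑ l, c l * v l : ℤ) : ℚ) = 0 := by
        push_cast
        rw [← mul_zero ((b : ℤ) : ℚ), ← h1, Finset.mul_sum]
        refine Finset.sum_congr rfl fun l _ => ?_
        rw [hc' l]
        ring
      exact_mod_cast h2

/-- Rational approximations from approximate solutions of a nonsingular integral linear system. -/
theorem exists_approx_of_det_ne_zero {r : ℕ} (M : Matrix (Fin (r + 1)) (Fin (r + 1)) ℤ)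
    (hM : M.det ≠ 0) {E δ : ℝ} (hE : ∀ k l, |(M k l : ℝ)| ≤ E) (α : Fin (r + 1) → ℝ)
    (m : Fin (r + 1) → ℤ) (hm : ∀ k, |∑ l, α l * (M k l : ℝ) - m k| ≤ δ) :
    ∃ (q : ℤ) (a : Fin (r + 1) → ℤ), 1 ≤ q ∧ (q : ℝ) ≤ (r + 1).factorial * E ^ (r + 1) ∧
      ∀ l, |(q : ℝ) * α l - a l| ≤ (r + 1).factorial * E ^ r * δ := by
  have hE0 : 0 ≤ E := (abs_nonneg _).trans (hE 0 0)
  have habs : ∀ {t : ℕ} (N : Matrix (Fin t) (Fin t) ℤ), (∀ k l, |(N k l : ℝ)| ≤ E) →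
      |(N.det : ℝ)| ≤ t.factorial * E ^ t := by
    intro t N hN
    have := Matrix.det_le (A := N.map (Int.cast : ℤ → ℝ)) (abv := AbsoluteValue.abs) (x := E) hN
    rw [Fintype.card_fin, nsmul_eq_mul] at this
    rwa [show N.map (Int.cast : ℤ → ℝ) = (Int.castRingHom ℝ).mapMatrix N from rfl,
      ← RingHom.map_det] at this
  have hdet := habs M hE
  have hadj : ∀ l k, |(M.adjugate l k : ℝ)| ≤ r.factorial * E ^ r := by
    intro l k
    rw [Matrix.adjugate_fin_succ_eq_det_submatrix]
    rw [Int.cast_mul, Int.cast_pow, Int.cast_neg, Int.cast_one, abs_mul, abs_pow, abs_neg,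
      abs_one, one_pow, one_mul]
    exact habs _ fun _ _ => hE _ _
  -- Cramer's rule: the adjugate applied to `M α - m`, so `det M` serves as denominator up to sign.
  have hmul : ∀ l, (M.det : ℝ) * α l - ((∑ k, M.adjugate l k * m k : ℤ) : ℝ) =
      ∑ k, (M.adjugate l k : ℝ) * (∑ l, α l * (M k l : ℝ) - m k) := by
    intro l
    have h1 : ∀ l', ∑ k, (M.adjugate l k : ℝ) * (M k l' : ℝ) =
        if l = l' then (M.det : ℝ) else 0 := by
      intro l'
      have h2 := congrFun (congrFun (Matrix.adjugate_mul M) l) l'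
      rw [Matrix.mul_apply, Matrix.smul_apply, Matrix.one_apply, smul_eq_mul, mul_ite, mul_one,
        mul_zero] at h2
      have h3 := congrArg (Int.cast : ℤ → ℝ) h2
      simp only [Int.cast_sum, Int.cast_mul, Int.cast_ite, Int.cast_zero] at h3
      exact h3
    simp only [mul_sub, Finset.sum_sub_distrib, Finset.mul_sum]
    rw [Finset.sum_comm]
    simp only [Int.cast_sum, Int.cast_mul]
    congr 1
    have h4 : ∀ l', ∑ k, (M.adjugate l k : ℝ) * (α l' * (M k l' : ℝ)) =
        α l' * if l = l' then (M.det : ℝ) else 0 := by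
      intro l'
      rw [← h1, Finset.mul_sum]
      exact Finset.sum_congr rfl fun k _ => by ring
    simp only [h4, mul_ite, mul_zero, Finset.sum_ite_eq, Finset.mem_univ, if_true]
    ring
  have hbd : ∀ l, |(M.det : ℝ) * α l - ((∑ k, M.adjugate l k * m k : ℤ) : ℝ)| ≤
      (r + 1).factorial * E ^ r * δ := by
    intro l
    rw [hmul]
    calc |∑ k, (M.adjugate l k : ℝ) * (∑ l, α l * (M k l : ℝ) - m k)|
        ≤ ∑ k, |(M.adjugate l k : ℝ) * (∑ l, α l * (M k l : ℝ) - m k)| :=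
          Finset.abs_sum_le_sum_abs _ _
      _ ≤ ∑ _k : Fin (r + 1), (r.factorial * E ^ r) * δ := by
          refine Finset.sum_le_sum fun k _ => ?_
          rw [abs_mul]
          exact mul_le_mul (hadj l k) (hm k) (abs_nonneg _) (by positivity)
      _ = (r + 1).factorial * E ^ r * δ := by
          rw [Finset.sum_const, Finset.card_univ, Fintype.card_fin, nsmul_eq_mul,
            Nat.factorial_succ]
          push_cast
          ring
  rcases lt_or_gt_of_ne hM with h | h
  · refine ⟨-M.det, fun l => -∑ k, M.adjugate l k * m k, by omega, ?_, fun l => ?_⟩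
    · rw [Int.cast_neg]
      exact (neg_le_abs _).trans hdet
    · rw [← abs_neg]
      convert hbd l using 2
      rw [Int.cast_neg, Int.cast_neg]
      ring
  · exact ⟨M.det, fun l => ∑ k, M.adjugate l k * m k, h, (le_abs_self _).trans hdet, hbd⟩

/-- Dividing by the common divisor increases neither the denominator nor the errors. -/
theorem exists_coprime_approx {R : ℕ} {q : ℤ} (hq : 1 ≤ q) (a : Fin R → ℤ) (α : Fin R → ℝ)
    {T U : ℝ} (hqT : (q : ℝ) ≤ T) (hU : ∀ l, |(q : ℝ) * α l - a l| ≤ U) :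
    ∃ (q' : ℤ) (a' : Fin R → ℤ), Int.gcd q' (Finset.univ.gcd a') = 1 ∧ 1 ≤ q' ∧ (q' : ℝ) ≤ T ∧
      ∀ l, |(q' : ℝ) * α l - a' l| ≤ U := by
  set g := Int.gcd q (Finset.univ.gcd a) with hg
  have hg0 : 0 < g := Int.gcd_pos_of_ne_zero_left _ (by omega)
  obtain ⟨q', hq'⟩ : (g : ℤ) ∣ q := Int.gcd_dvd_left _ _
  have hga : ∀ l, (g : ℤ) ∣ a l := fun l =>
    (Int.gcd_dvd_right _ _).trans (Finset.gcd_dvd (Finset.mem_univ l))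
  choose a' ha' using hga
  have hg1 : (1 : ℝ) ≤ g := by exact_mod_cast hg0
  have hq'1 : 1 ≤ q' := by
    have h1 : 0 < (g : ℤ) * q' := by omega
    exact pos_of_mul_pos_right h1 (by omega)
  have hq'0 : (0 : ℝ) ≤ q' := by exact_mod_cast (by omega : 0 ≤ q')
  refine ⟨q', a', ?_, hq'1, ?_, fun l => ?_⟩
  · have h1 : Finset.univ.gcd a = g * Finset.univ.gcd a' := by
      rw [show a = fun l => (g : ℤ) * a' l from funext ha', Finset.gcd_mul_left,
        Int.normalize_of_nonneg (by omega)]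
    rw [h1, hq', Int.gcd_mul_left, Int.natAbs_natCast] at hg
    exact Nat.eq_of_mul_eq_mul_left hg0 (by rw [← hg, mul_one])
  · refine le_trans ?_ hqT
    rw [hq']
    push_cast
    nlinarith
  · refine le_trans ?_ (hU l)
    rw [hq', ha' l]
    push_cast
    rw [mul_assoc, ← mul_sub, abs_mul, Nat.abs_cast]
    exact le_mul_of_one_le_left (abs_nonneg _) hg1

theorem exists_abs_apolar_le {n k : ℕ} (f : MvPolynomial (Fin n) ℤ) :
    ∃ C : ℝ, 0 ≤ C ∧ ∀ (h : Fin k → Fin n → ℤ) (A : ℝ), (∀ j i, |(h j i : ℝ)| ≤ A) → ∀ i,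
      |(apolar f (X i * ∏ j, linForm (h j)) : ℝ)| ≤ C * A ^ k := by
  classical
  refine ⟨∑ i, ∑ κ : Fin k → Fin n, |(apolar f (X i * ∏ j, X (κ j)) : ℝ)|,
    Finset.sum_nonneg fun _ _ => Finset.sum_nonneg fun _ _ => abs_nonneg _, fun h A hA i => ?_⟩
  have h1 : apolar f (X i * ∏ j, linForm (h j)) =
      ∑ κ : Fin k → Fin n, (∏ j, h j (κ j)) * apolar f (X i * ∏ j, X (κ j)) := by
    simp only [linForm]
    rw [Finset.prod_univ_sum, Finset.mul_sum, map_sum, Fintype.piFinset_univ]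
    refine Finset.sum_congr rfl fun κ _ => ?_
    rw [Finset.prod_mul_distrib, ← map_prod, mul_left_comm, ← smul_eq_C_mul, map_smul, smul_eq_mul]
  rw [h1]
  push_cast
  calc |∑ κ : Fin k → Fin n, (∏ j, (h j (κ j) : ℝ)) * (apolar f (X i * ∏ j, X (κ j)) : ℝ)|
      ≤ ∑ κ : Fin k → Fin n, |(∏ j, (h j (κ j) : ℝ)) * (apolar f (X i * ∏ j, X (κ j)) : ℝ)| :=
        Finset.abs_sum_le_sum_abs _ _
    _ ≤ ∑ κ : Fin k → Fin n, |(apolar f (X i * ∏ j, X (κ j)) : ℝ)| * A ^ k := by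
        refine Finset.sum_le_sum fun κ _ => ?_
        rw [abs_mul, mul_comm]
        refine mul_le_mul_of_nonneg_left ?_ (abs_nonneg _)
        rw [Finset.abs_prod]
        refine (Finset.prod_le_prod (fun _ _ => abs_nonneg _) fun j _ => hA j (κ j)).trans_eq ?_
        simp
    _ = (∑ κ : Fin k → Fin n, |(apolar f (X i * ∏ j, X (κ j)) : ℝ)|) * A ^ k := by
        rw [Finset.sum_mul]
    _ ≤ _ := by
        rcases Nat.eq_zero_or_pos k with rfl | hk
        · rw [pow_zero, mul_one, mul_one]
          exact Finset.single_le_sum (f := fun i => ∑ κ : Fin 0 → Fin n,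
            |(apolar f (X i * ∏ j, X (κ j)) : ℝ)|)
            (fun _ _ => Finset.sum_nonneg fun _ _ => abs_nonneg _) (Finset.mem_univ i)
        · have hA0 : 0 ≤ A := (abs_nonneg _).trans (hA ⟨0, hk⟩ i)
          refine mul_le_mul_of_nonneg_right ?_ (by positivity)
          exact Finset.single_le_sum (f := fun i => ∑ κ : Fin k → Fin n,
            |(apolar f (X i * ∏ j, X (κ j)) : ℝ)|)
            (fun _ _ => Finset.sum_nonneg fun _ _ => abs_nonneg _) (Finset.mem_univ i)

/-- The real linear combination of integral polynomials. -/
noncomputable def realComb {n R : ℕ} (F : Fin R → MvPolynomial (Fin n) ℤ) (α : Fin R → ℝ) :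
    MvPolynomial (Fin n) ℝ :=
  ∑ l, α l • map (Int.castRingHom ℝ) (F l)

theorem map_X_mul_prod_linForm {n k : ℕ} (i : Fin n) (h : Fin k → Fin n → ℤ) :
    map (Int.castRingHom ℝ) (X i * ∏ j, linForm (h j)) =
      X i * ∏ j, linForm (castVec (h j)) := by
  rw [map_mul, map_X, map_prod]
  simp only [map_linForm]
  rfl

theorem apolar_realComb {n R k : ℕ} (F : Fin R → MvPolynomial (Fin n) ℤ) (α : Fin R → ℝ)
    (i : Fin n) (h : Fin k → Fin n → ℤ) :
    apolar (realComb F α) (X i * ∏ j, linForm (castVec (h j))) =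
      ∑ l, α l * (apolar (F l) (X i * ∏ j, linForm (h j)) : ℝ) := by
  rw [realComb, apolar_sum_smul]
  refine Finset.sum_congr rfl fun l _ => ?_
  rw [← map_X_mul_prod_linForm, apolar_map]
  rfl

/-- Either the coefficients `α` admit a simultaneous rational approximation, or the multilinear
forms attached to a nontrivial integral combination of the `F l` vanish at all points at which
those attached to `∑ l, α l • F l` are near integers. -/
theorem exists_approx_or_annihilator {n r e : ℕ} (F : Fin (r + 1) → MvPolynomial (Fin n) ℤ) :
    ∃ C : ℝ, ∀ (P : ℝ), 1 ≤ P → ∀ (α : Fin (r + 1) → ℝ) (η : ℝ),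
      (∃ c : Fin (r + 1) → ℤ, c ≠ 0 ∧
        ∀ h ∈ multiNear (realComb F α) (fun _ : Fin (e + 1) => 2 * P ^ η)
          (P ^ (-((e : ℝ) + 2) + (e + 1) * η)),
          ∀ i, apolar (linComb F c) (X i * ∏ j, linForm (h j)) = 0) ∨
      ∃ (q : ℤ) (a : Fin (r + 1) → ℤ), Int.gcd q (Finset.univ.gcd a) = 1 ∧ 1 ≤ q ∧
        (q : ℝ) ≤ C * P ^ (((r : ℝ) + 1) * (e + 1) * η) ∧
        ∀ l, |(q : ℝ) * α l - a l| ≤ C * P ^ (-((e : ℝ) + 2) + (r + 1) * (e + 1) * η) := by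
  choose CF hCF0 hCF using fun l => exists_abs_apolar_le (k := e + 1) (F l)
  -- The power of `2` comes from the range `2 * P ^ η` of the `e + 1` arguments. The summand `1`
  -- ensures `C₀ ^ r ≤ C₀ ^ (r + 1)`, so one constant serves both bounds.
  set C₀ : ℝ := 1 + (∑ l, CF l) * 2 ^ (e + 1) with hC₀
  have hsum0 : 0 ≤ ∑ l, CF l := Finset.sum_nonneg fun l _ => hCF0 l
  have hC₀1 : 1 ≤ C₀ := by
    have : 0 ≤ (∑ l, CF l) * 2 ^ (e + 1) := by positivity
    linarith
  refine ⟨(r + 1).factorial * C₀ ^ (r + 1), fun P hP α η => ?_⟩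
  have hP0 : 0 < P := by linarith
  set 𝓜 := multiNear (realComb F α) (fun _ : Fin (e + 1) => 2 * P ^ η)
    (P ^ (-((e : ℝ) + 2) + (e + 1) * η)) with h𝓜
  rcases exists_annihilator_or_exists_det_ne_zero
    {v : Fin (r + 1) → ℤ | ∃ h ∈ 𝓜, ∃ i, v = fun l => apolar (F l) (X i * ∏ j, linForm (h j))}
    with ⟨c, hc, hv⟩ | ⟨M, hM, hdet⟩
  · refine Or.inl ⟨c, hc, fun h hh i => ?_⟩
    rw [linComb, apolar_sum_smul]
    exact hv _ ⟨h, hh, i, rfl⟩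
  · right
    choose h hh i hi using hM
    have hnear : ∀ k, ∃ m : ℤ, |∑ l, α l * (M k l : ℝ) - m| ≤
        P ^ (-((e : ℝ) + 2) + (e + 1) * η) := by
      intro k
      have := (mem_multiNear.1 (hh k)).2 (i k)
      rw [apolar_realComb] at this
      rw [hi k]
      exact this
    choose m hm using hnear
    set E : ℝ := C₀ * (P ^ η) ^ (e + 1) with hE
    have hME : ∀ k l, |(M k l : ℝ)| ≤ E := by
      intro k l
      rw [hi k]
      refine (hCF l (h k) (2 * P ^ η) (mem_multiNear.1 (hh k)).1 (i k)).trans ?_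
      rw [mul_pow, ← mul_assoc]
      refine mul_le_mul_of_nonneg_right ?_ (by positivity)
      have : CF l ≤ ∑ l, CF l := Finset.single_le_sum (fun l _ => hCF0 l) (Finset.mem_univ l)
      have : CF l * 2 ^ (e + 1) ≤ (∑ l, CF l) * 2 ^ (e + 1) :=
        mul_le_mul_of_nonneg_right this (by positivity)
      linarith
    obtain ⟨q, a, hq, hqE, hqa⟩ := exists_approx_of_det_ne_zero M hdet hME α m hm
    refine exists_coprime_approx hq a α (hqE.trans_eq ?_) fun l => (hqa l).trans ?_
    · rw [hE, mul_pow, ← mul_assoc]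
      congr 1
      simp only [← Real.rpow_natCast, ← Real.rpow_mul hP0.le]
      congr 1
      push_cast
      ring
    · have h1 : ((P ^ η) ^ (e + 1)) ^ r * P ^ (-((e : ℝ) + 2) + (e + 1) * η) =
          P ^ (-((e : ℝ) + 2) + (r + 1) * (e + 1) * η) := by
        simp only [← Real.rpow_natCast, ← Real.rpow_mul hP0.le, ← Real.rpow_add hP0]
        congr 1
        push_cast
        ring
      rw [hE, mul_pow, ← mul_assoc, mul_assoc (_ * _), h1]
      refine mul_le_mul_of_nonneg_right ?_ (by positivity)
      exact mul_le_mul_of_nonneg_left (pow_le_pow_right₀ hC₀1 (by omega)) (by positivity)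

end BirchHessian

/-! ### Lattice points of boxes, logarithms, and the final estimate. -/

namespace BirchHessian

open MvPolynomial

theorem exists_eq_Icc_of_ordConnected {J : Set ℤ} (hJ : J.OrdConnected) {N : ℕ}
    (hN : ∀ x ∈ J, ∀ y ∈ J, x - y ≤ N) : ∃ a b : ℤ, J = Set.Icc a b ∧ b - a ≤ N := by
  rcases J.eq_empty_or_nonempty with rfl | ⟨x₀, hx₀⟩
  · exact ⟨1, 0, by simp, by omega⟩
  · have hA : BddAbove J := ⟨x₀ + N, fun x hx => by have := hN x hx x₀ hx₀; omega⟩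
    have hB : BddBelow J := ⟨x₀ - N, fun x hx => by have := hN x₀ hx₀ x hx; omega⟩
    have ha := Int.csInf_mem ⟨x₀, hx₀⟩ hB
    have hb := Int.csSup_mem ⟨x₀, hx₀⟩ hA
    exact ⟨sInf J, sSup J, Set.Subset.antisymm
      (fun x hx => ⟨csInf_le hB hx, le_csSup hA hx⟩) (hJ.out ha hb), hN _ hb _ ha⟩

theorem exists_latticePoints_eq_Icc {n : ℕ} {B : Set (Fin n → ℝ)} (hB : IsBox B) {P : ℝ}
    (hP : 0 < P) : ∃ a b : Fin n → ℤ, latticePoints B P = ↑(Finset.Icc a b) ∧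
      ∀ i, b i - a i ≤ (⌊P⌋₊ : ℤ) := by
  obtain ⟨I, hI, rfl⟩ := hB
  have key : ∀ i, ∃ a b : ℤ, {m : ℤ | P⁻¹ * (m : ℝ) ∈ I i} = Set.Icc a b ∧
      b - a ≤ (⌊P⌋₊ : ℤ) := by
    intro i
    refine exists_eq_Icc_of_ordConnected ⟨fun x hx y hy z hz => ?_⟩ fun x hx y hy => ?_
    · refine (hI i).1.out hx hy ⟨?_, ?_⟩
      · exact mul_le_mul_of_nonneg_left (Int.cast_le.2 hz.1) (inv_nonneg.2 hP.le)
      · exact mul_le_mul_of_nonneg_left (Int.cast_le.2 hz.2) (inv_nonneg.2 hP.le)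
    · have h1 := (le_abs_self _).trans ((hI i).2.2 _ hx _ hy)
      rw [← mul_sub, inv_mul_le_iff₀ hP, mul_one] at h1
      rw [Int.natCast_floor_eq_floor hP.le]
      exact Int.le_floor.2 (by push_cast; exact h1)
  choose a b hab hle using key
  refine ⟨a, b, ?_, hle⟩
  ext x
  have h1 : x ∈ latticePoints (Set.univ.pi I) P ↔ ∀ i, x i ∈ {m : ℤ | P⁻¹ * (m : ℝ) ∈ I i} := by
    rw [latticePoints, Set.mem_ofPred_eq, Set.mem_smul_set_iff_inv_smul_mem₀ hP.ne']
    simp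
  rw [h1, Finset.coe_Icc, ← Set.pi_univ_Icc, Set.mem_univ_pi]
  simp only [hab]

theorem eval_realComb {n R : ℕ} (F : Fin R → MvPolynomial (Fin n) ℤ) (α : Fin R → ℝ)
    (x : Fin n → ℤ) :
    eval (castVec x) (realComb F α) = ∑ l, α l * ((eval x (F l) : ℤ) : ℝ) := by
  rw [realComb, map_sum]
  refine Finset.sum_congr rfl fun l _ => ?_
  rw [smul_eval, eval_map]
  congr 1
  exact (eval₂_comp (Int.castRingHom ℝ) x (F l)).symm

theorem isHomogeneous_realComb {n R d : ℕ} {F : Fin R → MvPolynomial (Fin n) ℤ}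
    (hF : ∀ l, (F l).IsHomogeneous d) (α : Fin R → ℝ) : (realComb F α).IsHomogeneous d :=
  IsHomogeneous.sum _ _ _ fun l _ => by
    rw [smul_eq_C_mul]
    simpa using (isHomogeneous_C _ (α l)).mul ((hF l).map _)

theorem isHomogeneous_linComb {n R d : ℕ} {F : Fin R → MvPolynomial (Fin n) ℤ}
    (hF : ∀ l, (F l).IsHomogeneous d) (c : Fin R → ℤ) : (linComb F c).IsHomogeneous d :=
  IsHomogeneous.sum _ _ _ fun l _ => by
    rw [smul_eq_C_mul]
    simpa using (isHomogeneous_C _ (c l)).mul (hF l)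

theorem expSum_eq_sum_expChar {n R : ℕ} (F : Fin R → MvPolynomial (Fin n) ℤ)
    {B : Set (Fin n → ℝ)} {P : ℝ} (α : Fin R → ℝ) {s : Finset (Fin n → ℤ)}
    (h : latticePoints B P = ↑s) :
    expSum F B P α = ∑ x ∈ s, expChar (eval (castVec x) (realComb F α)) := by
  rw [expSum, h, finsum_mem_coe_finset]
  refine Finset.sum_congr rfl fun x _ => ?_
  rw [eval_realComb, expChar]

theorem one_add_log_pow_le {n : ℕ} {t : ℝ} (ht : 0 < t) {P : ℝ} (hP : 1 ≤ P) :
    (1 + Real.log (2 * P)) ^ n ≤ (2 + (n + 1) / t) ^ n * P ^ t := by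
  have hP0 : 0 < P := by linarith
  -- Dividing by `n + 1` rather than `n` keeps `s` meaningful for `n = 0`, and still `s * n ≤ t`.
  set s : ℝ := t / (n + 1) with hs
  have hs0 : 0 < s := by positivity
  have h1 : Real.log (2 * P) ≤ 1 + P ^ s / s := by
    rw [Real.log_mul two_ne_zero hP0.ne']
    have := Real.log_le_rpow_div hP0.le hs0
    have := Real.log_two_lt_d9
    linarith
  have h2 : 0 ≤ Real.log (2 * P) := Real.log_nonneg (by linarith)
  have h3 : 1 ≤ P ^ s := Real.one_le_rpow hP hs0.le
  have h4 : (n + 1) / t = 1 / s := by rw [hs, one_div_div]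
  have h5 : 1 + Real.log (2 * P) ≤ (2 + (n + 1) / t) * P ^ s := by
    rw [h4, add_mul, one_div_mul_eq_div]
    linarith
  calc (1 + Real.log (2 * P)) ^ n ≤ ((2 + (n + 1) / t) * P ^ s) ^ n :=
        pow_le_pow_left₀ (by linarith) h5 n
    _ = (2 + (n + 1) / t) ^ n * P ^ (s * n) := by
        rw [mul_pow, Real.rpow_mul hP0.le, Real.rpow_natCast]
    _ ≤ (2 + (n + 1) / t) ^ n * P ^ t := by
        refine mul_le_mul_of_nonneg_left (Real.rpow_le_rpow_of_exponent_le hP ?_) (by positivity)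
        rw [hs, div_mul_eq_mul_div, div_le_iff₀ (by positivity)]
        nlinarith

theorem le_max_one_mul_of_pow_le {x y c : ℝ} {D : ℕ} (hD : D ≠ 0) (hy : 0 ≤ y)
    (h : x ^ D ≤ c * y ^ D) : x ≤ max 1 c * y := by
  refine le_of_pow_le_pow_left₀ hD (by positivity) (h.trans ?_)
  rw [mul_pow]
  refine mul_le_mul_of_nonneg_right ?_ (by positivity)
  exact (le_max_right 1 c).trans (le_self_pow₀ (le_max_left 1 c) hD)

theorem exists_nat_sigma {n R : ℕ} (hR : 0 < R) (d : ℕ) (F : Fin R → MvPolynomial (Fin n) ℤ) :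
    ∃ k : ℕ, sigma d F = k ∧ k ≤ n ∧
      ∀ c : Fin R → ℤ, c ≠ 0 → hessianInvariant d (linComb F c) ≤ k := by
  have h := isGreatest_sigma hR d F
  obtain ⟨c, -, hc⟩ := h.1
  have h0 : 0 ≤ sigma d F := hc ▸ hessianInvariant_nonneg d _
  have hn : sigma d F ≤ n := hc ▸ hessianInvariant_le d _
  obtain ⟨k, hk⟩ := Int.eq_ofNat_of_zero_le h0
  exact ⟨k, hk, by omega, fun c hc => hk ▸ h.2 ⟨c, hc, rfl⟩⟩

/-- The bound for the exponential sum in terms of `sigma`, when the multilinear forms of a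
nontrivial integral combination vanish at all points at which those attached to `∑ l, α l • F l`
are near integers. -/
theorem exists_norm_expSum_le (n e : ℕ) :
    ∃ C₁ : ℝ → ℝ, ∀ (R : ℕ) (_ : 0 < R) (F : Fin R → MvPolynomial (Fin n) ℤ),
      (∀ l, (F l).IsHomogeneous (e + 2)) → ∀ B : Set (Fin n → ℝ), IsBox B → ∀ P : ℝ, 1 ≤ P →
        ∀ (α : Fin R → ℝ) (η : ℝ), 0 < η → η < 1 →
          (∃ c : Fin R → ℤ, c ≠ 0 ∧
            ∀ h ∈ multiNear (realComb F α) (fun _ : Fin (e + 1) => 2 * P ^ η)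
              (P ^ (-((e : ℝ) + 2) + (e + 1) * η)),
              ∀ i, apolar (linComb F c) (X i * ∏ j, linForm (h j)) = 0) →
          ∀ ε : ℝ, 0 < ε → ‖expSum F B P α‖ ≤
            C₁ ε * P ^ ((n : ℝ) - ((n : ℝ) - (sigma (e + 2) F : ℝ)) * η / (2 : ℝ) ^ (e + 1) + ε) := by
  obtain ⟨Cw, hCw, hweyl⟩ := exists_weyl_bound n e
  obtain ⟨Cz, hzeros⟩ := exists_card_multilinear_zeros_le n e
  -- Nothing here depends on `R` or `F`: the exponent of `3` uses `σ ≤ n`. Before the root of order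
  -- `2 ^ (e + 1)` is taken, the logarithms may cost `P ^ (ε * 2 ^ (e + 1))`.
  refine ⟨fun ε => max 1 (Cw * (Cz * 3 ^ (e * n + n)) *
    (2 + (n + 1) / (ε * 2 ^ (e + 1))) ^ n), ?_⟩
  intro R hR F hF B hB P hP α η hη0 hη1 ⟨c, hc, hvan⟩ ε hε
  have hP0 : 0 < P := by linarith
  obtain ⟨a, b, hBox, hab⟩ := exists_latticePoints_eq_Icc hB hP0
  obtain ⟨k, hk, hkn, hkc⟩ := exists_nat_sigma hR (e + 2) F
  have hS := hweyl (realComb F α) (DegBound.of_isHomogeneous (isHomogeneous_realComb hF α)) P hP η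
    hη0 hη1 a b hab
  rw [← expSum_eq_sum_expChar F α hBox] at hS
  set M := multiNear (realComb F α) (fun _ : Fin (e + 1) => 2 * P ^ η)
    (P ^ (-((e : ℝ) + 2) + (e + 1) * η)) with hM
  have hPη : 1 ≤ P ^ η := Real.one_le_rpow hP hη0.le
  have hcard := hzeros (linComb F c) (isHomogeneous_linComb hF c) k (hkc c hc) ⌊2 * P ^ η⌋₊ M
    (fun h hh j i => by
      have h1 := (mem_multiNear.1 hh).1 j i
      rw [Int.natCast_floor_eq_floor (by positivity)]
      exact Int.le_floor.2 (by push_cast; exact h1)) hvan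
  have hcard' : (M.card : ℝ) ≤ Cz * 3 ^ (e * n + n) * P ^ (η * (e * n + k)) := by
    have h1 : (⌊2 * P ^ η⌋₊ : ℝ) + 1 ≤ 3 * P ^ η := by
      have := Nat.floor_le (show 0 ≤ 2 * P ^ η by positivity)
      linarith
    calc (M.card : ℝ) ≤ Cz * ((⌊2 * P ^ η⌋₊ : ℝ) + 1) ^ (e * n + k) := by exact_mod_cast hcard
      _ ≤ Cz * (3 * P ^ η) ^ (e * n + k) := by gcongr
      _ = Cz * 3 ^ (e * n + k) * P ^ (η * (e * n + k)) := by
          rw [mul_pow, ← Real.rpow_natCast (P ^ η), ← Real.rpow_mul hP0.le]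
          push_cast
          ring
      _ ≤ _ := by
          gcongr
          norm_num
  refine le_max_one_mul_of_pow_le (D := 2 ^ (e + 1)) (by positivity) (by positivity) ?_
  have hlog := one_add_log_pow_le (n := n) (t := ε * 2 ^ (e + 1)) (by positivity) hP
  have hlog0 : 0 ≤ Real.log (2 * P) := Real.log_nonneg (by linarith)
  refine hS.trans ((mul_le_mul (mul_le_mul_of_nonneg_left hlog (by positivity)) hcard'
    (by positivity) (by positivity)).trans_eq ?_)
  -- The saving `n(e + 1)η` from Weyl's inequality, less the cost `(en + σ)η` of the zeros, leaves
  -- `(n - σ)η`.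
  have hexp : P ^ ((n : ℝ) * 2 ^ (e + 1) - n * (e + 1) * η) * P ^ (ε * 2 ^ (e + 1)) *
      P ^ (η * (e * n + k)) =
      (P ^ ((n : ℝ) - ((n : ℝ) - (sigma (e + 2) F : ℝ)) * η / (2 : ℝ) ^ (e + 1) + ε)) ^
        2 ^ (e + 1) := by
    rw [← Real.rpow_natCast _ (2 ^ (e + 1)), ← Real.rpow_mul hP0.le, ← Real.rpow_add hP0,
      ← Real.rpow_add hP0, hk]
    congr 1
    push_cast
    have : (2 : ℝ) ^ (e + 1) ≠ 0 := by positivity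
    generalize (2 : ℝ) ^ (e + 1) = D at this
    field_simp
    ring
  rw [← hexp]
  ring

end BirchHessian

theorem lemma2p2 (n d : ℕ) (hd : 2 ≤ d) :
    -- `C₁ ε` depends only on `d`, `n` and `ε`
    ∃ C₁ : ℝ → ℝ, ∀ (R : ℕ) (_ : 0 < R) (F : Fin R → MvPolynomial (Fin n) ℤ),
      (∀ l, (F l).IsHomogeneous d) →
      -- `C₂` depends only on `d`, `n`, `R` and `F`
      ∃ C₂ : ℝ, ∀ (B : Set (Fin n → ℝ)), BirchHessian.IsBox B →
        ∀ (P : ℝ), 1 ≤ P → ∀ (α : Fin R → ℝ) (η : ℝ), 0 < η → η < 1 →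
          (∀ ε : ℝ, 0 < ε →
            ‖BirchHessian.expSum F B P α‖ ≤
              C₁ ε * P ^ ((n : ℝ) -
                ((n : ℝ) - (BirchHessian.sigma d F : ℝ)) * η / (2 : ℝ) ^ (d - 1) + ε)) ∨
          (∃ (q : ℤ) (a : Fin R → ℤ),
            Int.gcd q (Finset.univ.gcd a) = 1 ∧
            1 ≤ q ∧ (q : ℝ) ≤ C₂ * P ^ ((R : ℝ) * ((d : ℝ) - 1) * η) ∧
            ∀ l, |(q : ℝ) * α l - (a l : ℝ)| ≤
              C₂ * P ^ (-(d : ℝ) + (R : ℝ) * ((d : ℝ) - 1) * η)) := by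
  obtain ⟨e, rfl⟩ := Nat.exists_eq_add_of_le' hd
  obtain ⟨C₁, hC₁⟩ := BirchHessian.exists_norm_expSum_le n e
  refine ⟨C₁, fun R hR F hF => ?_⟩
  obtain ⟨r, rfl⟩ := Nat.exists_eq_add_of_le' hR
  obtain ⟨C₂, hC₂⟩ := BirchHessian.exists_approx_or_annihilator (e := e) F
  refine ⟨C₂, fun B hB P hP α η hη0 hη1 => ?_⟩
  -- The dichotomy does not involve `ε`, so the annihilator yields (i) for all `ε` at once.
  rcases hC₂ P hP α η with h | h
  · exact Or.inl (hC₁ (r + 1) hR F hF B hB P hP α η hη0 hη1 h)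
  · right
    have h1 : ((e + 2 : ℕ) : ℝ) - 1 = e + 1 := by push_cast; ring
    have h2 : ((e + 2 : ℕ) : ℝ) = e + 2 := by push_cast; ring
    have h3 : ((r + 1 : ℕ) : ℝ) = r + 1 := by push_cast; ring
    rw [h1, h2, h3]
    exact h
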